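/- **Setting.** Let $S$ be a string of length $n>0$ over the alphabet $\{0,\dots,\sigma-1\}$. A sequence of windows $S[i_t..j_t]$, $t=0,\dots,T$, is *valid* if $i_0=j_0=0$, $0\le i_t\le j_t\le n-1$ for all $t$, and for every $t>0$ either $(i_t,j_t)=(i_{t-1}+1,j_{t-1})$ (the leftmost character is deleted) or $(i_t,j_t)=(i_{t-1},j_{t-1}+1)$ (a character is appended). Let $d$ be an upper bound on the lengths of all windows, and let $d'$ be the maximum, over all windows, of the number of distinct palindromes (including the empty one) in the window. The *eertree* of a string $W$ has one ordinary node $v$ for each nonempty palindrome $\mathrm{pal}(v)$ occurring in $W$, with $\mathrm{len}(v)=|\mathrm{pal}(v)|$, and two auxiliary nodes, the $0$-node and the $-1$-node, with $\mathrm{pal}=\varepsilon$ and $\mathrm{len}=0$ and $-1$, respectively. There is an edge from $u$ to $v$ iff $\mathrm{len}(u)+2=\mathrm{len}(v)$ and $\mathrm{pal}(u)=\mathrm{pal}(v)[1..\mathrm{len}(v)-2]$; it is labeled by the character $\mathrm{pal}(v)[0]$. The suffix link of a node $v$ with $\mathrm{len}(v)\ge 2$ is the node of the longest palindromic proper suffix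 of $\mathrm{pal}(v)$; it is the $0$-node if $\mathrm{len}(v)=1$, and the $-1$-node if $v$ is one of the auxiliary nodes. An eertree is *stored* if each node $v$ is an object of $\sigma+O(1)$ words of memory that contains $\mathrm{len}(v)$, a pointer to its suffix link, for ordinary nodes a pointer to the parent and the label of the edge from it, and an array of size $\sigma$ whose entry for a character $c$ is a pointer to the child along the edge labeled $c$ (or a null pointer), the objects being disjoint and the two auxiliary nodes being directly accessible. The model is the word RAM with words of $w$ bits, where $2^w\ge C(n+d\sigma)$ for a constant $C$, with uninitialized memory, with unit-cost operations, and with read-only random access to the characters of the current window. The algorithm is given $\sigma$ and $d$ and then the append and delete operations one by one. **Theorem.** There is a single algorithm that, for all $\sigma$, all $S$, all valid sequences of windows and all $d$ as above, stores the eertree of $S[i_t..j_t]$ at each time $t$, in a total of $O(n+d'\sigma)$ time, using a memory of $(d'+1)\sigma+O(d')+d\in O(d\sigma)$ words. Moreover, all node objects that are ever used lie in a fixed set of at most $d'+1$ pairwise disjoint places of $\sigma+O(1)$ words each (places of removed nodes are reused). The constants in the $O$-notation are absolute. -/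

import Mathlib

/-! ### Strings, windows, palindromes -/

/-- The substring `S[i..j]` (0-based, both ends included; empty if `i > j`). -/
def substr {α : Type} (S : List α) (i j : ℕ) : List α :=
  (S.drop i).take (j + 1 - i)

/-- The set of all distinct palindromes occurring in `W`, including the empty one. -/
def DPal {α : Type} (W : List α) : Set (List α) :=
  {p | p.Palindrome ∧ p <:+: W}

/-- `S[lo t .. hi t]`, for `t = 0, …, T`, is a sliding window over `S`: it starts as `S[0..0]`,
it is always a nonempty substring of `S`, and every step either appends the next character on the
right or deletes the leftmost character. -/
structure IsSlidingWindow {α : Type} (S : List α) (lo hi : ℕ → ℕ) (T : ℕ) : Prop where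
  lo_zero : lo 0 = 0
  hi_zero : hi 0 = 0
  lo_le_hi : ∀ t ≤ T, lo t ≤ hi t
  hi_lt : ∀ t ≤ T, hi t < S.length
  step : ∀ t < T, (lo (t + 1) = lo t + 1 ∧ hi (t + 1) = hi t) ∨
    (lo (t + 1) = lo t ∧ hi (t + 1) = hi t + 1)

/-- The maximum, over the windows at times `0, …, T`, of the number of distinct palindromes
(the empty one included) in the window. -/
noncomputable def maxPal {α : Type} (S : List α) (lo hi : ℕ → ℕ) (T : ℕ) : ℕ :=
  (Finset.range (T + 1)).sup fun t => (DPal (substr S (lo t) (hi t))).ncard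

/-! ### Eertrees -/

/-- Candidates for nodes of an eertree: the `-1`-node, the `0`-node, and ordinary nodes,
which are identified with their palindromes. -/
inductive ENode (α : Type) where
  | neg : ENode α
  | zero : ENode α
  | ord (p : List α) : ENode α

namespace ENode

variable {α : Type}

/-- `pal(v)` -/
def pal : ENode α → List α
  | neg => []
  | zero => []
  | ord p => p

/-- `len(v)` -/
def len : ENode α → ℤ
  | neg => -1
  | zero => 0
  | ord p => p.length

/-- `v` is a node of the eertree of `W`. -/
def IsNode (W : List α) : ENode α → Prop
  | neg => True
  | zero => True
  | ord p => p ≠ [] ∧ p ∈ DPal W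

/-- There is an edge from `u` to `v` with label `c`: `len(u) + 2 = len(v)`,
`pal(u) = pal(v)[1..len(v)-2]` and `c = pal(v)[0]`. -/
def IsEdge (u : ENode α) (c : α) (v : ENode α) : Prop :=
  u.len + 2 = v.len ∧ u.pal = v.pal.tail.dropLast ∧ v.pal.head? = some c

/-- `q` is the longest palindromic proper suffix of `p`. -/
def IsLongestPalProperSuffix (q p : List α) : Prop :=
  (q.Palindrome ∧ q <:+ p ∧ q ≠ p) ∧
    ∀ q' : List α, q'.Palindrome → q' <:+ p → q' ≠ p → q'.length ≤ q.length

/-- `slink(v) = u` -/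
def IsSuffixLink : ENode α → ENode α → Prop
  | neg, u => u = neg
  | zero, u => u = neg
  | ord p, u => (p.length = 1 ∧ u = zero) ∨
      (2 ≤ p.length ∧ ∃ q, u = ord q ∧ IsLongestPalProperSuffix q p)

end ENode

/-! ### A word RAM

Words are natural numbers below `2 ^ w`. A program has finitely many registers (those that it
names) and a random access memory of `M` words; a memory access outside the first `M` words is an
error. The text is read-only, and only the characters in the current window can be read. -/

/-- Expressions over registers. -/
inductive RExpr where
  | const (k : ℕ) : RExpr
  | reg (r : ℕ) : RExpr
  | add (e₁ e₂ : RExpr) : RExpr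
  | sub (e₁ e₂ : RExpr) : RExpr
  | mul (e₁ e₂ : RExpr) : RExpr
  | div (e₁ e₂ : RExpr) : RExpr
  | mod (e₁ e₂ : RExpr) : RExpr

/-- Conditions in tests. -/
inductive RTest where
  | lt (e₁ e₂ : RExpr) : RTest
  | eq (e₁ e₂ : RExpr) : RTest

/-- Programs. `branch` is if-then-else and `loop` is a while loop. -/
inductive Cmd where
  | skip : Cmd
  | set (r : ℕ) (e : RExpr) : Cmd
  | load (r : ℕ) (addr : RExpr) : Cmd
  | store (addr e : RExpr) : Cmd
  | readChar (r : ℕ) (pos : RExpr) : Cmd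
  | seq (c₁ c₂ : Cmd) : Cmd
  | branch (b : RTest) (c₁ c₂ : Cmd) : Cmd
  | loop (b : RTest) (c : Cmd) : Cmd

/-- Contents of the registers and of the memory. -/
structure RState where
  reg : ℕ → ℕ
  mem : ℕ → ℕ

/-- What a program runs on: word size `w`, number `M` of available memory words, the text, and
the ends of the current window. -/
structure REnv (σ : ℕ) where
  w : ℕ
  M : ℕ
  text : List (Fin σ)
  lo : ℕ
  hi : ℕ

namespace RExpr

/-- Value of an expression in `w`-bit arithmetic (subtraction is cut off at `0`). -/
def eval (w : ℕ) (reg : ℕ → ℕ) : RExpr → ℕ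
  | const k => k % 2 ^ w
  | .reg r => reg r
  | add e₁ e₂ => (e₁.eval w reg + e₂.eval w reg) % 2 ^ w
  | sub e₁ e₂ => e₁.eval w reg - e₂.eval w reg
  | mul e₁ e₂ => (e₁.eval w reg * e₂.eval w reg) % 2 ^ w
  | div e₁ e₂ => e₁.eval w reg / e₂.eval w reg
  | mod e₁ e₂ => e₁.eval w reg % e₂.eval w reg

/-- Time to evaluate an expression: one unit for every operation and operand. -/
def cost : RExpr → ℕ
  | const _ => 1
  | reg _ => 1
  | add e₁ e₂ => e₁.cost + e₂.cost + 1
  | sub e₁ e₂ => e₁.cost + e₂.cost + 1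
  | mul e₁ e₂ => e₁.cost + e₂.cost + 1
  | div e₁ e₂ => e₁.cost + e₂.cost + 1
  | mod e₁ e₂ => e₁.cost + e₂.cost + 1

end RExpr

namespace RTest

/-- Truth of a condition. -/
def Holds (w : ℕ) (reg : ℕ → ℕ) : RTest → Prop
  | lt e₁ e₂ => e₁.eval w reg < e₂.eval w reg
  | eq e₁ e₂ => e₁.eval w reg = e₂.eval w reg

/-- Time to evaluate a condition. -/
def cost : RTest → ℕ
  | lt e₁ e₂ => e₁.cost + e₂.cost + 1
  | eq e₁ e₂ => e₁.cost + e₂.cost + 1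

end RTest

/-- `Exec E c s t s'`: started in state `s`, the program `c` runs without error and stops after
exactly `t` time units in state `s'`. -/
inductive Exec {σ : ℕ} (E : REnv σ) : Cmd → RState → ℕ → RState → Prop where
  | skip (s : RState) : Exec E .skip s 1 s
  | set (s : RState) (r : ℕ) (e : RExpr) :
      Exec E (.set r e) s (e.cost + 1)
        { s with reg := Function.update s.reg r (e.eval E.w s.reg) }
  | load (s : RState) (r : ℕ) (a : RExpr) (ha : a.eval E.w s.reg < E.M) :
      Exec E (.load r a) s (a.cost + 1)
        { s with reg := Function.update s.reg r (s.mem (a.eval E.w s.reg)) }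
  | store (s : RState) (a e : RExpr) (ha : a.eval E.w s.reg < E.M) :
      Exec E (.store a e) s (a.cost + e.cost + 1)
        { s with mem := Function.update s.mem (a.eval E.w s.reg) (e.eval E.w s.reg) }
  | readChar (s : RState) (r : ℕ) (p : RExpr) (hlo : E.lo ≤ p.eval E.w s.reg)
      (hhi : p.eval E.w s.reg ≤ E.hi) (hlt : p.eval E.w s.reg < E.text.length) :
      Exec E (.readChar r p) s (p.cost + 1)
        { s with reg := Function.update s.reg r (E.text[p.eval E.w s.reg] : Fin σ).val }
  | seq {s s' s'' : RState} {t t' : ℕ} {c₁ c₂ : Cmd} (h₁ : Exec E c₁ s t s')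
      (h₂ : Exec E c₂ s' t' s'') : Exec E (.seq c₁ c₂) s (t + t') s''
  | branchTrue {s s' : RState} {t : ℕ} {b : RTest} {c₁ c₂ : Cmd} (hb : b.Holds E.w s.reg)
      (h : Exec E c₁ s t s') : Exec E (.branch b c₁ c₂) s (b.cost + t) s'
  | branchFalse {s s' : RState} {t : ℕ} {b : RTest} {c₁ c₂ : Cmd} (hb : ¬ b.Holds E.w s.reg)
      (h : Exec E c₂ s t s') : Exec E (.branch b c₁ c₂) s (b.cost + t) s'
  | loopStop {s : RState} {b : RTest} {c : Cmd} (hb : ¬ b.Holds E.w s.reg) :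
      Exec E (.loop b c) s b.cost s
  | loopStep {s s' s'' : RState} {t t' : ℕ} {b : RTest} {c : Cmd} (hb : b.Holds E.w s.reg)
      (h₁ : Exec E c s t s') (h₂ : Exec E (.loop b c) s' t' s'') :
      Exec E (.loop b c) s (b.cost + t + t') s''

/-! ### Maintaining eertrees -/

/-- An algorithm for a sliding window: a program for the initial window, a program that is run
after a character has been appended, and a program that is run after the leftmost character has
been deleted. Registers `zeroReg` and `negReg` point to the `0`-node and the `-1`-node, and every
node object has `extra` words besides its array of child pointers. -/
structure WindowAlgorithm where
  start : Cmd
  append : Cmd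
  delete : Cmd
  zeroReg : ℕ
  negReg : ℕ
  extra : ℕ
  four_le_extra : 4 ≤ extra

/-- A pool of places for node objects: pairwise disjoint blocks of `σ + extra` words in a memory
of `M` words. Address `0` is not used, since `0` is the null pointer. -/
structure IsPool (σ extra M : ℕ) (pool : Finset ℕ) : Prop where
  pos : ∀ a ∈ pool, 0 < a
  fits : ∀ a ∈ pool, a + (σ + extra) ≤ M
  disjoint : ∀ a ∈ pool, ∀ b ∈ pool, a < b → a + (σ + extra) ≤ b

/-- State `s` contains the eertree of `W`, the node `v` being stored at address `addr v`, which is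
one of the places in `pool`. The object at address `a` consists of the words
* `a`: the number `len(v) + 1`,
* `a + 1`: a pointer to `slink(v)`,
* `a + 2` and `a + 3`: for ordinary nodes, a pointer to the parent and the label of the edge from
  the parent,
* `a + 4 + c`, for every character `c < σ`: a pointer to the child along the edge labeled `c`, or
  the null pointer `0` if there is no such child,

and of further words for internal use. -/
structure StoresEertree {σ : ℕ} (A : WindowAlgorithm) (pool : Finset ℕ) (W : List (Fin σ))
    (s : RState) (addr : ENode (Fin σ) → ℕ) : Prop where
  mem_pool : ∀ v, v.IsNode W → addr v ∈ pool
  inj : ∀ u v, u.IsNode W → v.IsNode W → addr u = addr v → u = v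
  zero : s.reg A.zeroReg = addr .zero
  neg : s.reg A.negReg = addr .neg
  len : ∀ v, v.IsNode W → (s.mem (addr v) : ℤ) = v.len + 1
  slink : ∀ v, v.IsNode W →
    ∃ u, u.IsNode W ∧ v.IsSuffixLink u ∧ s.mem (addr v + 1) = addr u
  parent : ∀ u c v, u.IsNode W → v.IsNode W → u.IsEdge c v →
    s.mem (addr v + 2) = addr u ∧ s.mem (addr v + 3) = c.val
  child : ∀ u c v, u.IsNode W → v.IsNode W → u.IsEdge c v →
    s.mem (addr u + 4 + c.val) = addr v
  no_child : ∀ u c, u.IsNode W → (∀ v, v.IsNode W → ¬ u.IsEdge c v) →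
    s.mem (addr u + 4 + c.val) = 0

/-- `s` is a possible state before the start: register `0` contains the alphabet size, register
`1` the bound on the window length, and everything else is filled with arbitrary words (the memory
is not initialized). -/
structure IsInitialState (w σ d : ℕ) (s : RState) : Prop where
  reg_zero : s.reg 0 = σ
  reg_one : s.reg 1 = d
  reg_lt : ∀ r, s.reg r < 2 ^ w
  mem_lt : ∀ a, s.mem a < 2 ^ w

/-- Run of `A` on a sliding window with word size `w`, in a memory of `M` words, from state `s₀`:
at time `t` the program belonging to the operation that produced the window at time `t` takes
`τ t` time units and ends in state `s t`. -/
structure IsRun {σ : ℕ} (A : WindowAlgorithm) (S : List (Fin σ)) (lo hi : ℕ → ℕ) (T w M : ℕ)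
    (s₀ : RState) (s : ℕ → RState) (τ : ℕ → ℕ) : Prop where
  start : Exec ⟨w, M, S, lo 0, hi 0⟩ A.start s₀ (τ 0) (s 0)
  append : ∀ t < T, hi (t + 1) = hi t + 1 →
    Exec ⟨w, M, S, lo (t + 1), hi (t + 1)⟩ A.append (s t) (τ (t + 1)) (s (t + 1))
  delete : ∀ t < T, lo (t + 1) = lo t + 1 →
    Exec ⟨w, M, S, lo (t + 1), hi (t + 1)⟩ A.delete (s t) (τ (t + 1)) (s (t + 1))

namespace SlidingEertree

open List

/-! ### Longest palindromic suffixes -/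

section Words

variable {α : Type}

/-! Every ordinary node carries a counter of references, and a palindrome is discarded exactly when
its counter drops to zero. The references are the incoming suffix links and the entries of a
surface: each position of the window records at most one palindrome starting there, in such a way
that the longest palindrome starting at any position is a suffix of a recorded one. In particular,
the entry at the left end is the longest palindromic prefix `P` (`Surface.first`).

Deleting the leftmost character can destroy only `P`, since a shorter palindromic prefix is also a
suffix of `P` and occurs again (`Surface.mem_pals_delete`). Whatever the entry `P` covered is
covered by its longest palindromic proper suffix, which is entered at its own start unless the entry
there is at least as long (`Surface.delete`). A palindrome of the window is a surface entry or the
suffix link of another palindrome (`Surface.exists_ref`), so `P` survives iff a reference to it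
remains (`Surface.first_mem_iff`). Appending a character adds at most one palindrome, the new
longest palindromic suffix (`pals_concat`), which is recorded at its start (`Surface.append`).
Overwriting a shorter entry is harmless by periodicity: between two palindromes with a common start,
every position inside the shorter one starts a palindrome reaching beyond it
(`exists_palindrome_between`).

An append walks along suffix links twice: from the old longest palindromic suffix to the node `u` to
be extended (`lspal_concat`), and, if a node is created, from the link of `u` to the node whose
child is the new link (`slink_wrap`). The potential `pot` adds the lengths, each plus one, of the
longest palindromic suffix and of its suffix link. The walks are paid for by its decrease; an append
raises it by a constant apart from that, and a deletion does not raise it (`pot_tail_le`). A removed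
node is a leaf, so its child array is already null and its block is reused without clearing. Only
blocks never used before are cleared, at most `d' + 1` of them, which gives the term `d'σ`.

In memory, the surface is a circular array of `d` words indexed by positions modulo `d`, followed by
`d' + 1` blocks of `σ + 5` words. A fresh block is opened only when no block is free, so `d' - 1`
nonempty palindromes and two auxiliary nodes always fit. The invariants `Tree`, `Core` and `Inv` tie
registers and memory to these objects, `Wp` carries exact running times, and `exists_run` sums the
amortized costs. -/

theorem palindrome_of_prefix_suffix {p q : List α} (hq : q.Palindrome) (hp : p.Palindrome)
    (h : p <+: q) : p <:+ q := by
  have := List.reverse_suffix.2 h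
  rwa [hq.reverse_eq, hp.reverse_eq] at this

theorem palindrome_of_suffix_prefix {p q : List α} (hq : q.Palindrome) (hp : p.Palindrome)
    (h : p <:+ q) : p <+: q := by
  have := List.reverse_prefix.2 h
  rwa [hq.reverse_eq, hp.reverse_eq] at this

theorem suffix_tail_of_ne {p q : List α} (h : p <:+ q) (hne : p ≠ q) : p <:+ q.tail := by
  cases q with
  | nil => simp_all
  | cons a q =>
    rcases List.suffix_cons_iff.1 h with h | h
    · exact absurd h hne
    · exact h

variable [DecidableEq α]

/-- The longest palindromic suffix. -/
def lspal : List α → List α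
  | [] => []
  | a :: W => if (a :: W).Palindrome then a :: W else lspal W

@[simp] theorem lspal_nil : lspal ([] : List α) = [] := rfl

theorem lspal_cons (a : α) (W : List α) :
    lspal (a :: W) = if (a :: W).Palindrome then a :: W else lspal W := rfl

theorem lspal_suffix (W : List α) : lspal W <:+ W := by
  induction W with
  | nil => simp
  | cons a W ih =>
    rw [lspal_cons]
    split_ifs
    · exact List.suffix_refl _
    · exact ih.trans (List.suffix_cons _ _)

theorem lspal_palindrome (W : List α) : (lspal W).Palindrome := by
  induction W with
  | nil => exact .nil
  | cons a W ih =>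
    rw [lspal_cons]
    split_ifs with h
    · exact h
    · exact ih

/-- The recursion stops at the first palindrome met when letters are dropped from the left, so every
other palindromic suffix lies inside it. The containment, rather than an inequality of lengths, is
what later transfers occurrences. -/
theorem suffix_lspal {W q : List α} (hq : q.Palindrome) (h : q <:+ W) : q <:+ lspal W := by
  induction W with
  | nil => simpa using h
  | cons a W ih =>
    rw [lspal_cons]
    split_ifs with hp
    · exact h
    · rcases List.suffix_cons_iff.1 h with h | h
      · exact absurd (h ▸ hq) hp
      · exact ih h

theorem lspal_eq {W q : List α} (hq : q.Palindrome) (h : q <:+ W)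
    (hmax : ∀ q' : List α, q'.Palindrome → q' <:+ W → q'.length ≤ q.length) : lspal W = q :=
  ((suffix_lspal hq h).eq_of_length_le
    (hmax _ (lspal_palindrome W) (lspal_suffix W))).symm

theorem lspal_self {W : List α} (h : W.Palindrome) : lspal W = W :=
  lspal_eq h (List.suffix_refl _) fun _ _ h => h.length_le

theorem lspal_ne_nil {W : List α} (h : W ≠ []) : lspal W ≠ [] := by
  intro h0
  have h1 : [W.getLast h] <:+ W := ⟨_, List.dropLast_append_getLast h⟩
  have h2 := (suffix_lspal (.singleton _) h1).length_le
  rw [h0] at h2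
  simp at h2

theorem lspal_tail_length_lt {p : List α} (h : p ≠ []) : (lspal p.tail).length < p.length := by
  have h1 := (lspal_suffix p.tail).length_le
  have h2 := List.length_pos_iff.2 h
  rw [List.length_tail] at h1
  omega

end Words

/-! ### Nodes -/

section Nodes

variable {α : Type}

/-- The node of a palindrome. -/
def node : List α → ENode α
  | [] => .zero
  | a :: p => .ord (a :: p)

@[simp] theorem neg_pal : (.neg : ENode α).pal = [] := rfl
@[simp] theorem zero_pal : (.zero : ENode α).pal = [] := rfl
@[simp] theorem ord_pal (p : List α) : (ENode.ord p).pal = p := rfl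
theorem neg_len : (.neg : ENode α).len = -1 := rfl
theorem zero_len : (.zero : ENode α).len = 0 := rfl
theorem ord_len (p : List α) : (ENode.ord p).len = p.length := rfl

@[simp] theorem node_pal (p : List α) : (node p).pal = p := by cases p <;> rfl

theorem node_of_ne_nil {p : List α} (h : p ≠ []) : node p = .ord p := by
  cases p with
  | nil => exact absurd rfl h
  | cons => rfl

/-- The length of a node plus one. -/
def lp : ENode α → ℕ
  | .neg => 0
  | .zero => 1
  | .ord p => p.length + 1

@[simp] theorem lp_neg : lp (.neg : ENode α) = 0 := rfl
@[simp] theorem lp_zero : lp (.zero : ENode α) = 1 := rfl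
@[simp] theorem lp_ord (p : List α) : lp (.ord p) = p.length + 1 := rfl

@[simp] theorem lp_node (p : List α) : lp (node p) = p.length + 1 := by cases p <;> rfl

theorem lp_eq_len (v : ENode α) : (lp v : ℤ) = v.len + 1 := by
  cases v <;> simp [ENode.len]

/-- The string `cvc`. -/
def wrap (c : α) : ENode α → List α
  | .neg => [c]
  | .zero => [c, c]
  | .ord p => c :: (p ++ [c])

@[simp] theorem wrap_neg (c : α) : wrap c .neg = [c] := rfl
@[simp] theorem wrap_node (c : α) (p : List α) : wrap c (node p) = c :: (p ++ [c]) := by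
  cases p <;> rfl

@[simp] theorem wrap_ne_nil (c : α) (v : ENode α) : wrap c v ≠ [] := by cases v <;> simp [wrap]

@[simp] theorem length_wrap (c : α) (v : ENode α) : (wrap c v).length = lp v + 1 := by
  cases v <;> simp [wrap]

/-- A node whose string is a palindrome, nonempty for ordinary nodes. -/
def Valid : ENode α → Prop
  | .ord p => p ≠ [] ∧ p.Palindrome
  | _ => True

theorem valid_node {p : List α} (h : p.Palindrome) : Valid (node p) := by
  cases p with
  | nil => trivial
  | cons => exact ⟨by simp, h⟩

theorem Valid.eq_neg_or {v : ENode α} (h : Valid v) :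
    v = .neg ∨ ∃ p : List α, p.Palindrome ∧ v = node p := by
  cases v with
  | neg => exact .inl rfl
  | zero => exact .inr ⟨[], .nil, rfl⟩
  | ord p => exact .inr ⟨p, h.2, (node_of_ne_nil h.1).symm⟩

theorem Valid.wrap {v : ENode α} (h : Valid v) (c : α) : (wrap c v).Palindrome := by
  rcases h.eq_neg_or with rfl | ⟨p, hp, rfl⟩
  · exact .singleton c
  · rw [wrap_node]
    exact .cons_concat c hp

theorem wrap_inj {u v : ENode α} {c c' : α} (hu : Valid u) (hv : Valid v)
    (h : wrap c u = wrap c' v) : c = c' ∧ u = v := by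
  have hl := congrArg List.length h
  rw [length_wrap, length_wrap] at hl
  rcases hu.eq_neg_or with rfl | ⟨p, hp, rfl⟩ <;> rcases hv.eq_neg_or with rfl | ⟨q, hq, rfl⟩
  · simpa using h
  · simp at hl
  · simp at hl
  · simp only [wrap_node, List.cons.injEq] at h
    exact ⟨h.1, by rw [(List.append_inj' h.2 rfl).1]⟩

theorem exists_wrap {p : List α} (h : p.Palindrome) (h0 : p ≠ []) :
    ∃ c u, Valid u ∧ p = wrap c u ∧ u.pal <:+: p := by
  cases h with
  | nil => exact absurd rfl h0
  | singleton c => exact ⟨c, .neg, trivial, rfl, [], [c], rfl⟩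
  | @cons_concat c q hq =>
    exact ⟨c, node q, valid_node hq, by simp, ⟨[c], [c], by simp⟩⟩

theorem isEdge_wrap (u : ENode α) (hu : Valid u) (c : α) : u.IsEdge c (.ord (wrap c u)) := by
  refine ⟨?_, ?_, ?_⟩
  · have := lp_eq_len u
    simp only [ord_len, length_wrap]
    push_cast
    omega
  · rcases hu.eq_neg_or with rfl | ⟨p, hp, rfl⟩ <;> simp
  · rcases hu.eq_neg_or with rfl | ⟨p, hp, rfl⟩ <;> simp

/-- Replaces the edge relation by `wrap`, the form used from here on. The length equation is needed
to tell the two auxiliary nodes apart, since both have the empty string. -/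
theorem isEdge_iff {u v : ENode α} (hu : Valid u) (hv : Valid v) (c : α) :
    u.IsEdge c v ↔ v = .ord (wrap c u) := by
  constructor
  · rintro ⟨h1, h2, h3⟩
    have hl := lp_eq_len u
    cases v with
    | neg => rw [neg_len] at h1; omega
    | zero => rw [zero_len] at h1; omega
    | ord p =>
      obtain ⟨c', u', hu', rfl, -⟩ := exists_wrap hv.2 hv.1
      have e2 := (isEdge_wrap u' hu' c').2.2
      have hc : c = c' := by
        rw [h3] at e2
        simpa using e2
      subst hc
      have e1 := (isEdge_wrap u' hu' c).1
      have e3 := (isEdge_wrap u' hu' c).2.1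
      rw [← h2] at e3
      rw [← h1] at e1
      congr 2
      rcases hu.eq_neg_or with rfl | ⟨p, hp, rfl⟩ <;>
        rcases hu'.eq_neg_or with rfl | ⟨q, hq, rfl⟩
      · rfl
      · have := lp_eq_len (node q)
        simp [neg_len] at this e1
        omega
      · have := lp_eq_len (node p)
        simp [neg_len] at this e1
        omega
      · simp only [node_pal] at e3
        rw [e3]
  · rintro rfl
    exact isEdge_wrap u hu c

variable [DecidableEq α]

/-- The suffix link. -/
def slink : ENode α → ENode α
  | .ord p => node (lspal p.tail)
  | _ => .neg

theorem slink_node (p : List α) (h : p ≠ []) : slink (node p) = node (lspal p.tail) := by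
  rw [node_of_ne_nil h, slink]

theorem valid_slink (v : ENode α) : Valid (slink v) := by
  cases v with
  | ord p => exact valid_node (lspal_palindrome _)
  | _ => trivial

theorem lp_slink_lt {v : ENode α} (hv : Valid v) (h : v ≠ .neg) : lp (slink v) < lp v := by
  cases v with
  | neg => exact absurd rfl h
  | zero => simp [slink]
  | ord p => simpa [slink] using lspal_tail_length_lt hv.1

theorem isSuffixLink_slink {v : ENode α} (hv : Valid v) : v.IsSuffixLink (slink v) := by
  cases v with
  | neg => rfl
  | zero => rfl
  | ord p =>
    cases p with
    | nil => exact absurd rfl hv.1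
    | cons a p =>
      cases p with
      | nil => exact .inl ⟨rfl, rfl⟩
      | cons b p =>
        refine .inr ⟨by simp, lspal (b :: p), ?_, ⟨?_, ?_, ?_⟩, ?_⟩
        · exact node_of_ne_nil (lspal_ne_nil (by simp))
        · exact lspal_palindrome _
        · exact (lspal_suffix _).trans (List.suffix_cons _ _)
        · intro h
          have := (lspal_suffix (b :: p)).length_le
          rw [h] at this
          simp at this
        · intro q hq hs hne
          exact (suffix_lspal hq (suffix_tail_of_ne hs hne)).length_le

/-! ### Appending a character -/

/-- `v` is a node on the chain of suffix links that starts at the longest palindromic suffix. -/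
def OnSuffix (W : List α) (v : ENode α) : Prop := Valid v ∧ v.pal <:+ W

/-- `cvc` is a suffix of the string `Wc`. -/
def Extends (W : List α) (c : α) : ENode α → Prop
  | .neg => True
  | .zero => [c] <:+ W
  | .ord p => (c :: p) <:+ W

omit [DecidableEq α] in
theorem extends_node (W : List α) (c : α) (p : List α) :
    Extends W c (node p) ↔ (c :: p) <:+ W := by cases p <;> rfl

omit [DecidableEq α] in
theorem wrap_suffix {W : List α} {c : α} {v : ENode α} (hv : Valid v) (h : Extends W c v) :
    wrap c v <:+ W ++ [c] := by
  rcases hv.eq_neg_or with rfl | ⟨p, hp, rfl⟩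
  · exact List.suffix_append _ _
  · rw [wrap_node, ← List.cons_append]
    obtain ⟨t, rfl⟩ := (extends_node _ _ _).1 h
    exact ⟨t, by simp⟩

omit [DecidableEq α] in
-- The last letter of the palindrome is `c`, hence so is the first. Peeling off both leaves a node
-- that the first `c` extends inside `W`; a single letter comes from the `-1`-node.
theorem exists_wrap_of_suffix {W q : List α} {c : α} (hq : q.Palindrome) (h0 : q ≠ [])
    (h : q <:+ W ++ [c]) : ∃ v, Valid v ∧ Extends W c v ∧ q = wrap c v := by
  obtain ⟨a, v, hv, rfl, -⟩ := exists_wrap hq h0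
  rcases hv.eq_neg_or with rfl | ⟨p, hp, rfl⟩
  · refine ⟨.neg, trivial, trivial, ?_⟩
    rcases List.suffix_concat_iff.1 h with h | ⟨t, h, -⟩
    · simp at h
    · rw [wrap_neg] at h ⊢
      cases t with
      | nil => simpa using h
      | cons => simp at h
  · rcases List.suffix_concat_iff.1 h with h | ⟨t, h, ht⟩
    · exact absurd h (wrap_ne_nil _ _)
    · rw [wrap_node, ← List.cons_append] at h
      obtain ⟨h1, h2⟩ := List.append_inj' h rfl
      obtain rfl : a = c := by simpa using h2
      exact ⟨node p, hv, (extends_node _ _ _).2 (h1 ▸ ht), rfl⟩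

omit [DecidableEq α] in
theorem Extends.onSuffix {W : List α} {c : α} {v : ENode α} (hv : Valid v)
    (h : Extends W c v) : OnSuffix W v := by
  refine ⟨hv, ?_⟩
  rcases hv.eq_neg_or with rfl | ⟨p, hp, rfl⟩
  · exact List.nil_suffix
  · rw [node_pal]
    exact (List.suffix_cons _ _).trans ((extends_node _ _ _).1 h)

/-- The longest palindromic suffix after appending a character. -/
theorem lspal_concat {W : List α} {c : α} {v : ENode α} (hv : Valid v) (h : Extends W c v)
    (hmax : ∀ v', Valid v' → Extends W c v' → lp v' ≤ lp v) : lspal (W ++ [c]) = wrap c v := by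
  refine lspal_eq (hv.wrap c) (wrap_suffix hv h) fun q hq hs => ?_
  by_cases h0 : q = []
  · simp [h0]
  · obtain ⟨v', h1, h2, rfl⟩ := exists_wrap_of_suffix hq h0 hs
    have := hmax v' h1 h2
    simp only [length_wrap]
    omega

omit [DecidableEq α] in
theorem OnSuffix.pal_suffix {W : List α} {u v : ENode α} (hu : OnSuffix W u) (hv : OnSuffix W v)
    (h : lp v ≤ lp u) : v.pal <:+ u.pal := by
  refine List.suffix_of_suffix_length_le hv.2 hu.2 ?_
  rcases hu.1.eq_neg_or with rfl | ⟨p, hp, rfl⟩ <;>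
    rcases hv.1.eq_neg_or with rfl | ⟨q, hq, rfl⟩ <;> simp_all

theorem OnSuffix.slink {W : List α} {v : ENode α} (h : OnSuffix W v) : OnSuffix W (slink v) := by
  refine ⟨valid_slink v, ?_⟩
  cases v with
  | ord p =>
    simp only [SlidingEertree.slink, node_pal]
    exact (lspal_suffix _).trans ((List.tail_suffix _).trans h.2)
  | _ => exact List.nil_suffix

/-- No node of the chain lies strictly between a node and its suffix link. -/
theorem OnSuffix.lp_le_slink {W : List α} {u v : ENode α} (hu : OnSuffix W u)
    (hv : OnSuffix W v) (h : lp v < lp u) : lp v ≤ lp (SlidingEertree.slink u) := by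
  have hs := hu.pal_suffix hv h.le
  cases u with
  | neg => simp at h
  | zero =>
    simp only [lp_zero] at h
    omega
  | ord p =>
    simp only [SlidingEertree.slink, lp_node]
    rcases hv.1.eq_neg_or with rfl | ⟨q, hq, rfl⟩
    · simp
    · simp only [node_pal, ord_pal, lp_node, lp_ord] at hs h ⊢
      have : q ≠ p := by
        rintro rfl
        simp at h
      have := (suffix_lspal hq (suffix_tail_of_ne hs this)).length_le
      omega

/-- Bounds the starting point `slink u` of the second walk by the link of the old longest
palindromic suffix, which is the second term of the potential. -/
theorem lp_slink_mono {W : List α} {u v : ENode α} (hu : OnSuffix W u) (hv : OnSuffix W v)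
    (h : lp v ≤ lp u) : lp (slink v) ≤ lp (slink u) := by
  by_cases hn : v = .neg
  · subst hn
    simp [slink]
  · exact hu.lp_le_slink hv.slink ((lp_slink_lt hv.1 hn).trans_le h)

theorem onSuffix_lspal (W : List α) : OnSuffix W (node (lspal W)) :=
  ⟨valid_node (lspal_palindrome W), by simpa using lspal_suffix W⟩

theorem OnSuffix.lp_le {W : List α} {v : ENode α} (h : OnSuffix W v) :
    lp v ≤ lp (node (lspal W)) := by
  rw [lp_node]
  rcases h.1.eq_neg_or with rfl | ⟨q, hq, rfl⟩
  · simp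
  · rw [lp_node]
    have := h.2
    rw [node_pal] at this
    have := (suffix_lspal hq this).length_le
    omega

/-- Lets the suffix link of `cuc` be searched for in the window. If `cv` is a suffix of the string
of `u`, then `v` is a proper palindromic suffix of it and is no longer than the link of `u`;
conversely, a suffix of `W` that is no longer than `u` is a suffix of `u`. -/
theorem extends_pal_iff {W : List α} {c : α} {u v : ENode α} (hu : OnSuffix W u) (hn : u ≠ .neg)
    (hv : Valid v) : Extends u.pal c v ↔ Extends W c v ∧ lp v ≤ lp (slink u) := by
  rcases hv.eq_neg_or with rfl | ⟨q, hq, rfl⟩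
  · simp [Extends]
  rw [extends_node, extends_node]
  constructor
  · intro h
    have hW := h.trans hu.2
    refine ⟨hW, hu.lp_le_slink (((extends_node _ _ _).2 hW).onSuffix hv) ?_⟩
    rcases hu.1.eq_neg_or with rfl | ⟨p, hp, rfl⟩
    · exact absurd rfl hn
    · have := h.length_le
      simp at this ⊢
      omega
  · rintro ⟨h1, h2⟩
    refine List.suffix_of_suffix_length_le h1 hu.2 ?_
    have h3 := lp_slink_lt hu.1 hn
    rcases hu.1.eq_neg_or with rfl | ⟨p, hp, rfl⟩
    · exact absurd rfl hn
    · simp at h2 h3 ⊢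
      omega

/-- The suffix link of a new node. -/
theorem slink_wrap {W : List α} {c : α} {u v : ENode α} (hu : OnSuffix W u) (hn : u ≠ .neg)
    (hv : Valid v) (h : Extends W c v) (hle : lp v ≤ lp (slink u))
    (hmax : ∀ v', Valid v' → Extends W c v' → lp v' ≤ lp (slink u) → lp v' ≤ lp v) :
    slink (.ord (wrap c u)) = .ord (wrap c v) := by
  have : (wrap c u).tail = u.pal ++ [c] := by
    rcases hu.1.eq_neg_or with rfl | ⟨p, hp, rfl⟩
    · exact absurd rfl hn
    · simp
  rw [slink, this, lspal_concat hv ((extends_pal_iff hu hn hv).2 ⟨h, hle⟩), node_of_ne_nil]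
  · simp
  · intro v' hv' h'
    have := (extends_pal_iff hu hn hv').1 h'
    exact hmax v' hv' this.1 this.2

/-- The link of `cuc` is some `cvc` with `v` no longer than the link of `u`, and two letters are
added. This bounds the growth of the potential when the node already exists and no second walk takes
place. -/
theorem lp_slink_wrap_le {W : List α} {c : α} {u : ENode α} (hu : OnSuffix W u) :
    lp (slink (.ord (wrap c u))) ≤ lp (slink u) + 2 := by
  by_cases hn : u = .neg
  · subst hn
    simp [slink]
  have ht : (wrap c u).tail = u.pal ++ [c] := by
    rcases hu.1.eq_neg_or with rfl | ⟨p, hp, rfl⟩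
    · exact absurd rfl hn
    · simp
  rw [slink, ht, lp_node]
  obtain ⟨v, hv, he, h⟩ := exists_wrap_of_suffix (lspal_palindrome (u.pal ++ [c]))
    (lspal_ne_nil (by simp)) (lspal_suffix _)
  rw [h, length_wrap]
  have := ((extends_pal_iff hu hn hv).1 he).2
  omega

end Nodes

/-! ### Palindromes in a string -/

section Pals

variable {α : Type}

/-- The nonempty palindromes in a string. -/
def pals (W : List α) : Set (List α) := {p | p ≠ [] ∧ p ∈ DPal W}

theorem mem_pals {W p : List α} : p ∈ pals W ↔ p ≠ [] ∧ p.Palindrome ∧ p <:+: W := Iff.rfl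

theorem finite_infix (W : List α) : {p | p <:+: W}.Finite :=
  (W.sublists.finite_toSet).subset fun _ hp => List.mem_sublists.2 hp.sublist

theorem finite_DPal (W : List α) : (DPal W).Finite :=
  (finite_infix W).subset fun _ hp => hp.2

theorem finite_pals (W : List α) : (pals W).Finite :=
  (finite_DPal W).subset fun _ hp => hp.2

theorem DPal_eq_insert (W : List α) : DPal W = insert [] (pals W) := by
  ext p
  simp only [Set.mem_insert_iff, mem_pals, DPal, Set.mem_ofPred_eq]
  by_cases h : p = []
  · subst h
    simp [List.Palindrome.nil]
  · simp [h]

theorem ncard_DPal (W : List α) : (DPal W).ncard = (pals W).ncard + 1 := by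
  rw [DPal_eq_insert, Set.ncard_insert_of_notMem (fun h => h.1 rfl) (finite_pals W)]

/-- `v` is an auxiliary node or an ordinary node of a string in `N`. -/
def NodeIn (N : Set (List α)) : ENode α → Prop
  | .ord p => p ∈ N
  | _ => True

theorem isNode_iff (W : List α) (v : ENode α) : v.IsNode W ↔ NodeIn (pals W) v := by
  cases v <;> rfl

theorem nodeIn_node {N : Set (List α)} {p : List α} (h : p ∈ N) : NodeIn N (node p) := by
  cases p with
  | nil => trivial
  | cons => exact h

/-- A set of nonempty palindromes with all palindromic factors of its elements. -/
structure FactorClosed (N : Set (List α)) : Prop where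
  ne_nil : ∀ p ∈ N, p ≠ []
  pal : ∀ p ∈ N, p.Palindrome
  mem : ∀ p ∈ N, ∀ q : List α, q ≠ [] → q.Palindrome → q <:+: p → q ∈ N

theorem factorClosed_pals (W : List α) : FactorClosed (pals W) where
  ne_nil _ h := h.1
  pal _ h := h.2.1
  mem _ h _ h0 hq hi := ⟨h0, hq, hi.trans h.2.2⟩

theorem FactorClosed.valid {N : Set (List α)} (hN : FactorClosed N) {v : ENode α}
    (h : NodeIn N v) : Valid v := by
  cases v with
  | ord p => exact ⟨hN.ne_nil p h, hN.pal p h⟩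
  | _ => trivial

theorem FactorClosed.nodeIn_of_infix {N : Set (List α)} (hN : FactorClosed N) {p : List α}
    (hp : p ∈ N) {v : ENode α} (hv : Valid v) (h : v.pal <:+: p) : NodeIn N v := by
  cases v with
  | ord q => exact hN.mem p hp q hv.1 hv.2 h
  | _ => trivial

theorem FactorClosed.nodeIn_slink [DecidableEq α] {N : Set (List α)} (hN : FactorClosed N)
    {v : ENode α} (h : NodeIn N v) : NodeIn N (slink v) := by
  cases v with
  | ord p =>
    refine hN.nodeIn_of_infix h (valid_slink _) ?_
    simp only [slink, node_pal]
    exact ((lspal_suffix _).trans (List.tail_suffix _)).isInfix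
  | _ => trivial

theorem pal_infix_wrap {c : α} {u : ENode α} (hu : Valid u) : u.pal <:+: wrap c u := by
  rcases hu.eq_neg_or with rfl | ⟨p, hp, rfl⟩
  · exact ⟨[], [c], rfl⟩
  · exact ⟨[c], [c], by simp⟩

theorem FactorClosed.nodeIn_of_wrap {N : Set (List α)} (hN : FactorClosed N) {c : α}
    {u : ENode α} (hu : Valid u) (h : wrap c u ∈ N) : NodeIn N u :=
  hN.nodeIn_of_infix h hu (pal_infix_wrap hu)

variable [DecidableEq α]

/-- Appending a character creates at most one palindrome. -/
theorem pals_concat (W : List α) (c : α) : pals (W ++ [c]) = insert (lspal (W ++ [c])) (pals W) := by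
  ext p
  simp only [Set.mem_insert_iff, mem_pals]
  constructor
  · rintro ⟨h0, hp, hi⟩
    rcases List.infix_concat_iff.1 hi with h | h
    · by_cases he : p = lspal (W ++ [c])
      · exact .inl he
      right
      refine ⟨h0, hp, ?_⟩
      -- A palindromic suffix is also a prefix of the longest one. If it is strictly shorter, this
      -- second occurrence ends before the last letter and thus lies in `W`.
      have h1 := palindrome_of_suffix_prefix (lspal_palindrome _) hp (suffix_lspal hp h)
      obtain ⟨t, ht⟩ := h1
      have ht0 : t ≠ [] := by
        rintro rfl
        exact he (by simpa using ht)
      have h2 := lspal_suffix (W ++ [c])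
      rw [← ht, ← List.dropLast_append_getLast ht0, ← List.append_assoc] at h2
      rcases List.suffix_concat_iff.1 h2 with h2 | ⟨t', h2, h3⟩
      · simp at h2
      · rw [← (List.append_inj' h2 rfl).1] at h3
        exact (List.prefix_append p _).isInfix.trans h3.isInfix
    · exact .inr ⟨h0, hp, h⟩
  · rintro (rfl | ⟨h0, hp, hi⟩)
    · exact ⟨lspal_ne_nil (by simp), lspal_palindrome _, (lspal_suffix _).isInfix⟩
    · exact ⟨h0, hp, hi.trans (List.prefix_append _ _).isInfix⟩

theorem ncard_pals_le (W : List α) : (pals W).ncard ≤ W.length := by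
  induction W using List.reverseRecOn with
  | nil =>
    have : pals ([] : List α) = ∅ := by
      ext p
      simp only [mem_pals, List.infix_nil, Set.mem_empty_iff_false, iff_false]
      tauto
    simp [this]
  | append_singleton W c ih =>
    rw [pals_concat]
    have := Set.ncard_insert_le (lspal (W ++ [c])) (pals W)
    simp
    omega

end Pals

/-! ### Factors -/

section Factors

variable {α : Type}

/-- The factor `S[b..e-1]`. -/
def factor (S : List α) (b e : ℕ) : List α := (S.drop b).take (e - b)

theorem substr_eq_factor (S : List α) (i j : ℕ) : substr S i j = factor S i (j + 1) := rfl

variable {S : List α}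

theorem length_factor {b e : ℕ} (h : e ≤ S.length) : (factor S b e).length = e - b := by
  simp [factor]
  omega

theorem factor_eq_nil {b e : ℕ} (h : e ≤ b) : factor S b e = [] := by
  simp [factor, Nat.sub_eq_zero_of_le h]

theorem factor_ne_nil {b e : ℕ} (h : b < e) (he : e ≤ S.length) : factor S b e ≠ [] := by
  intro h0
  have := length_factor (b := b) he
  rw [h0] at this
  simp at this
  omega

theorem getElem?_factor (b e i : ℕ) :
    (factor S b e)[i]? = if i < e - b then S[b + i]? else none := by
  simp [factor, List.getElem?_take]

theorem drop_factor (b e k : ℕ) : (factor S b e).drop k = factor S (b + k) e := by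
  simp [factor, List.drop_take, Nat.sub_sub]

theorem take_factor {b e k : ℕ} (h : b + k ≤ e) : (factor S b e).take k = factor S b (b + k) := by
  simp [factor, List.take_take]
  omega

theorem factor_concat {b e : ℕ} (h : b ≤ e) (he : e < S.length) :
    factor S b (e + 1) = factor S b e ++ [S[e]] := by
  have h1 : e + 1 - b = (e - b) + 1 := by omega
  have h2 : b + (e - b) = e := by omega
  rw [factor, factor, h1, List.take_add_one]
  simp [h2, he]

theorem factor_cons {b e : ℕ} (h : b < e) (hb : b < S.length) :
    factor S b e = S[b] :: factor S (b + 1) e := by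
  have h1 : e - b = (e - (b + 1)) + 1 := by omega
  rw [factor, factor, h1, List.drop_eq_getElem_cons hb, List.take_succ_cons]

theorem factor_tail (b e : ℕ) : (factor S b e).tail = factor S (b + 1) e := by
  rw [← List.drop_one, drop_factor]

theorem factor_suffix {b c e : ℕ} (h : b ≤ c) : factor S c e <:+ factor S b e := by
  have := drop_factor (S := S) b e (c - b)
  rw [Nat.add_sub_cancel' h] at this
  rw [← this]
  exact List.drop_suffix _ _

theorem factor_prefix {b e f : ℕ} (h : e ≤ f) : factor S b e <+: factor S b f := by
  rcases le_total b e with hb | hb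
  · have := take_factor (S := S) (b := b) (e := f) (k := e - b) (by omega)
    rw [Nat.add_sub_cancel' hb] at this
    rw [← this]
    exact List.take_prefix _ _
  · rw [factor_eq_nil hb]
    exact List.nil_prefix

theorem eq_factor_of_suffix {p : List α} {b e : ℕ} (he : e ≤ S.length)
    (h : p <:+ factor S b e) : p = factor S (e - p.length) e := by
  have hl := h.length_le
  rw [length_factor he] at hl
  rw [List.suffix_iff_eq_drop, drop_factor, length_factor he] at h
  rw [h, length_factor he]
  by_cases hbe : b ≤ e
  · congr 1
    omega
  · rw [factor_eq_nil (by omega), factor_eq_nil (by omega)]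

theorem eq_factor_of_prefix {p : List α} {b e : ℕ} (he : e ≤ S.length)
    (h : p <+: factor S b e) : p = factor S b (b + p.length) := by
  have hl := h.length_le
  rw [length_factor he] at hl
  rw [List.prefix_iff_eq_take] at h
  by_cases hbe : b ≤ e
  · rwa [take_factor (by omega)] at h
  · have : p.length = 0 := by omega
    rw [factor_eq_nil (by omega)]
    exact List.length_eq_zero_iff.1 this

theorem eq_factor_of_infix {p : List α} {l r : ℕ} (hr : r ≤ S.length) (h0 : p ≠ [])
    (h : p <:+: factor S l r) : ∃ b e, l ≤ b ∧ b < e ∧ e ≤ r ∧ p = factor S b e := by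
  obtain ⟨t, h1, h2⟩ := List.infix_iff_prefix_suffix.1 h
  have hp := List.length_pos_iff.2 h0
  have hl2 := h2.length_le
  have hl1 := h1.length_le
  rw [length_factor hr] at hl2
  rw [eq_factor_of_suffix hr h2] at h1
  exact ⟨r - t.length, r - t.length + p.length, by omega, by omega, by omega,
    eq_factor_of_prefix hr h1⟩

theorem factor_infix {b e l r : ℕ} (hb : l ≤ b) (he : e ≤ r) : factor S b e <:+: factor S l r :=
  (factor_prefix he).isInfix.trans (factor_suffix hb).isInfix

theorem mem_pals_factor {p : List α} {l r : ℕ} (hr : r ≤ S.length) :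
    p ∈ pals (factor S l r) ↔
      p.Palindrome ∧ ∃ b e, l ≤ b ∧ b < e ∧ e ≤ r ∧ p = factor S b e := by
  constructor
  · rintro ⟨h0, hp, hi⟩
    exact ⟨hp, eq_factor_of_infix hr h0 hi⟩
  · rintro ⟨hp, b, e, h1, h2, h3, rfl⟩
    exact ⟨factor_ne_nil h2 (h3.trans hr), hp, factor_infix h1 h3⟩

/-- States palindromicity as invariance under the reflection of positions `i ↦ b + e - 1 - i`, so
that periodicity becomes a computation with indices. -/
theorem palindrome_factor_iff {b e : ℕ} (he : e ≤ S.length) :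
    (factor S b e).Palindrome ↔ ∀ i, b ≤ i → i < e → S[i]? = S[b + e - 1 - i]? := by
  rw [List.Palindrome.iff_reverse_eq]
  constructor
  · intro h i h1 h2
    have h3 := congrArg (·[i - b]?) h
    rw [List.getElem?_reverse (by rw [length_factor he]; omega), getElem?_factor,
      getElem?_factor, length_factor he, if_pos (by omega), if_pos (by omega)] at h3
    rw [show b + (i - b) = i by omega,
      show b + (e - b - 1 - (i - b)) = b + e - 1 - i by omega] at h3
    exact h3.symm
  · intro h
    refine List.ext_getElem? fun i => ?_
    by_cases hi : i < e - b
    · rw [List.getElem?_reverse (by rwa [length_factor he]), getElem?_factor,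
        getElem?_factor, length_factor he, if_pos (by omega), if_pos (by omega),
        h (b + i) (by omega) (by omega)]
      congr 1
      omega
    · rw [List.getElem?_eq_none, List.getElem?_eq_none]
      · rw [length_factor he]; omega
      · rw [List.length_reverse, length_factor he]; omega

/-- If two palindromes start at `s`, every position in the shorter one is the start of a palindrome
that ends between the ends of the two. -/
theorem exists_palindrome_between {s e₀ e₁ b : ℕ} (he₁ : e₁ ≤ S.length) (he : e₀ < e₁)
    (h₀ : (factor S s e₀).Palindrome) (h₁ : (factor S s e₁).Palindrome) (hs : s ≤ b)
    (hb : b < e₀) : ∃ e, e₀ < e ∧ e ≤ e₁ ∧ (factor S b e).Palindrome := by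
  rw [palindrome_factor_iff (he.le.trans he₁)] at h₀
  rw [palindrome_factor_iff he₁] at h₁
  obtain ⟨p, rfl⟩ : ∃ p, e₁ = e₀ + p := ⟨e₁ - e₀, by omega⟩
  -- Reflecting in the shorter palindrome and then in the longer one is a translation by `p = e₁ -
  -- e₀`, so `p` is a period of the longer palindrome.
  have hper : ∀ k i, s ≤ i → i + p * k < e₀ + p → S[i]? = S[i + p * k]? := by
    intro k
    induction k with
    | zero => intros; rfl
    | succ k ih =>
      intro i h1 h2
      rw [Nat.mul_succ] at h2 ⊢
      rw [ih i h1 (by omega), h₀ (i + p * k) (by omega) (by omega),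
        h₁ (i + (p * k + p)) (by omega) (by omega)]
      congr 1
      omega
  have h1 := Nat.div_add_mod (b - s) p
  have h2 := Nat.mod_lt (b - s) (show 0 < p by omega)
  generalize (b - s) / p = k at h1
  -- The new end is `e₁` minus the remainder of `b - s` modulo `p`, hence beyond `e₀`. The
  -- reflection about the new palindrome is the reflection about the longer one followed by a
  -- translation by the multiple `p * k` of the period.
  refine ⟨s + p * k + (e₀ + p) - b, by omega, by omega, ?_⟩
  rw [palindrome_factor_iff (by omega)]
  intro i h3 h4
  rw [h₁ i (by omega) (by omega), hper k _ (by omega) (by omega)]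
  congr 1
  omega

/-! ### Surfaces -/

/-- `E b` is the end of some palindrome that starts at position `b` of the window `S[l..r-1]`
(`E b = b` if there is none), and the longest palindrome that starts at any given position is a
suffix of one of these palindromes. -/
structure Surface (S : List α) (l r : ℕ) (E : ℕ → ℕ) : Prop where
  entry : ∀ b, l ≤ b → b < r →
    E b = b ∨ (b < E b ∧ E b ≤ r ∧ (factor S b (E b)).Palindrome)
  cover : ∀ b e, l ≤ b → b < e → e ≤ r → (factor S b e).Palindrome →
    (∀ e', e < e' → e' ≤ r → ¬ (factor S b e').Palindrome) → ∃ b', l ≤ b' ∧ b' ≤ b ∧ E b' = e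

variable {l r : ℕ} {E : ℕ → ℕ}

/-- Coverage could be lost only by overwriting the entry at `s`. By `exists_palindrome_between`,
every position inside the old palindrome there now starts a longer one, so that entry no longer
covers a longest palindrome. Palindromes ending at the new letter start at `s` or later and are
covered by the new entry. -/
theorem Surface.append (h : Surface S l r E) (hr : r < S.length) {s : ℕ} (hls : l ≤ s)
    (hsr : s ≤ r) (hs : (factor S s (r + 1)).Palindrome)
    (hmax : ∀ b, l ≤ b → b < s → ¬ (factor S b (r + 1)).Palindrome) :
    Surface S l (r + 1) (Function.update (Function.update E r r) s (r + 1)) where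
  entry b hl hb := by
    by_cases h1 : b = s
    · subst h1
      exact .inr ⟨by simp; omega, by simp, by simpa using hs⟩
    rw [Function.update_of_ne h1]
    by_cases h2 : b = r
    · subst h2
      simp
    rw [Function.update_of_ne h2]
    rcases h.entry b hl (by omega) with h3 | ⟨h3, h4, h5⟩
    · exact .inl h3
    · exact .inr ⟨h3, by omega, h5⟩
  cover b e hl hbe he hp hm := by
    rcases lt_trichotomy e (r + 1) with h1 | h1 | h1
    · obtain ⟨b', h2, h3, h4⟩ := h.cover b e hl hbe (by omega) hp
        fun e' h5 h6 => hm e' h5 (by omega)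
      refine ⟨b', h2, h3, ?_⟩
      have h6 : b' ≠ s := by
        rintro rfl
        rcases h.entry b' h2 (by omega) with h5 | ⟨h5, h6, h7⟩
        · omega
        · rw [h4] at h7
          obtain ⟨e', h8, h9, h10⟩ := exists_palindrome_between (by omega) h1 h7 hs h3 hbe
          exact hm e' h8 h9 h10
      rw [Function.update_of_ne h6, Function.update_of_ne (by omega), h4]
    · subst h1
      have : s ≤ b := by
        by_contra h2
        exact hmax b hl (by omega) hp
      exact ⟨s, hls, this, by simp⟩
    · omega

/-- A covering entry starts no later than what it covers, so at the left end only the entry at `l`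
itself can cover. -/
theorem Surface.first (h : Surface S l r E) (hr : r ≤ S.length) (hlr : l < r) :
    l < E l ∧ E l ≤ r ∧ (factor S l (E l)).Palindrome ∧
      ∀ e', E l < e' → e' ≤ r → ¬ (factor S l e').Palindrome := by
  classical
  have h1 : (factor S l (l + 1)).Palindrome := by
    rw [factor_concat le_rfl (by omega), factor_eq_nil le_rfl]
    exact .singleton _
  have h2 := Nat.findGreatest_spec (P := fun e => (factor S l e).Palindrome) (n := r)
    (m := l + 1) hlr h1
  have h3 := Nat.le_findGreatest (P := fun e => (factor S l e).Palindrome) (n := r)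
    (m := l + 1) hlr h1
  have h4 := Nat.findGreatest_le (P := fun e => (factor S l e).Palindrome) r
  have h5 : ∀ e', Nat.findGreatest (fun e => (factor S l e).Palindrome) r < e' → e' ≤ r →
      ¬ (factor S l e').Palindrome := fun e' h6 h7 => Nat.findGreatest_is_greatest h6 h7
  generalize Nat.findGreatest (fun e => (factor S l e).Palindrome) r = e at *
  obtain ⟨b, h6, h7, h8⟩ := h.cover l e le_rfl (by omega) h4 h2 h5
  obtain rfl : b = l := by omega
  rw [h8]
  exact ⟨by omega, h4, h2, h5⟩

/-- The new end at position `q` after a palindrome ending at `e` has been deleted. -/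
def shiftEnd (E : ℕ → ℕ) (q e : ℕ) : ℕ → ℕ :=
  if q < e ∧ E q < e then Function.update E q e else E

/-- What the lost entry covered ends at `E l` and starts at `q` or later. If the entry at `q`
already ends at `E l`, it takes over; if it ended later, `exists_palindrome_between` would
contradict maximality; if it ended earlier, it is replaced, and the same lemma shows that it covered
nothing. For an empty suffix `q = E l`, and nothing has to be covered. -/
theorem Surface.delete [DecidableEq α] (h : Surface S l r E) (hr : r ≤ S.length) (hlr : l < r)
    {q : ℕ} (hlq : l < q) (hqe : q ≤ E l)
    (hq : lspal (factor S (l + 1) (E l)) = factor S q (E l)) :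
    Surface S (l + 1) r (shiftEnd E q (E l)) := by
  obtain ⟨h1, h2, h3, h4⟩ := h.first hr hlr
  have hqp : (factor S q (E l)).Palindrome := hq ▸ lspal_palindrome _
  -- the palindromes that were covered by the deleted one are suffixes of the new one
  have hqb : ∀ b, l < b → b < E l → (factor S b (E l)).Palindrome → q ≤ b := by
    intro b h5 h6 h7
    have := (suffix_lspal h7 (factor_suffix (S := S) (e := E l) (show l + 1 ≤ b by omega))).length_le
    rw [hq, length_factor (by omega), length_factor (by omega)] at this
    omega
  constructor
  · intro b hl hb
    have h5 := h.entry b (by omega) hb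
    unfold shiftEnd
    split_ifs with h6
    · by_cases h7 : b = q
      · subst h7
        exact .inr ⟨by simp; omega, by simpa using h2, by simpa using hqp⟩
      · rwa [Function.update_of_ne h7]
    · exact h5
  · intro b e hl hbe he hp hm
    obtain ⟨b', h5, h6, h7⟩ := h.cover b e (by omega) hbe he hp hm
    by_cases h8 : b' = l
    · subst h8 h7
      have h9 := hqb b (by omega) hbe hp
      by_cases h10 : E q < E b'
      · refine ⟨q, by omega, h9, ?_⟩
        rw [shiftEnd, if_pos ⟨by omega, h10⟩]
        simp
      · have h11 : E q = E b' := by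
          by_contra h12
          rcases h.entry q (by omega) (by omega) with h13 | ⟨h13, h14, h15⟩
          · omega
          · obtain ⟨e', h16, h17, h18⟩ := exists_palindrome_between (h14.trans hr)
              (show E b' < E q by omega) hqp h15 h9 hbe
            exact hm e' h16 (by omega) h18
        refine ⟨q, by omega, h9, ?_⟩
        rw [shiftEnd, if_neg (by omega), h11]
    · refine ⟨b', by omega, h6, ?_⟩
      unfold shiftEnd
      split_ifs with h9
      · have h10 : b' ≠ q := by
          rintro rfl
          rcases h.entry b' h5 (by omega) with h13 | ⟨h13, h14, h15⟩
          · omega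
          · obtain ⟨e', h16, h17, h18⟩ := exists_palindrome_between (h2.trans hr) h9.2 h15 hqp h6
              (by omega)
            exact hm e' (by omega) (by omega) h18
        rwa [Function.update_of_ne h10]
      · exact h7

/-- Every palindrome except the longest prefix survives the deletion of the first character. -/
theorem Surface.mem_pals_delete (h : Surface S l r E) (hr : r ≤ S.length) (hlr : l < r)
    {p : List α} (hp : p ∈ pals (factor S l r)) (hne : p ≠ factor S l (E l)) :
    p ∈ pals (factor S (l + 1) r) := by
  obtain ⟨h1, h2, h3, h4⟩ := h.first hr hlr
  rw [mem_pals_factor hr] at hp ⊢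
  obtain ⟨hp, b, e, h5, h6, h7, rfl⟩ := hp
  refine ⟨hp, ?_⟩
  by_cases hb : b = l
  · subst hb
    have he : e < E b := by
      by_contra h8
      rcases Nat.lt_or_ge (E b) e with h9 | h9
      · exact h4 e h9 h7 hp
      · exact hne (by rw [show e = E b by omega])
    have h8 := eq_factor_of_suffix (h2.trans hr)
      (palindrome_of_prefix_suffix h3 hp (factor_prefix he.le))
    rw [length_factor (by omega)] at h8
    exact ⟨_, _, by omega, by omega, h2, h8⟩
  · exact ⟨b, e, by omega, h6, h7, rfl⟩

/-- A palindrome in a window is the longest palindromic proper suffix of another one or belongs to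
the surface. -/
theorem Surface.exists_ref [DecidableEq α] (h : Surface S l r E) (hr : r ≤ S.length)
    {p : List α} (hp : p ∈ pals (factor S l r)) :
    (∃ b, l ≤ b ∧ b < r ∧ b < E b ∧ factor S b (E b) = p) ∨
      ∃ q ∈ pals (factor S l r), lspal q.tail = p := by
  classical
  -- Take a shortest palindrome `q` with `p` as a proper suffix. Its longest palindromic proper
  -- suffix also ends with `p` and is shorter than `q`, so by minimality it is `p`.
  by_cases hq : ∃ n, ∃ q ∈ pals (factor S l r), p <:+ q ∧ p ≠ q ∧ q.length = n
  · right
    obtain ⟨q, h1, h2, h3, h4⟩ := Nat.find_spec hq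
    refine ⟨q, h1, ?_⟩
    have h5 := suffix_lspal hp.2.1 (suffix_tail_of_ne h2 h3)
    by_contra h6
    have h7 := lspal_tail_length_lt h1.1
    refine Nat.find_min hq (m := (lspal q.tail).length) (by omega)
      ⟨_, ?_, h5, Ne.symm h6, rfl⟩
    refine (factorClosed_pals _).mem q h1 _ ?_ (lspal_palindrome _)
      ((lspal_suffix _).trans (List.tail_suffix _)).isInfix
    intro h0
    rw [h0] at h5
    exact hp.1 (List.suffix_nil.1 h5)
  · left
    push Not at hq
    have hq' : ∀ q ∈ pals (factor S l r), p <:+ q → p = q := by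
      intro q h1 h2
      by_contra h3
      exact hq _ q h1 h2 h3 rfl
    obtain ⟨hpp, b, e, h1, h2, h3, rfl⟩ := (mem_pals_factor hr).1 hp
    -- A longer palindrome starting at `b` would have `p` as a prefix, hence as a proper suffix,
    -- which is excluded in this case. So the occurrence is covered, and the covering entry, which
    -- ends with `p`, can only be `p`.
    obtain ⟨b', h4, h5, h6⟩ := h.cover b e h1 h2 h3 hpp fun e' h4 h5 h6 => by
      have h7 := hq' _ ((mem_pals_factor hr).2 ⟨h6, b, e', h1, by omega, h5, rfl⟩)
        (palindrome_of_prefix_suffix h6 hpp (factor_prefix h4.le))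
      have h8 := congrArg List.length h7
      rw [length_factor (by omega), length_factor (by omega)] at h8
      omega
    refine ⟨b', h4, by omega, by omega, ?_⟩
    rcases h.entry b' h4 (by omega) with h7 | ⟨h7, h8, h9⟩
    · omega
    · refine (hq' _ ((mem_pals_factor hr).2 ⟨h9, b', E b', h4, h7, h8, rfl⟩) ?_).symm
      rw [h6]
      exact factor_suffix h5

/-! ### Reference counts -/

/-- The number of entries of the surface that are occurrences of `p`. -/
def refs [DecidableEq α] (S : List α) (l r : ℕ) (E : ℕ → ℕ) (p : List α) : ℕ :=
  ∑ b ∈ Finset.Ico l r, if b < E b ∧ factor S b (E b) = p then 1 else 0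

/-- The number of palindromes in `N` with suffix link `p`. -/
noncomputable def links [DecidableEq α] (N : Set (List α)) (p : List α) : ℕ :=
  {q ∈ N | lspal q.tail = p}.ncard

theorem refs_le [DecidableEq α] (S : List α) (l r : ℕ) (E : ℕ → ℕ) (p : List α) :
    refs S l r E p ≤ r - l := by
  refine (Finset.sum_le_card_nsmul _ _ 1 fun b _ => ?_).trans (by simp)
  split_ifs <;> simp

theorem links_le [DecidableEq α] {N : Set (List α)} (hN : N.Finite) (p : List α) :
    links N p ≤ N.ncard :=
  Set.ncard_le_ncard (fun _ h => h.1) hN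

theorem refs_pos_iff [DecidableEq α] {p : List α} :
    0 < refs S l r E p ↔ ∃ b, l ≤ b ∧ b < r ∧ b < E b ∧ factor S b (E b) = p := by
  rw [refs, Finset.sum_pos_iff]
  constructor
  · rintro ⟨b, h1, h2⟩
    rw [Finset.mem_Ico] at h1
    split_ifs at h2 with h3
    · exact ⟨b, h1.1, h1.2, h3.1, h3.2⟩
    · simp at h2
  · rintro ⟨b, h1, h2, h3⟩
    exact ⟨b, Finset.mem_Ico.2 ⟨h1, h2⟩, by rw [if_pos h3]; exact one_pos⟩

theorem links_pos_iff [DecidableEq α] {N : Set (List α)} (hN : N.Finite) {p : List α} :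
    0 < links N p ↔ ∃ q ∈ N, lspal q.tail = p := by
  rw [links, Set.ncard_pos (hN.subset fun _ h => h.1)]
  rfl

theorem refs_congr [DecidableEq α] {E' : ℕ → ℕ} (h : ∀ b, l ≤ b → b < r → E b = E' b)
    (p : List α) : refs S l r E p = refs S l r E' p := by
  refine Finset.sum_congr rfl fun b hb => ?_
  rw [Finset.mem_Ico] at hb
  rw [h b hb.1 hb.2]

/-- The lost reference is added on the left and the gained one on the right, which avoids truncated
subtraction. -/
theorem refs_update [DecidableEq α] {q e : ℕ} (hl : l ≤ q) (hr : q < r) (p : List α) :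
    refs S l r (Function.update E q e) p + (if q < E q ∧ factor S q (E q) = p then 1 else 0) =
      refs S l r E p + (if q < e ∧ factor S q e = p then 1 else 0) := by
  have hq : q ∈ Finset.Ico l r := Finset.mem_Ico.2 ⟨hl, hr⟩
  rw [refs, refs, ← Finset.add_sum_erase _ _ hq, ← Finset.add_sum_erase _ _ hq]
  have : ∑ b ∈ (Finset.Ico l r).erase q, (if b < Function.update E q e b ∧
      factor S b (Function.update E q e b) = p then 1 else 0) =
      ∑ b ∈ (Finset.Ico l r).erase q, if b < E b ∧ factor S b (E b) = p then 1 else 0 := by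
    refine Finset.sum_congr rfl fun b hb => ?_
    rw [Function.update_of_ne (Finset.ne_of_mem_erase hb)]
  rw [this]
  simp only [Function.update_self]
  ring

theorem refs_succ_left [DecidableEq α] (hlr : l < r) (p : List α) :
    refs S l r E p =
      refs S (l + 1) r E p + (if l < E l ∧ factor S l (E l) = p then 1 else 0) := by
  rw [refs, Finset.sum_eq_sum_Ico_succ_bot hlr, add_comm]
  rfl

theorem refs_succ_right [DecidableEq α] (hlr : l ≤ r) (h : E r = r) (p : List α) :
    refs S l (r + 1) E p = refs S l r E p := by
  rw [refs, Finset.sum_Ico_succ_top hlr, if_neg (by omega)]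
  rfl

/-- The longest palindromic prefix survives the deletion of the first character iff it has a
reference. -/
theorem Surface.first_mem_iff [DecidableEq α] (h : Surface S l r E) (hr : r ≤ S.length)
    (hlr : l < r) {E' : ℕ → ℕ} (h' : Surface S (l + 1) r E') :
    factor S l (E l) ∈ pals (factor S (l + 1) r) ↔
      0 < refs S (l + 1) r E' (factor S l (E l)) +
        links (pals (factor S l r)) (factor S l (E l)) := by
  have hsub : pals (factor S (l + 1) r) ⊆ pals (factor S l r) := fun p hp =>
    ⟨hp.1, hp.2.1, hp.2.2.trans (factor_suffix (Nat.le_succ l)).isInfix⟩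
  rw [add_pos_iff, refs_pos_iff, links_pos_iff (finite_pals _)]
  constructor
  · intro hp
    rcases h'.exists_ref hr hp with h1 | ⟨q, h1, h2⟩
    · exact .inl h1
    · exact .inr ⟨q, hsub h1, h2⟩
  · rintro (⟨b, h1, h2, h3, h4⟩ | ⟨q, h1, h2⟩)
    · rcases h'.entry b h1 h2 with h5 | ⟨h5, h6, h7⟩
      · omega
      · exact (mem_pals_factor hr).2 ⟨h4 ▸ h7, b, E' b, h1, h5, h6, h4.symm⟩
    · have h3 := lspal_tail_length_lt h1.1
      -- A palindrome whose link is the longest prefix is strictly longer than it, so it survives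
      -- the deletion and keeps its suffix link alive as a factor.
      have h4 := h.mem_pals_delete hr hlr h1 (by rintro rfl; rw [h2] at h3; omega)
      obtain ⟨h5, h6, h7, -⟩ := h.first hr hlr
      refine (factorClosed_pals _).mem q h4 _ (factor_ne_nil h5 (h6.trans hr)) h7 ?_
      rw [← h2]
      exact ((lspal_suffix _).trans (List.tail_suffix _)).isInfix

end Factors

/-! ### Eertrees in memory -/

section Memory

variable {σ : ℕ}

/-- The address of the `k`-th block; the first `d` words hold the surface. -/
def blk (σ d k : ℕ) : ℕ := d + k * (σ + 5)

theorem blk_succ (σ d k : ℕ) : blk σ d (k + 1) = blk σ d k + (σ + 5) := by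
  unfold blk
  ring

theorem le_blk (σ d k : ℕ) : d ≤ blk σ d k := Nat.le_add_right _ _

theorem blk_mono {σ d k k' : ℕ} (h : k ≤ k') : blk σ d k ≤ blk σ d k' :=
  Nat.add_le_add_left (Nat.mul_le_mul_right _ h) _

theorem blk_lt_blk {σ d k k' : ℕ} (h : k < k') : blk σ d k + (σ + 5) ≤ blk σ d k' := by
  rw [← blk_succ]
  exact blk_mono h

/-- Reduces every question whether two memory words coincide to block numbers and offsets; the
aliasing arguments below all rest on it. -/
theorem blk_add_inj {σ d k k' o o' : ℕ} (ho : o < σ + 5) (ho' : o' < σ + 5) :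
    blk σ d k + o = blk σ d k' + o' ↔ k = k' ∧ o = o' := by
  constructor
  · intro h
    rcases lt_trichotomy k k' with h1 | h1 | h1
    · have := blk_lt_blk (σ := σ) (d := d) h1
      omega
    · subst h1
      exact ⟨rfl, by omega⟩
    · have := blk_lt_blk (σ := σ) (d := d) h1
      omega
  · rintro ⟨rfl, rfl⟩
    rfl

theorem blk_eq_add {σ d k k' o : ℕ} (ho : o < σ + 5) :
    blk σ d k = blk σ d k' + o ↔ k = k' ∧ 0 = o :=
  blk_add_inj (o := 0) (by omega) ho

theorem blk_add_eq {σ d k k' o : ℕ} (ho : o < σ + 5) :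
    blk σ d k + o = blk σ d k' ↔ k = k' ∧ o = 0 :=
  blk_add_inj (o' := 0) ho (by omega)

theorem blk_inj {σ d k k' : ℕ} : blk σ d k = blk σ d k' ↔ k = k' := by
  have := blk_add_inj (σ := σ) (d := d) (k := k) (k' := k') (o := 0) (o' := 0) (by omega) (by omega)
  simpa using this

/-- The blocks in `F` form a linked list that starts at the given address. -/
def FreeChain (σ d : ℕ) (mem : ℕ → ℕ) : ℕ → List ℕ → Prop
  | a, [] => a = 0
  | a, k :: F => a = blk σ d k ∧ FreeChain σ d mem (mem (blk σ d k + 1)) F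

theorem FreeChain.congr {d : ℕ} {mem mem' : ℕ → ℕ} {F : List ℕ}
    (h : ∀ k ∈ F, mem' (blk σ d k + 1) = mem (blk σ d k + 1)) {a : ℕ}
    (hF : FreeChain σ d mem a F) : FreeChain σ d mem' a F := by
  induction F generalizing a with
  | nil => exact hF
  | cons k F ih =>
    refine ⟨hF.1, ?_⟩
    rw [h k (by simp)]
    exact ih (fun k' hk' => h k' (by simp [hk'])) hF.2

/-- The memory contains an eertree with ordinary nodes `N`, node `v` being stored in block `ix v`.
The last word of an ordinary node is the number of its incoming suffix links plus the number of
other references to it. Blocks in `F` are free. -/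
structure Tree (d : ℕ) (N : Set (List (Fin σ))) (ref : List (Fin σ) → ℕ) (mem : ℕ → ℕ)
    (ix : ENode (Fin σ) → ℕ) (F : List ℕ) (K head : ℕ) : Prop where
  ix_lt : ∀ v, NodeIn N v → ix v < K
  ix_inj : ∀ u v, NodeIn N u → NodeIn N v → ix u = ix v → u = v
  len : ∀ v, NodeIn N v → mem (blk σ d (ix v)) = lp v
  slink : ∀ v, NodeIn N v → mem (blk σ d (ix v) + 1) = blk σ d (ix (slink v))
  parent : ∀ u c, NodeIn N u → wrap c u ∈ N →
    mem (blk σ d (ix (.ord (wrap c u))) + 2) = blk σ d (ix u)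
  label : ∀ u c, NodeIn N u → wrap c u ∈ N →
    mem (blk σ d (ix (.ord (wrap c u))) + 3) = c.val
  child : ∀ u c, NodeIn N u → wrap c u ∈ N →
    mem (blk σ d (ix u) + (4 + c.val)) = blk σ d (ix (.ord (wrap c u)))
  no_child : ∀ u c, NodeIn N u → wrap c u ∉ N → mem (blk σ d (ix u) + (4 + c.val)) = 0
  count : ∀ p ∈ N, mem (blk σ d (ix (.ord p)) + (4 + σ)) = ref p + links N p
  free_lt : ∀ k ∈ F, k < K
  free_nodup : F.Nodup
  free_ne : ∀ k ∈ F, ∀ v, NodeIn N v → ix v ≠ k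
  free_null : ∀ k ∈ F, ∀ c : Fin σ, mem (blk σ d k + (4 + c.val)) = 0
  chain : FreeChain σ d mem head F

variable {d : ℕ} {N : Set (List (Fin σ))} {ref : List (Fin σ) → ℕ} {mem mem' : ℕ → ℕ}
  {ix : ENode (Fin σ) → ℕ} {F : List ℕ} {K head : ℕ}

theorem Tree.congr (h : Tree d N ref mem ix F K head)
    (hN : ∀ v, NodeIn N v → ∀ o < σ + 5, mem' (blk σ d (ix v) + o) = mem (blk σ d (ix v) + o))
    (hF : ∀ k ∈ F, ∀ o < σ + 5, mem' (blk σ d k + o) = mem (blk σ d k + o)) :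
    Tree d N ref mem' ix F K head where
  ix_lt := h.ix_lt
  ix_inj := h.ix_inj
  len v hv := (hN v hv 0 (by omega)).trans (h.len v hv)
  slink v hv := (hN v hv 1 (by omega)).trans (h.slink v hv)
  parent u c hu hw := (hN (.ord _) hw 2 (by omega)).trans (h.parent u c hu hw)
  label u c hu hw := (hN (.ord _) hw 3 (by omega)).trans (h.label u c hu hw)
  child u c hu hw := (hN u hu _ (by omega)).trans (h.child u c hu hw)
  no_child u c hu hw := (hN u hu _ (by omega)).trans (h.no_child u c hu hw)
  count p hp := (hN (.ord p) hp _ (by omega)).trans (h.count p hp)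
  free_lt := h.free_lt
  free_nodup := h.free_nodup
  free_ne := h.free_ne
  free_null k hk c := (hF k hk _ (by omega)).trans (h.free_null k hk c)
  chain := h.chain.congr fun k hk => hF k hk 1 (by omega)

theorem Tree.congr_ref (h : Tree d N ref mem ix F K head) {ref' : List (Fin σ) → ℕ}
    (hr : ∀ p ∈ N, ref' p = ref p) : Tree d N ref' mem ix F K head :=
  { h with count := fun p hp => by rw [hr p hp]; exact h.count p hp }

/-- The words outside the blocks are irrelevant. -/
theorem Tree.update_surface (h : Tree d N ref mem ix F K head) {a : ℕ} (ha : a < d) (x : ℕ) :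
    Tree d N ref (Function.update mem a x) ix F K head := by
  refine h.congr (fun v _ o _ => ?_) (fun k _ o _ => ?_)
  · rw [Function.update_of_ne]
    have := le_blk σ d (ix v)
    omega
  · rw [Function.update_of_ne]
    have := le_blk σ d k
    omega

/-- Changing a counter. -/
theorem Tree.update_count (h : Tree d N ref mem ix F K head) {ref' : List (Fin σ) → ℕ}
    {p : List (Fin σ)} (hp : p ∈ N) {x : ℕ} (hx : x = ref' p + links N p)
    (hr : ∀ q ∈ N, q ≠ p → ref' q = ref q) :
    Tree d N ref' (Function.update mem (blk σ d (ix (.ord p)) + (4 + σ)) x) ix F K head := by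
  have key : ∀ k o, o < 4 + σ → Function.update mem (blk σ d (ix (.ord p)) + (4 + σ)) x
      (blk σ d k + o) = mem (blk σ d k + o) := by
    intro k o ho
    rw [Function.update_of_ne]
    rw [Ne, blk_add_inj (by omega) (by omega)]
    omega
  exact {
    ix_lt := h.ix_lt
    ix_inj := h.ix_inj
    len := fun v hv => (key _ 0 (by omega)).trans (h.len v hv)
    slink := fun v hv => (key _ 1 (by omega)).trans (h.slink v hv)
    parent := fun u c hu hw => (key _ 2 (by omega)).trans (h.parent u c hu hw)
    label := fun u c hu hw => (key _ 3 (by omega)).trans (h.label u c hu hw)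
    child := fun u c hu hw => (key _ _ (by omega)).trans (h.child u c hu hw)
    no_child := fun u c hu hw => (key _ _ (by omega)).trans (h.no_child u c hu hw)
    count := by
      intro q hq
      by_cases hqp : q = p
      · subst hqp
        rw [Function.update_self, hx]
      · rw [Function.update_of_ne, hr q hq hqp]
        · exact h.count q hq
        · rw [Ne, blk_add_inj (by omega) (by omega)]
          intro h1
          have := h.ix_inj (.ord q) (.ord p) hq hp h1.1
          exact hqp (by simpa using this)
    free_lt := h.free_lt
    free_nodup := h.free_nodup
    free_ne := h.free_ne
    free_null := fun k hk c => (key _ _ (by omega)).trans (h.free_null k hk c)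
    chain := h.chain.congr fun k hk => key _ 1 (by omega) }

theorem Tree.mono (h : Tree d N ref mem ix F K head) {K' : ℕ} (hK : K ≤ K') :
    Tree d N ref mem ix F K' head :=
  { h with
    ix_lt := fun v hv => (h.ix_lt v hv).trans_le hK
    free_lt := fun k hk => (h.free_lt k hk).trans_le hK }

/-- Taking the first block from the list of free blocks. -/
theorem Tree.pop {k : ℕ} (h : Tree d N ref mem ix (k :: F) K head) :
    Tree d N ref mem ix F K (mem (blk σ d k + 1)) :=
  { h with
    free_lt := fun k' hk => h.free_lt k' (by simp [hk])
    free_nodup := (List.nodup_cons.1 h.free_nodup).2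
    free_ne := fun k' hk => h.free_ne k' (by simp [hk])
    free_null := fun k' hk => h.free_null k' (by simp [hk])
    chain := h.chain.2 }

/-! ### Adding and removing a node -/

theorem links_insert (hN : N.Finite) {p : List (Fin σ)} (hp : p ∉ N) (q : List (Fin σ)) :
    links (insert p N) q = links N q + if lspal p.tail = q then 1 else 0 := by
  unfold links
  split_ifs with h
  · have : {x ∈ insert p N | lspal x.tail = q} = insert p {x ∈ N | lspal x.tail = q} := by
      ext x
      simp only [Set.mem_insert_iff, Set.mem_ofPred_eq]
      constructor
      · tauto
      · rintro (rfl | h1)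
        · exact ⟨.inl rfl, h⟩
        · exact ⟨.inr h1.1, h1.2⟩
    rw [this, Set.ncard_insert_of_notMem (fun h1 => hp h1.1) (hN.subset fun _ h1 => h1.1)]
  · have : {x ∈ insert p N | lspal x.tail = q} = {x ∈ N | lspal x.tail = q} := by
      ext x
      simp only [Set.mem_insert_iff, Set.mem_ofPred_eq]
      constructor
      · rintro ⟨rfl | h1, h2⟩
        · exact absurd h2 h
        · exact ⟨h1, h2⟩
      · tauto
    rw [this, add_zero]

theorem nodeIn_insert_iff {p : List (Fin σ)} {v : ENode (Fin σ)} :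
    NodeIn (insert p N) v ↔ v = .ord p ∨ NodeIn N v := by
  cases v <;> simp [NodeIn]

theorem mem_of_node_mem {N : Set (List (Fin σ))} {p : List (Fin σ)}
    (h0 : p ≠ []) (h : NodeIn N (node p)) : p ∈ N := by
  rwa [node_of_ne_nil h0] at h

/-- Adding a node. -/
theorem Tree.add_node (h : Tree d N ref mem ix F K head) (hN : FactorClosed N) (hfin : N.Finite)
    {u : ENode (Fin σ)} {c : Fin σ} (hu : NodeIn N u) (hp : wrap c u ∉ N)
    (hN' : FactorClosed (insert (wrap c u) N)) (href : ref (wrap c u) = 0) {kn : ℕ} (hkK : kn < K)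
    (hkF : kn ∉ F) (hkix : ∀ v, NodeIn N v → ix v ≠ kn)
    {ix' : ENode (Fin σ) → ℕ} (hixp : ix' (.ord (wrap c u)) = kn)
    (hix : ∀ v, NodeIn N v → ix' v = ix v)
    (hlen : mem' (blk σ d kn) = lp u + 2)
    (hslink : mem' (blk σ d kn + 1) = blk σ d (ix (SlidingEertree.slink (.ord (wrap c u)))))
    (hparent : mem' (blk σ d kn + 2) = blk σ d (ix u))
    (hlabel : mem' (blk σ d kn + 3) = c.val)
    (hnull : ∀ c' : Fin σ, mem' (blk σ d kn + (4 + c'.val)) = 0)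
    (hcount : mem' (blk σ d kn + (4 + σ)) = 0)
    (hchild : mem' (blk σ d (ix u) + (4 + c.val)) = blk σ d kn)
    (hinc : ∀ q, SlidingEertree.slink (.ord (wrap c u)) = .ord q →
      mem' (blk σ d (ix (.ord q)) + (4 + σ)) = mem (blk σ d (ix (.ord q)) + (4 + σ)) + 1)
    (hother : ∀ v, NodeIn N v → ∀ o < σ + 5, ¬ (v = u ∧ o = 4 + c.val) →
      ¬ (v = SlidingEertree.slink (.ord (wrap c u)) ∧ o = 4 + σ) →
      mem' (blk σ d (ix v) + o) = mem (blk σ d (ix v) + o))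
    (hF : ∀ k ∈ F, ∀ o < σ + 5, mem' (blk σ d k + o) = mem (blk σ d k + o)) :
    Tree d (insert (wrap c u) N) ref mem' ix' F K head := by
  set p := wrap c u with hpdef
  have hpv : Valid (.ord p) := ⟨wrap_ne_nil c u, (hN.valid hu).wrap c⟩
  have hsl : NodeIn N (SlidingEertree.slink (.ord p)) := by
    rcases nodeIn_insert_iff.1 (hN'.nodeIn_slink (v := .ord p) (Set.mem_insert _ _)) with h1 | h1
    · have := lp_slink_lt hpv (by simp)
      rw [h1] at this
      omega
    · exact h1
  -- a child of the new node would contain it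
  have hnew : ∀ c', wrap c' (.ord p) ∉ (insert p N : Set (List (Fin σ))) := by
    intro c' h1
    rcases Set.mem_insert_iff.1 h1 with h1 | h1
    · exact absurd (congrArg List.length h1) (by simp only [length_wrap, lp_ord]; omega)
    · exact hp (hN.nodeIn_of_wrap hpv h1)
  have hval : ∀ v, NodeIn N v → Valid v := fun v hv => hN.valid hv
  constructor
  · intro v hv
    rcases nodeIn_insert_iff.1 hv with rfl | hv
    · rwa [hixp]
    · rw [hix v hv]
      exact h.ix_lt v hv
  · intro v v' hv hv' he
    rcases nodeIn_insert_iff.1 hv with rfl | hv <;> rcases nodeIn_insert_iff.1 hv' with rfl | hv'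
    · rfl
    · rw [hixp, hix v' hv'] at he
      exact absurd he.symm (hkix v' hv')
    · rw [hixp, hix v hv] at he
      exact absurd he (hkix v hv)
    · rw [hix v hv, hix v' hv'] at he
      exact h.ix_inj v v' hv hv' he
  · intro v hv
    rcases nodeIn_insert_iff.1 hv with rfl | hv
    · rw [hixp, hlen]
      simp [hpdef]
    · rw [hix v hv, ← h.len v hv]
      exact hother v hv 0 (by omega) (by omega) (by omega)
  · intro v hv
    rcases nodeIn_insert_iff.1 hv with rfl | hv
    · rw [hixp, hslink, hix _ hsl]
    · rw [hix v hv, hix _ (hN.nodeIn_slink hv), ← h.slink v hv]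
      exact hother v hv 1 (by omega) (by omega) (by omega)
  · intro v c' hv hw
    rcases nodeIn_insert_iff.1 hv with rfl | hv
    · exact absurd hw (hnew c')
    · rw [hix v hv]
      rcases Set.mem_insert_iff.1 hw with h1 | h1
      · obtain ⟨-, rfl⟩ := wrap_inj (hval v hv) (hval u hu) h1
        rw [h1, hixp, hparent]
      · rw [hix (.ord _) h1, ← h.parent v c' hv h1]
        exact hother (.ord _) h1 2 (by omega) (by omega) (by omega)
  · intro v c' hv hw
    rcases nodeIn_insert_iff.1 hv with rfl | hv
    · exact absurd hw (hnew c')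
    · rcases Set.mem_insert_iff.1 hw with h1 | h1
      · obtain ⟨rfl, rfl⟩ := wrap_inj (hval v hv) (hval u hu) h1
        rw [h1, hixp, hlabel]
      · rw [hix (.ord _) h1, ← h.label v c' hv h1]
        exact hother (.ord _) h1 3 (by omega) (by omega) (by omega)
  · intro v c' hv hw
    rcases nodeIn_insert_iff.1 hv with rfl | hv
    · exact absurd hw (hnew c')
    · rw [hix v hv]
      rcases Set.mem_insert_iff.1 hw with h1 | h1
      · obtain ⟨rfl, rfl⟩ := wrap_inj (hval v hv) (hval u hu) h1
        rw [h1, hixp, hchild]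
      · rw [hix (.ord _) h1, ← h.child v c' hv h1]
        refine hother v hv _ (by omega) ?_ (by omega)
        rintro ⟨rfl, h2⟩
        obtain rfl : c' = c := Fin.ext (by omega)
        exact hp h1
  · intro v c' hv hw
    rcases nodeIn_insert_iff.1 hv with rfl | hv
    · rw [hixp]
      exact hnull c'
    · rw [hix v hv, ← h.no_child v c' hv fun h1 => hw (Set.mem_insert_of_mem _ h1)]
      refine hother v hv _ (by omega) ?_ (by omega)
      rintro ⟨rfl, h2⟩
      obtain rfl : c' = c := Fin.ext (by omega)
      exact hw (Set.mem_insert _ _)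
  · intro q hq
    rw [links_insert hfin hp]
    rcases Set.mem_insert_iff.1 hq with rfl | hq
    -- An element of `N` linking to the new palindrome would force the palindrome into the
    -- factor-closed set `N`. So zero is the correct initial counter.
    · have h1 : links N p = 0 := by
        by_contra h2
        obtain ⟨x, h3, h4⟩ := (links_pos_iff hfin).1 (Nat.pos_of_ne_zero h2)
        apply hp
        rw [← h4]
        exact mem_of_node_mem (by rw [h4]; exact hpv.1)
          (hN.nodeIn_slink (v := .ord x) h3)
      have h2 : lspal p.tail ≠ p := by
        intro h3
        have := lspal_tail_length_lt hpv.1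
        rw [h3] at this
        omega
      rw [hixp, hcount, href, h1, if_neg h2]
    · rw [hix (.ord q) hq]
      split_ifs with h1
      · have h2 : SlidingEertree.slink (.ord p) = .ord q := by
          rw [SlidingEertree.slink, h1, node_of_ne_nil (hN.ne_nil q hq)]
        rw [hinc q h2, h.count q hq, add_assoc]
      · rw [add_zero, ← h.count q hq]
        refine hother (.ord q) hq _ (by omega) (by omega) ?_
        rintro ⟨h2, -⟩
        apply h1
        have := congrArg ENode.pal h2
        simpa [SlidingEertree.slink] using this.symm
  · exact h.free_lt
  · exact h.free_nodup
  · intro k hk v hv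
    rcases nodeIn_insert_iff.1 hv with rfl | hv
    · rw [hixp]
      rintro rfl
      exact hkF hk
    · rw [hix v hv]
      exact h.free_ne k hk v hv
  · intro k hk c'
    rw [hF k hk _ (by omega)]
    exact h.free_null k hk c'
  · exact h.chain.congr fun k hk => hF k hk 1 (by omega)

/-- Removing a leaf. -/
theorem Tree.remove_node {u : ENode (Fin σ)} {c : Fin σ}
    (hN' : FactorClosed (insert (wrap c u) N)) (hN : FactorClosed N)
    (hfin : N.Finite) (hp : wrap c u ∉ N)
    (h : Tree d (insert (wrap c u) N) ref mem ix F K head) (hu : NodeIn N u)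
    (hnull : mem' (blk σ d (ix u) + (4 + c.val)) = 0)
    (hdec : mem' (blk σ d (ix (SlidingEertree.slink (.ord (wrap c u)))) + (4 + σ)) =
      mem (blk σ d (ix (SlidingEertree.slink (.ord (wrap c u)))) + (4 + σ)) - 1)
    (hnext : mem' (blk σ d (ix (.ord (wrap c u))) + 1) = head)
    (hown : ∀ o < 4 + σ, o ≠ 1 → mem' (blk σ d (ix (.ord (wrap c u))) + o) =
      mem (blk σ d (ix (.ord (wrap c u))) + o))
    (hother : ∀ v, NodeIn N v → ∀ o < σ + 5, ¬ (v = u ∧ o = 4 + c.val) →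
      ¬ (v = SlidingEertree.slink (.ord (wrap c u)) ∧ o = 4 + σ) →
      mem' (blk σ d (ix v) + o) = mem (blk σ d (ix v) + o))
    (hF : ∀ k ∈ F, ∀ o < σ + 5, mem' (blk σ d k + o) = mem (blk σ d k + o)) :
    Tree d N ref mem' ix (ix (.ord (wrap c u)) :: F) K (blk σ d (ix (.ord (wrap c u)))) := by
  set p := wrap c u with hpdef
  have hpN : p ∈ (insert p N : Set (List (Fin σ))) := Set.mem_insert _ _
  have hin : ∀ v, NodeIn N v → NodeIn (insert p N) v := fun v hv => nodeIn_insert_iff.2 (.inr hv)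
  have hval : ∀ v, NodeIn N v → Valid v := fun v hv => hN.valid hv
  have hpv : Valid (.ord p) := ⟨wrap_ne_nil c u, (hN.valid hu).wrap c⟩
  have hne : ∀ v, NodeIn N v → v ≠ .ord p := by
    rintro v hv rfl
    exact hp hv
  constructor
  · exact fun v hv => h.ix_lt v (hin v hv)
  · exact fun v v' hv hv' => h.ix_inj v v' (hin v hv) (hin v' hv')
  · intro v hv
    rw [← h.len v (hin v hv)]
    exact hother v hv 0 (by omega) (by omega) (by omega)
  · intro v hv
    rw [← h.slink v (hin v hv)]
    exact hother v hv 1 (by omega) (by omega) (by omega)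
  · intro v c' hv hw
    rw [← h.parent v c' (hin v hv) (Set.mem_insert_of_mem _ hw)]
    exact hother (.ord _) hw 2 (by omega) (by omega) (by omega)
  · intro v c' hv hw
    rw [← h.label v c' (hin v hv) (Set.mem_insert_of_mem _ hw)]
    exact hother (.ord _) hw 3 (by omega) (by omega) (by omega)
  · intro v c' hv hw
    rw [← h.child v c' (hin v hv) (Set.mem_insert_of_mem _ hw)]
    refine hother v hv _ (by omega) ?_ (by omega)
    rintro ⟨rfl, h2⟩
    obtain rfl : c' = c := Fin.ext (by omega)
    exact hp hw
  · intro v c' hv hw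
    by_cases h1 : v = u ∧ c' = c
    · rw [h1.1, h1.2]
      exact hnull
    · rw [← h.no_child v c' (hin v hv)]
      · refine hother v hv _ (by omega) ?_ (by omega)
        rintro ⟨h2, h3⟩
        exact h1 ⟨h2, Fin.ext (by omega)⟩
      · intro h2
        rcases Set.mem_insert_iff.1 h2 with h2 | h2
        · have := wrap_inj (hval v hv) (hval u hu) h2
          exact h1 this.symm
        · exact hw h2
  · intro q hq
    have h0 := h.count q (Set.mem_insert_of_mem _ hq)
    rw [links_insert hfin hp] at h0
    by_cases h1 : lspal p.tail = q
    · have h2 : SlidingEertree.slink (.ord p) = .ord q := by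
        rw [SlidingEertree.slink, h1, node_of_ne_nil (hN.ne_nil q hq)]
      rw [h2] at hdec
      rw [hdec, h0, if_pos h1]
      omega
    · rw [if_neg h1] at h0
      rw [← add_zero (links N q), ← h0]
      refine hother (.ord q) hq _ (by omega) (by omega) ?_
      rintro ⟨h2, -⟩
      apply h1
      have := congrArg ENode.pal h2
      simpa [SlidingEertree.slink] using this.symm
  · intro k hk
    rcases List.mem_cons.1 hk with rfl | hk
    · exact h.ix_lt (.ord p) hpN
    · exact h.free_lt k hk
  · exact List.nodup_cons.2 ⟨fun hk => h.free_ne _ hk (.ord p) hpN rfl, h.free_nodup⟩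
  · intro k hk v hv
    rcases List.mem_cons.1 hk with rfl | hk
    · exact fun h1 => hne v hv (h.ix_inj v (.ord p) (hin v hv) hpN h1)
    · exact h.free_ne k hk v (hin v hv)
  · intro k hk c'
    rcases List.mem_cons.1 hk with rfl | hk
    · rw [hown _ (by omega) (by omega)]
      refine h.no_child (.ord p) c' hpN ?_
      intro h1
      rcases Set.mem_insert_iff.1 h1 with h1 | h1
      · exact absurd (congrArg List.length h1) (by simp only [length_wrap, lp_ord]; omega)
      · exact hp (hN.nodeIn_of_wrap hpv h1)
    · rw [hF k hk _ (by omega)]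
      exact h.free_null k hk c'
  · refine ⟨rfl, ?_⟩
    rw [hnext]
    exact h.chain.congr fun k hk => hF k hk 1 (by omega)

end Memory

/-! ### Reasoning about programs -/

section Logic

/-- Value of an expression without overflows. -/
def val (reg : ℕ → ℕ) : RExpr → ℕ
  | .const k => k
  | .reg r => reg r
  | .add e₁ e₂ => val reg e₁ + val reg e₂
  | .sub e₁ e₂ => val reg e₁ - val reg e₂
  | .mul e₁ e₂ => val reg e₁ * val reg e₂
  | .div e₁ e₂ => val reg e₁ / val reg e₂
  | .mod e₁ e₂ => val reg e₁ % val reg e₂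

/-- No operation in the expression overflows. -/
def Fits (m : ℕ) (reg : ℕ → ℕ) : RExpr → Prop
  | .const k => k < m
  | .reg _ => True
  | .add e₁ e₂ => Fits m reg e₁ ∧ Fits m reg e₂ ∧ val reg e₁ + val reg e₂ < m
  | .sub e₁ e₂ => Fits m reg e₁ ∧ Fits m reg e₂
  | .mul e₁ e₂ => Fits m reg e₁ ∧ Fits m reg e₂ ∧ val reg e₁ * val reg e₂ < m
  | .div e₁ e₂ => Fits m reg e₁ ∧ Fits m reg e₂
  | .mod e₁ e₂ => Fits m reg e₁ ∧ Fits m reg e₂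

theorem eval_eq_val {w : ℕ} {reg : ℕ → ℕ} {e : RExpr} (h : Fits (2 ^ w) reg e) :
    e.eval w reg = val reg e := by
  induction e with
  | const k => exact Nat.mod_eq_of_lt h
  | reg r => rfl
  | add e₁ e₂ ih₁ ih₂ =>
    rw [RExpr.eval, ih₁ h.1, ih₂ h.2.1]
    exact Nat.mod_eq_of_lt h.2.2
  | sub e₁ e₂ ih₁ ih₂ => rw [RExpr.eval, ih₁ h.1, ih₂ h.2]; rfl
  | mul e₁ e₂ ih₁ ih₂ =>
    rw [RExpr.eval, ih₁ h.1, ih₂ h.2.1]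
    exact Nat.mod_eq_of_lt h.2.2
  | div e₁ e₂ ih₁ ih₂ => rw [RExpr.eval, ih₁ h.1, ih₂ h.2]; rfl
  | mod e₁ e₂ ih₁ ih₂ => rw [RExpr.eval, ih₁ h.1, ih₂ h.2]; rfl

variable {σ : ℕ} {E : REnv σ} {s : RState} {Q : ℕ → RState → Prop}

/-- The program runs without error and ends after a time and in a state that satisfy `Q`. -/
def Wp (E : REnv σ) (c : Cmd) (s : RState) (Q : ℕ → RState → Prop) : Prop :=
  ∃ t s', Exec E c s t s' ∧ Q t s'

theorem Wp.mono {c : Cmd} {Q' : ℕ → RState → Prop} (h : Wp E c s Q)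
    (hQ : ∀ t s', Q t s' → Q' t s') : Wp E c s Q' := by
  obtain ⟨t, s', h1, h2⟩ := h
  exact ⟨t, s', h1, hQ t s' h2⟩

theorem wp_skip (h : Q 1 s) : Wp E .skip s Q := ⟨_, _, .skip s, h⟩

theorem wp_seq {c₁ c₂ : Cmd} (h : Wp E c₁ s fun t s' => Wp E c₂ s' fun t' s'' => Q (t + t') s'') :
    Wp E (.seq c₁ c₂) s Q := by
  obtain ⟨t, s', h1, t', s'', h2, h3⟩ := h
  exact ⟨_, _, .seq h1 h2, h3⟩

theorem wp_set {r : ℕ} {e : RExpr} (x : ℕ) (hf : Fits (2 ^ E.w) s.reg e) (hx : val s.reg e = x)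
    (h : Q (e.cost + 1) ⟨Function.update s.reg r x, s.mem⟩) : Wp E (.set r e) s Q := by
  have := Exec.set (E := E) s r e
  rw [eval_eq_val hf, hx] at this
  exact ⟨_, _, this, h⟩

theorem wp_load {r : ℕ} {e : RExpr} (a : ℕ) (hf : Fits (2 ^ E.w) s.reg e) (hx : val s.reg e = a)
    (ha : a < E.M) (h : Q (e.cost + 1) ⟨Function.update s.reg r (s.mem a), s.mem⟩) :
    Wp E (.load r e) s Q := by
  have := Exec.load (E := E) s r e
  rw [eval_eq_val hf, hx] at this
  exact ⟨_, _, this ha, h⟩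

theorem wp_store {e₁ e₂ : RExpr} (a x : ℕ) (hf₁ : Fits (2 ^ E.w) s.reg e₁)
    (hx₁ : val s.reg e₁ = a) (ha : a < E.M) (hf₂ : Fits (2 ^ E.w) s.reg e₂)
    (hx₂ : val s.reg e₂ = x)
    (h : Q (e₁.cost + e₂.cost + 1) ⟨s.reg, Function.update s.mem a x⟩) :
    Wp E (.store e₁ e₂) s Q := by
  have := Exec.store (E := E) s e₁ e₂
  rw [eval_eq_val hf₁, hx₁, eval_eq_val hf₂, hx₂] at this
  exact ⟨_, _, this ha, h⟩

theorem wp_readChar {r : ℕ} {e : RExpr} (a : ℕ) (hf : Fits (2 ^ E.w) s.reg e)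
    (hx : val s.reg e = a) (hlo : E.lo ≤ a) (hhi : a ≤ E.hi) (hlt : a < E.text.length)
    (h : Q (e.cost + 1) ⟨Function.update s.reg r (E.text[a]).val, s.mem⟩) :
    Wp E (.readChar r e) s Q := by
  have hea : e.eval E.w s.reg = a := (eval_eq_val hf).trans hx
  subst hea
  exact ⟨_, _, .readChar s r e hlo hhi hlt, h⟩

theorem wp_branch_lt {e₁ e₂ : RExpr} {c₁ c₂ : Cmd} (x₁ x₂ : ℕ) (hf₁ : Fits (2 ^ E.w) s.reg e₁)
    (hx₁ : val s.reg e₁ = x₁) (hf₂ : Fits (2 ^ E.w) s.reg e₂) (hx₂ : val s.reg e₂ = x₂)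
    (h₁ : x₁ < x₂ → Wp E c₁ s fun t s' => Q (e₁.cost + e₂.cost + 1 + t) s')
    (h₂ : x₂ ≤ x₁ → Wp E c₂ s fun t s' => Q (e₁.cost + e₂.cost + 1 + t) s') :
    Wp E (.branch (.lt e₁ e₂) c₁ c₂) s Q := by
  have e : (RTest.lt e₁ e₂).Holds E.w s.reg ↔ x₁ < x₂ := by
    rw [RTest.Holds, eval_eq_val hf₁, eval_eq_val hf₂, hx₁, hx₂]
  rcases Nat.lt_or_ge x₁ x₂ with h | h
  · obtain ⟨t, s', h3, h4⟩ := h₁ h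
    exact ⟨_, _, .branchTrue (e.2 h) h3, h4⟩
  · obtain ⟨t, s', h3, h4⟩ := h₂ h
    exact ⟨_, _, .branchFalse (fun h5 => absurd (e.1 h5) (by omega)) h3, h4⟩

theorem wp_branch_eq {e₁ e₂ : RExpr} {c₁ c₂ : Cmd} (x₁ x₂ : ℕ) (hf₁ : Fits (2 ^ E.w) s.reg e₁)
    (hx₁ : val s.reg e₁ = x₁) (hf₂ : Fits (2 ^ E.w) s.reg e₂) (hx₂ : val s.reg e₂ = x₂)
    (h₁ : x₁ = x₂ → Wp E c₁ s fun t s' => Q (e₁.cost + e₂.cost + 1 + t) s')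
    (h₂ : x₁ ≠ x₂ → Wp E c₂ s fun t s' => Q (e₁.cost + e₂.cost + 1 + t) s') :
    Wp E (.branch (.eq e₁ e₂) c₁ c₂) s Q := by
  have e : (RTest.eq e₁ e₂).Holds E.w s.reg ↔ x₁ = x₂ := by
    rw [RTest.Holds, eval_eq_val hf₁, eval_eq_val hf₂, hx₁, hx₂]
  by_cases h : x₁ = x₂
  · obtain ⟨t, s', h3, h4⟩ := h₁ h
    exact ⟨_, _, .branchTrue (e.2 h) h3, h4⟩
  · obtain ⟨t, s', h3, h4⟩ := h₂ h
    exact ⟨_, _, .branchFalse (fun h5 => h (e.1 h5)) h3, h4⟩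

theorem wp_loop_step {b : RTest} {c : Cmd} (hb : b.Holds E.w s.reg)
    (h : Wp E c s fun t s' => Wp E (.loop b c) s' fun t' s'' => Q (b.cost + t + t') s'') :
    Wp E (.loop b c) s Q := by
  obtain ⟨t, s', h1, t', s'', h2, h3⟩ := h
  exact ⟨_, _, .loopStep hb h1 h2, h3⟩

theorem wp_loop_exit {b : RTest} {c : Cmd} (hb : ¬ b.Holds E.w s.reg) (h : Q b.cost s) :
    Wp E (.loop b c) s Q := ⟨_, _, .loopStop hb, h⟩

end Logic

/-! ### The programs

Registers: `0` alphabet size, `1` bound on the window length, `2` and `3` the auxiliary nodes,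
`4` the longest palindromic suffix, `5` and `6` the ends of the window, `7` the first unused block,
`8` the list of free blocks; the others are temporary. -/

section Programs

open RExpr Cmd

/-- The word with offset `k` of the object in register `a`. -/
def fld (a k : ℕ) : RExpr := add (reg a) (const k)

/-- The child of the object in register `a` along the character in register `c`; for `c = 0` this
is the counter. -/
def chd (a c : ℕ) : RExpr := add (reg a) (add (const 4) (reg c))

/-- Follow suffix links from the node in register `10` until the palindrome is extended by the
character in register `9`. -/
def findCmd : Cmd :=
  seq (set 13 (const 0)) (loop (.eq (reg 13) (const 0))
    (seq (load 12 (reg 10))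
    (branch (.lt (reg 6) (add (reg 5) (reg 12))) (load 10 (fld 10 1))
    (seq (readChar 14 (sub (reg 6) (reg 12)))
    (branch (.eq (reg 14) (reg 9)) (set 13 (const 1)) (load 10 (fld 10 1)))))))

/-- Delete the child pointers of the object in register `11`. -/
def clearCmd : Cmd :=
  seq (set 17 (const 0)) (loop (.lt (reg 17) (reg 0))
    (seq (store (chd 11 17) (const 0)) (set 17 (add (reg 17) (const 1)))))

/-- Put the address of an empty object into register `11`. -/
def allocCmd : Cmd :=
  branch (.eq (reg 8) (const 0))
    (seq (set 11 (reg 7)) (seq (set 7 (add (reg 7) (add (reg 0) (const 5)))) clearCmd))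
    (seq (set 11 (reg 8)) (load 8 (fld 8 1)))

def incCmd (a : ℕ) : Cmd :=
  seq (load 18 (chd a 0)) (store (chd a 0) (add (reg 18) (const 1)))

def decCmd (a : ℕ) : Cmd :=
  seq (load 18 (chd a 0)) (store (chd a 0) (sub (reg 18) (const 1)))

/-- Put the suffix link of the new child of the node in register `15` into register `16`. -/
def linkCmd : Cmd :=
  branch (.eq (reg 12) (const 0)) (set 16 (reg 2))
    (seq (load 10 (fld 10 1)) (seq findCmd (load 16 (chd 10 9))))

/-- Write the fields of the new node in register `11`. -/
def fillCmd : Cmd :=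
  seq (store (reg 11) (reg 19)) (seq (store (fld 11 1) (reg 16)) (seq (store (fld 11 2) (reg 15))
    (seq (store (fld 11 3) (reg 9)) (seq (store (chd 11 0) (const 0))
    (seq (store (chd 15 9) (reg 11)) (incCmd 16))))))

/-- Create a child of the node in register `10`. -/
def createCmd : Cmd :=
  seq (set 15 (reg 10)) (seq (set 19 (add (reg 12) (const 2))) (seq linkCmd (seq allocCmd fillCmd)))

/-- Write the node in register `a` into the surface at the address in register `17`. -/
def slotCmd (a : ℕ) : Cmd :=
  seq (load 14 (reg 17)) (seq (branch (.eq (reg 14) (const 0)) skip (decCmd 14))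
    (seq (store (reg 17) (reg a)) (incCmd a)))

/-- Find or create the longest palindromic suffix after appending a character. -/
def growCmd : Cmd :=
  seq (readChar 9 (reg 6)) (seq (set 10 (reg 4)) (seq findCmd (seq (load 11 (chd 10 9))
    (branch (.eq (reg 11) (const 0)) createCmd skip))))

/-- The slot of the new position holds garbage or the entry of a position that has left the window.
It is nulled before `slotCmd`, which reads the slot it overwrites and may be given this very one.
Register `12` holds a length plus one, which accounts for the `2` in the start of the palindrome. -/
def appendCmd : Cmd :=
  seq growCmd (seq (set 4 (reg 11)) (seq (load 12 (reg 4))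
    (seq (store (mod (reg 6) (reg 1)) (const 0))
    (seq (set 17 (mod (sub (add (reg 6) (const 2)) (reg 12)) (reg 1)))
    (seq (slotCmd 4) (set 6 (add (reg 6) (const 1))))))))

/-- Remove the node in register `11`, whose suffix link is in register `10`. -/
def removeCmd : Cmd :=
  seq (load 15 (fld 11 2)) (seq (load 16 (fld 11 3)) (seq (store (chd 15 16) (const 0))
    (seq (decCmd 10) (seq (store (fld 11 1) (reg 8)) (set 8 (reg 11))))))

/-- Enter the suffix link of the longest palindromic prefix into the surface. -/
def shiftCmd : Cmd :=
  branch (.lt (const 1) (reg 13))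
    (seq (set 17 (mod (sub (add (reg 5) (reg 12)) (reg 13)) (reg 1))) (seq (load 14 (reg 17))
      (seq (branch (.eq (reg 14) (const 0)) (set 19 (const 0)) (load 19 (reg 14)))
      (branch (.lt (reg 19) (reg 13)) (slotCmd 10) skip)))) skip

/-- If the longest palindromic prefix is the whole window, it is also the longest palindromic
suffix, and the current node moves to its link. Removing the prefix lowers the counter of its link,
but no cascade follows, since no other palindrome can vanish. -/
def deleteCmd : Cmd :=
  seq (load 11 (mod (reg 5) (reg 1))) (seq (load 10 (fld 11 1)) (seq (load 12 (reg 11))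
    (seq (load 13 (reg 10))
    (seq (branch (.eq (add (reg 5) (reg 12)) (add (reg 6) (const 1))) (set 4 (reg 10)) skip)
    (seq shiftCmd (seq (decCmd 11) (seq (load 18 (chd 11 0))
    (seq (branch (.eq (reg 18) (const 0)) removeCmd skip)
    (set 5 (add (reg 5) (const 1)))))))))))

/-- Builds the eertree of the empty string and appends the first letter. The surface needs no
initialization, because each slot is nulled when its position enters the window. -/
def startCmd : Cmd :=
  seq (set 5 (const 0)) (seq (set 6 (const 0)) (seq (set 8 (const 0)) (seq (set 3 (reg 1))
    (seq (set 2 (add (reg 3) (add (reg 0) (const 5))))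
    (seq (set 7 (add (reg 2) (add (reg 0) (const 5))))
    (seq (store (reg 3) (const 0)) (seq (store (fld 3 1) (reg 3))
    (seq (store (reg 2) (const 1)) (seq (store (fld 2 1) (reg 3))
    (seq (set 11 (reg 3)) (seq clearCmd (seq (set 11 (reg 2)) (seq clearCmd
    (seq (set 4 (reg 2)) appendCmd))))))))))))))

/-- The algorithm. -/
def algorithm : WindowAlgorithm where
  start := startCmd
  append := appendCmd
  delete := deleteCmd
  zeroReg := 2
  negReg := 3
  extra := 5
  four_le_extra := by omega

end Programs

/-- The letter before the occurrence of `v` at the end of the window is at `r - lp v`. For the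
`-1`-node this is position `r`, where the new letter is compared with itself, so the search always
ends. -/
theorem extends_iff {α : Type} {S : List α} {l r : ℕ} (hlr : l ≤ r) (hr : r < S.length)
    {v : ENode α} (hv : OnSuffix (factor S l r) v) {c : α} (hc : S[r] = c) :
    Extends (factor S l r) c v ↔ l + lp v ≤ r ∧ S[r - lp v]? = some c := by
  rcases hv.1.eq_neg_or with rfl | ⟨p, hp, rfl⟩
  · simp [Extends, hlr, hr, hc]
  · have hs := hv.2
    rw [node_pal] at hs
    rw [extends_node, lp_node]
    have h1 := eq_factor_of_suffix hr.le hs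
    constructor
    · intro h
      have h2 := h.length_le
      rw [length_factor hr.le, List.length_cons] at h2
      have h3 := eq_factor_of_suffix hr.le h
      rw [List.length_cons, factor_cons (by omega) (by omega)] at h3
      refine ⟨by omega, ?_⟩
      rw [List.getElem?_eq_getElem (by omega), (List.cons.inj h3).1]
    · rintro ⟨h2, h3⟩
      have h4 : factor S (r - (p.length + 1)) r = c :: p := by
        rw [factor_cons (by omega) (by omega)]
        rw [List.getElem?_eq_getElem (by omega)] at h3
        rw [Option.some.inj h3, show r - (p.length + 1) + 1 = r - p.length by omega, ← h1]
      rw [← h4]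
      exact factor_suffix (by omega)

/-! ### Following suffix links -/

section Find

open RExpr Cmd

attribute [local simp] val Fits fld chd Function.update_apply RExpr.cost RTest.Holds RTest.cost

variable {σ : ℕ} {E : REnv σ} {d Kmax : ℕ}

/-- There is room for `Kmax` blocks after the first `d` words, and the words are long enough. -/
structure Room (E : REnv σ) (d Kmax : ℕ) : Prop where
  pos : 1 ≤ d
  fits : blk σ d Kmax ≤ E.M
  word : E.M + E.text.length + 16 < 2 ^ E.w

theorem Room.w_ne (h : Room E d Kmax) : E.w ≠ 0 := by
  intro h0
  have := h.word
  rw [h0] at this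
  omega

theorem Room.blk_le (h : Room E d Kmax) {k : ℕ} (hk : k < Kmax) :
    blk σ d k + (σ + 5) ≤ E.M := by
  rw [← blk_succ]
  exact (blk_mono hk).trans h.fits

variable {N : Set (List (Fin σ))} {ref : List (Fin σ) → ℕ} {mem : ℕ → ℕ}
  {ix : ENode (Fin σ) → ℕ} {F : List ℕ} {K head : ℕ}

/-- Strong induction on `lp v`. An iteration that follows a link takes at most `40` units and lowers
`lp` by at least one, so the cost is `40` times the total drop plus a constant. Maximality is
preserved because no node of the chain lies strictly between a node and its link. -/
theorem wp_find_loop (hB : Room E d Kmax) (hK : K ≤ Kmax) {l r : ℕ} (hlr : l ≤ r)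
    (hr : r < E.text.length) (hlo : E.lo = l) (hhi : E.hi = r) {c : Fin σ}
    (hc : E.text[r] = c) (hT : Tree d N ref mem ix F K head)
    (hN : ∀ v, OnSuffix (factor E.text l r) v → NodeIn N v) (n : ℕ) :
    ∀ (v : ENode (Fin σ)) (s : RState), lp v = n → OnSuffix (factor E.text l r) v →
      s.mem = mem → s.reg 5 = l → s.reg 6 = r → s.reg 9 = c.val → s.reg 13 = 0 →
      s.reg 10 = blk σ d (ix v) →
      Wp E (loop (.eq (reg 13) (const 0))
        (seq (load 12 (reg 10))
        (branch (.lt (reg 6) (add (reg 5) (reg 12))) (load 10 (fld 10 1))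
        (seq (readChar 14 (sub (reg 6) (reg 12)))
        (branch (.eq (reg 14) (reg 9)) (set 13 (const 1)) (load 10 (fld 10 1))))))) s
        fun t s' => ∃ v', OnSuffix (factor E.text l r) v' ∧ Extends (factor E.text l r) c v' ∧
          lp v' ≤ lp v ∧ (∀ x, Valid x → Extends (factor E.text l r) c x → lp x ≤ lp v →
            lp x ≤ lp v') ∧ s'.mem = mem ∧ s'.reg 10 = blk σ d (ix v') ∧ s'.reg 12 = lp v' ∧
          (∀ i, i ≠ 10 → i ≠ 12 → i ≠ 13 → i ≠ 14 → s'.reg i = s.reg i) ∧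
          t + 40 * lp v' ≤ 40 * lp v + 50 := by
  induction n using Nat.strong_induction_on with
  | _ n ih =>
  intro v s hn hv hmem h5 h6 h9 h13 h10
  have hw := hB.word
  have hw0 := hB.w_ne
  have hvN := hN v hv
  have hM := hB.blk_le ((hT.ix_lt v hvN).trans_le hK)
  have hlen := hT.len v hvN
  have hsl := hT.slink v hvN
  have hext := extends_iff hlr hr hv hc
  have hle : l + lp v ≤ r + 1 := by
    rcases hv.1.eq_neg_or with rfl | ⟨p, hp, rfl⟩
    · simp
      omega
    · have := hv.2.length_le
      rw [length_factor hr.le, node_pal] at this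
      rw [lp_node]
      omega
  -- the step to the suffix link
  have next : ∀ (t₀ : ℕ) (s₁ : RState), ¬ Extends (factor E.text l r) c v → s₁.mem = mem →
      s₁.reg 10 = blk σ d (ix (slink v)) →
      (∀ i, i ≠ 10 → i ≠ 12 → i ≠ 14 → s₁.reg i = s.reg i) → t₀ ≤ 40 →
      Wp E (loop (.eq (reg 13) (const 0))
        (seq (load 12 (reg 10))
        (branch (.lt (reg 6) (add (reg 5) (reg 12))) (load 10 (fld 10 1))
        (seq (readChar 14 (sub (reg 6) (reg 12)))
        (branch (.eq (reg 14) (reg 9)) (set 13 (const 1)) (load 10 (fld 10 1))))))) s₁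
        fun t s' => ∃ v', OnSuffix (factor E.text l r) v' ∧ Extends (factor E.text l r) c v' ∧
          lp v' ≤ lp v ∧ (∀ x, Valid x → Extends (factor E.text l r) c x → lp x ≤ lp v →
            lp x ≤ lp v') ∧ s'.mem = mem ∧ s'.reg 10 = blk σ d (ix v') ∧ s'.reg 12 = lp v' ∧
          (∀ i, i ≠ 10 → i ≠ 12 → i ≠ 13 → i ≠ 14 → s'.reg i = s.reg i) ∧
          t₀ + t + 40 * lp v' ≤ 40 * lp v + 50 := by
    intro t₀ s₁ hne hm₁ h10₁ hreg ht₀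
    have hv0 : v ≠ .neg := by
      rintro rfl
      exact hne trivial
    have hlt := lp_slink_lt hv.1 hv0
    refine (ih (lp (slink v)) (hn ▸ hlt) (slink v) s₁ rfl hv.slink hm₁ ?_ ?_ ?_ ?_ h10₁).mono ?_
    · rw [hreg 5 (by simp) (by simp) (by simp), h5]
    · rw [hreg 6 (by simp) (by simp) (by simp), h6]
    · rw [hreg 9 (by simp) (by simp) (by simp), h9]
    · rw [hreg 13 (by simp) (by simp) (by simp), h13]
    rintro t s' ⟨v', g1, g2, g3, g4, g5, g6, g7, g8, g9⟩
    refine ⟨v', g1, g2, by omega, ?_, g5, g6, g7, ?_, by omega⟩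
    · intro x hx hxe hxl
      refine g4 x hx hxe (hv.lp_le_slink (hxe.onSuffix hx) (lt_of_le_of_ne hxl ?_))
      intro he
      have h1 := hxe.onSuffix hx
      have h2 := (extends_iff hlr hr h1 hc).1 hxe
      rw [he] at h2
      exact hne (hext.2 h2)
    · intro i i1 i2 i3 i4
      rw [g8 i i1 i2 i3 i4, hreg i i1 i2 i4]
  refine wp_loop_step (by simp [RExpr.eval, h13]) ?_
  refine wp_seq (wp_load (blk σ d (ix v)) (by simp) (by simp [h10]) (by omega) ?_)
  refine wp_branch_lt r (l + lp v) (by simp) (by simp [h6]) (by simp [h5, hmem, hlen]; omega)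
    (by simp [h5, hmem, hlen]) ?_ ?_
  · intro hlt
    refine wp_load (blk σ d (ix v) + 1) (by simp [h10, hw0]; omega) (by simp [h10]) (by omega) ?_
    refine next _ _ (fun h => by have := (hext.1 h).1; omega) hmem ?_ ?_ ?_
    · simp [hmem, hsl]
    · intro i i1 i2 i3
      simp [i1, i2]
    · simp
  · intro hle'
    refine wp_seq (wp_readChar (r - lp v) (by simp) (by simp [h6, hmem, hlen]) (by omega)
      (by omega) (by omega) ?_)
    refine wp_branch_eq (E.text[r - lp v]).val c.val (by simp) (by simp) (by simp)
      (by simp [h9]) ?_ ?_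
    · intro heq
      refine wp_set 1 (by simp [hw0]) (by simp) ?_
      refine wp_loop_exit (by simp [RExpr.eval]) ?_
      refine ⟨v, hv, hext.2 ⟨hle', ?_⟩, le_rfl, fun x _ _ h => h, hmem, ?_, ?_, ?_, ?_⟩
      · rw [List.getElem?_eq_getElem (by omega), Fin.ext heq]
      · simp [h10]
      · simp [hmem, hlen]
      · intro i i1 i2 i3 i4
        simp [i2, i3, i4]
      · simp
        omega
    · intro hne
      refine wp_load (blk σ d (ix v) + 1) (by simp [h10, hw0]; omega) (by simp [h10]) (by omega) ?_
      refine next _ _ (fun h => hne ?_) hmem ?_ ?_ ?_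
      · have := (hext.1 h).2
        rw [List.getElem?_eq_getElem (by omega)] at this
        rw [Option.some.inj this]
      · simp [hmem, hsl]
      · intro i i1 i2 i3
        simp [i1, i2, i3]
      · simp

theorem wp_find (hB : Room E d Kmax) (hK : K ≤ Kmax) {l r : ℕ} (hlr : l ≤ r)
    (hr : r < E.text.length) (hlo : E.lo = l) (hhi : E.hi = r) {c : Fin σ}
    (hc : E.text[r] = c) (hN : ∀ v, OnSuffix (factor E.text l r) v → NodeIn N v)
    {v : ENode (Fin σ)} {s : RState} (hT : Tree d N ref s.mem ix F K head)
    (hv : OnSuffix (factor E.text l r) v) (h5 : s.reg 5 = l) (h6 : s.reg 6 = r)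
    (h9 : s.reg 9 = c.val) (h10 : s.reg 10 = blk σ d (ix v)) :
    Wp E findCmd s fun t s' => ∃ v', OnSuffix (factor E.text l r) v' ∧
      Extends (factor E.text l r) c v' ∧ lp v' ≤ lp v ∧
      (∀ x, Valid x → Extends (factor E.text l r) c x → lp x ≤ lp v → lp x ≤ lp v') ∧
      s'.mem = s.mem ∧ s'.reg 10 = blk σ d (ix v') ∧ s'.reg 12 = lp v' ∧
      (∀ i, i ≠ 10 → i ≠ 12 → i ≠ 13 → i ≠ 14 → s'.reg i = s.reg i) ∧
      t + 40 * lp v' ≤ 40 * lp v + 60 := by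
  have hw := hB.word
  have hw0 := hB.w_ne
  unfold findCmd
  refine wp_seq (wp_set 0 (by simp) (by simp) ?_)
  refine Wp.mono (wp_find_loop hB hK hlr hr hlo hhi hc hT hN _ v _ rfl hv rfl (by simp [h5])
    (by simp [h6]) (by simp [h9]) (by simp) (by simp [h10])) ?_
  rintro t s' ⟨v', g1, g2, g3, g4, g5, g6, g7, g8, g9⟩
  refine ⟨v', g1, g2, g3, g4, g5, g6, g7, ?_, ?_⟩
  · intro i i1 i2 i3 i4
    rw [g8 i i1 i2 i3 i4]
    simp [i3]
  · simp
    omega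

end Find

/-! ### Creating nodes -/

section Create

open RExpr Cmd

attribute [local simp] val Fits fld chd Function.update_apply RExpr.cost RTest.Holds RTest.cost

variable {σ : ℕ} {E : REnv σ} {d Kmax : ℕ}
variable {N : Set (List (Fin σ))} {ref : List (Fin σ) → ℕ} {ix : ENode (Fin σ) → ℕ}
  {F : List ℕ} {K : ℕ} {s : RState}

theorem Room.le_M (h : Room E d Kmax) : d + Kmax ≤ E.M := by
  have h1 := h.fits
  have h2 : Kmax * 1 ≤ Kmax * (σ + 5) := Nat.mul_le_mul_left _ (by omega)
  unfold blk at h1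
  omega

theorem wp_clear (hB : Room E d Kmax) {k : ℕ} (hk : k < Kmax) (h0 : s.reg 0 = σ)
    (h11 : s.reg 11 = blk σ d k) :
    Wp E clearCmd s fun t s' => (∀ c < σ, s'.mem (blk σ d k + (4 + c)) = 0) ∧
      (∀ a, (∀ c < σ, a ≠ blk σ d k + (4 + c)) → s'.mem a = s.mem a) ∧
      (∀ i, i ≠ 17 → s'.reg i = s.reg i) ∧ t ≤ 20 * σ + 10 := by
  have hw := hB.word
  have hw0 := hB.w_ne
  have hM := hB.blk_le hk
  have loop_spec : ∀ (n i : ℕ) (s : RState), i + n = σ → s.reg 0 = σ → s.reg 11 = blk σ d k →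
      s.reg 17 = i → (∀ c < i, s.mem (blk σ d k + (4 + c)) = 0) →
      Wp E (loop (.lt (reg 17) (reg 0))
        (seq (store (chd 11 17) (const 0)) (set 17 (add (reg 17) (const 1))))) s
      fun t s' => (∀ c < σ, s'.mem (blk σ d k + (4 + c)) = 0) ∧
        (∀ a, (∀ c < σ, a ≠ blk σ d k + (4 + c)) → s'.mem a = s.mem a) ∧
        (∀ i, i ≠ 17 → s'.reg i = s.reg i) ∧ t ≤ 20 * n + 5 := by
    intro n
    induction n with
    | zero =>
      intro i s hi h0 h11 h17 hc
      refine wp_loop_exit (by simp [RExpr.eval, h0, h17]; omega) ⟨?_, ?_, ?_, by simp⟩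
      · intro c hc'
        exact hc c (by omega)
      · intros; rfl
      · intros; rfl
    | succ n ih =>
      intro i s hi h0 h11 h17 hc
      refine wp_loop_step (by simp [RExpr.eval, h0, h17]; omega) ?_
      refine wp_seq (wp_store (blk σ d k + (4 + i)) 0 (by simp [h11, h17]; omega)
        (by simp [h11, h17]) (by omega) (by simp) (by simp) ?_)
      refine wp_set (i + 1) (by simp [h17, hw0]; omega) (by simp [h17]) ?_
      refine Wp.mono (ih (i + 1) _ (by omega) (by simp [h0]) (by simp [h11]) (by simp) ?_) ?_
      · intro c hc'
        by_cases h : c = i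
        · simp [h]
        · simp [h]
          exact hc c (by omega)
      · rintro t s' ⟨g1, g2, g3, g4⟩
        refine ⟨g1, ?_, ?_, ?_⟩
        · intro a ha
          rw [g2 a ha]
          have := ha i (by omega)
          simp [this]
        · intro j hj
          rw [g3 j hj]
          simp [hj]
        · simp
          omega
  unfold clearCmd
  refine wp_seq (wp_set 0 (by simp) (by simp) ?_)
  refine Wp.mono (loop_spec σ 0 _ (by omega) (by simp [h0]) (by simp [h11]) (by simp)
    (by simp)) ?_
  rintro t s' ⟨g1, g2, g3, g4⟩
  refine ⟨g1, g2, ?_, ?_⟩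
  · intro j hj
    rw [g3 j hj]
    simp [hj]
  · simp
    omega

/-- The new value is described only if it does not wrap around. The counter of the `0`-node may be
incremented as well; it is uninitialized and never tested for zero, so no bound on it is available
or needed. -/
theorem wp_inc (hB : Room E d Kmax) {a b : ℕ} (h0 : s.reg 0 = σ) (ha : s.reg a = b)
    (ha' : a ≠ 18) (hb : b + (σ + 5) ≤ E.M) :
    Wp E (incCmd a) s fun t s' =>
      ∃ x, (s.mem (b + (4 + σ)) + 1 < 2 ^ E.w → x = s.mem (b + (4 + σ)) + 1) ∧
        s' = ⟨Function.update s.reg 18 (s.mem (b + (4 + σ))),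
          Function.update s.mem (b + (4 + σ)) x⟩ ∧ t = 15 := by
  have hw := hB.word
  have hw0 := hB.w_ne
  refine wp_seq (wp_load (b + (4 + σ)) (by simp [ha, h0]; omega) (by simp [ha, h0])
    (by omega) ?_)
  refine ⟨_, _, .store _ _ _ ?_, (s.mem (b + (4 + σ)) + 1) % 2 ^ E.w, Nat.mod_eq_of_lt, ?_, ?_⟩
  · rw [eval_eq_val (by simp [ha, ha', h0]; omega)]
    simp [ha, ha', h0]
    omega
  · rw [eval_eq_val (e := chd a 0) (by simp [ha, ha', h0]; omega)]
    simp [ha, ha', h0, RExpr.eval]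
  · simp

theorem wp_dec (hB : Room E d Kmax) {a b : ℕ} (h0 : s.reg 0 = σ) (ha : s.reg a = b)
    (ha' : a ≠ 18) (hb : b + (σ + 5) ≤ E.M) :
    Wp E (decCmd a) s fun t s' =>
      s' = ⟨Function.update s.reg 18 (s.mem (b + (4 + σ))),
          Function.update s.mem (b + (4 + σ)) (s.mem (b + (4 + σ)) - 1)⟩ ∧ t = 15 := by
  have hw := hB.word
  have hw0 := hB.w_ne
  refine wp_seq (wp_load (b + (4 + σ)) (by simp [ha, h0]; omega) (by simp [ha, h0])
    (by omega) ?_)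
  refine wp_store (b + (4 + σ)) (s.mem (b + (4 + σ)) - 1) (by simp [ha, ha', h0]; omega)
    (by simp [ha, ha', h0]) (by omega) (by simp [hw0]) (by simp) ⟨rfl, by simp⟩

/-- The registers and the memory describe an eertree. -/
structure Core (d : ℕ) (N : Set (List (Fin σ))) (ref : List (Fin σ) → ℕ)
    (ix : ENode (Fin σ) → ℕ) (F : List ℕ) (K : ℕ) (s : RState) : Prop where
  r0 : s.reg 0 = σ
  r1 : s.reg 1 = d
  r2 : s.reg 2 = blk σ d (ix .zero)
  r3 : s.reg 3 = blk σ d (ix .neg)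
  r7 : s.reg 7 = blk σ d K
  tree : Tree d N ref s.mem ix F K (s.reg 8)
  size : F.length + N.ncard + 2 = K

/-- If no block is free, `size` gives `K = N.ncard + 2 < Kmax`, so there is room for one more.
Clearing the fresh block is charged to the growth of `20 * (σ * K)`, which telescopes over the run.
-/
theorem wp_alloc (hB : Room E d Kmax) (hK : K ≤ Kmax) (hN : N.ncard + 3 ≤ Kmax)
    (hC : Core d N ref ix F K s) :
    Wp E allocCmd s fun t s' => ∃ kn F' K', s'.reg 11 = blk σ d kn ∧ s'.reg 7 = blk σ d K' ∧
      (∀ i, i ≠ 7 → i ≠ 8 → i ≠ 11 → i ≠ 17 → s'.reg i = s.reg i) ∧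
      Tree d N ref s'.mem ix F' K' (s'.reg 8) ∧ F'.length + N.ncard + 3 = K' ∧ K' ≤ Kmax ∧
      K ≤ K' ∧ kn < K' ∧ kn ∉ F' ∧ (∀ v, NodeIn N v → ix v ≠ kn) ∧
      (∀ c : Fin σ, s'.mem (blk σ d kn + (4 + c.val)) = 0) ∧ (∀ a < d, s'.mem a = s.mem a) ∧
      t + 20 * (σ * K) ≤ 20 * (σ * K') + 40 := by
  have hw := hB.word
  have hw0 := hB.w_ne
  have hd := hB.pos
  have hT := hC.tree
  have hch := hT.chain
  have hsize := hC.size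
  cases F with
  | nil =>
    have h8 : s.reg 8 = 0 := hch
    simp only [List.length_nil] at hsize
    have hK' : K < Kmax := by omega
    have hM := hB.blk_le hK'
    refine wp_branch_eq 0 0 (by simp) (by simp [h8]) (by simp) (by simp) ?_ (by simp)
    intro _
    refine wp_seq (wp_set (blk σ d K) (by simp) (by simp [hC.r7]) ?_)
    refine wp_seq (wp_set (blk σ d (K + 1)) (by simp [hC.r7, hC.r0]; omega)
      (by simp [hC.r7, hC.r0, blk_succ]) ?_)
    refine Wp.mono (wp_clear hB hK' (by simp [hC.r0]) (by simp)) ?_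
    rintro t s' ⟨g1, g2, g3, g4⟩
    have hmem : ∀ k, k ≠ K → ∀ o < σ + 5, s'.mem (blk σ d k + o) = s.mem (blk σ d k + o) := by
      intro k hk o ho
      refine g2 _ fun c hc => ?_
      rw [Ne, blk_add_inj ho (by omega)]
      exact fun h => hk h.1
    refine ⟨K, [], K + 1, ?_, ?_, ?_, ?_, by simp; omega, hK', by omega, by omega, by simp, ?_,
      fun c => g1 c c.2, ?_, ?_⟩
    · rw [g3 11 (by simp)]
      simp
    · rw [g3 7 (by simp)]
      simp
    · intro i i1 i2 i3 i4
      rw [g3 i i4]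
      simp [i1, i3]
    · have h8' : s'.reg 8 = s.reg 8 := by
        rw [g3 8 (by simp)]
        simp
      rw [h8']
      exact (hT.congr (fun v hv => hmem _ (hT.ix_lt v hv).ne) (by simp)).mono (by omega)
    · intro v hv
      exact (hT.ix_lt v hv).ne
    · intro a ha
      refine g2 a fun c hc => ?_
      have := le_blk σ d K
      omega
    · simp [Nat.mul_succ]
      omega
  | cons k F =>
    have h8 : s.reg 8 = blk σ d k := hch.1
    have hblk := le_blk σ d k
    have hk := hT.free_lt k (by simp)
    have hM := hB.blk_le (hk.trans_le hK)
    simp only [List.length_cons] at hsize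
    refine wp_branch_eq (blk σ d k) 0 (by simp) (by simp [h8]) (by simp) (by simp) (by omega) ?_
    intro _
    refine wp_seq (wp_set (blk σ d k) (by simp) (by simp [h8]) ?_)
    refine wp_load (blk σ d k + 1) (by simp [h8, hw0]; omega) (by simp [h8]) (by omega) ?_
    refine ⟨k, F, K, by simp, by simp [hC.r7], ?_, ?_, by omega, hK, le_rfl, hk, ?_, ?_, ?_, ?_, ?_⟩
    · intro i i1 i2 i3 i4
      simp [i2, i3]
    · simpa using hT.pop
    · exact (List.nodup_cons.1 hT.free_nodup).1
    · exact hT.free_ne k (by simp)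
    · exact hT.free_null k (by simp)
    · intros; rfl
    · simp
      omega

variable {l r : ℕ} {c : Fin σ} {u : ENode (Fin σ)}

theorem nodeIn_of_onSuffix {W : List (Fin σ)} {v : ENode (Fin σ)} (hv : OnSuffix W v) :
    NodeIn (pals W) v := by
  cases v with
  | ord p => exact ⟨hv.1.1, hv.1.2, hv.2.isInfix⟩
  | _ => trivial

theorem wp_link (hB : Room E d Kmax) (hK : K ≤ Kmax) (hlr : l ≤ r)
    (hr : r < E.text.length) (hlo : E.lo = l) (hhi : E.hi = r) (hc : E.text[r] = c)
    (hN : N = pals (factor E.text l r)) (hC : Core d N ref ix F K s)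
    (hu : OnSuffix (factor E.text l r) u)
    (hN' : FactorClosed (insert (wrap c u) N)) (h5 : s.reg 5 = l) (h6 : s.reg 6 = r)
    (h9 : s.reg 9 = c.val) (h10 : s.reg 10 = blk σ d (ix u)) (h12 : s.reg 12 = lp u) :
    Wp E linkCmd s fun t s' =>
      s'.reg 16 = blk σ d (ix (slink (.ord (wrap c u)))) ∧ s'.mem = s.mem ∧
      (∀ i, i ≠ 10 → i ≠ 12 → i ≠ 13 → i ≠ 14 → i ≠ 16 → s'.reg i = s.reg i) ∧
      t + 40 * lp (slink (.ord (wrap c u))) ≤ 40 * lp (slink u) + 200 := by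
  have hw := hB.word
  have hw0 := hB.w_ne
  have hT := hC.tree
  have huN : NodeIn N u := hN ▸ nodeIn_of_onSuffix hu
  have hM := hB.blk_le ((hT.ix_lt u huN).trans_le hK)
  refine wp_branch_eq (lp u) 0 (by simp) (by simp [h12]) (by simp) (by simp) ?_ ?_
  · intro h0
    obtain rfl : u = .neg := by
      rcases hu.1.eq_neg_or with rfl | ⟨p, hp, rfl⟩
      · rfl
      · simp at h0
    refine wp_set (blk σ d (ix .zero)) (by simp) (by simp [hC.r2]) ⟨?_, rfl, ?_, ?_⟩
    · simp [slink, node]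
    · intro i _ _ _ _ i5
      simp [i5]
    · simp [slink, node]
  · intro h0
    have hn : u ≠ .neg := by
      rintro rfl
      simp at h0
    refine wp_seq (wp_load (blk σ d (ix u) + 1) (by simp [h10, hw0]; omega) (by simp [h10])
      (by omega) ?_)
    refine wp_seq (Wp.mono (wp_find (v := slink u) hB hK hlr hr hlo hhi hc
      (fun v hv => hN ▸ nodeIn_of_onSuffix hv) hT hu.slink
      (by simp [h5]) (by simp [h6]) (by simp [h9]) (by simp [hT.slink u huN])) ?_)
    rintro t s' ⟨v, g1, g2, g3, g4, g5, g6, g7, g8, g9⟩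
    have hsl := slink_wrap hu hn g1.1 g2 g3 g4
    have hvN : NodeIn N v := hN ▸ nodeIn_of_onSuffix g1
    have hM' := hB.blk_le ((hT.ix_lt v hvN).trans_le hK)
    -- The link target belongs to the enlarged node set. It is not the new node, since `lp v ≤ lp
    -- (slink u) < lp u`; so it is already stored as a child of `v`.
    have hmem : wrap c v ∈ N := by
      have h1 := hN'.nodeIn_slink (v := .ord (wrap c u)) (Set.mem_insert _ _)
      rw [hsl] at h1
      rcases Set.mem_insert_iff.1 h1 with h1 | h1
      · have h2 := congrArg List.length h1
        have h3 := lp_slink_lt hu.1 hn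
        simp only [length_wrap] at h2
        omega
      · exact h1
    have h9' : s'.reg 9 = c.val := by
      rw [g8 9 (by simp) (by simp) (by simp) (by simp)]
      simp [h9]
    have hch := hT.child v c hvN hmem
    have hcσ := c.2
    refine wp_load (blk σ d (ix v) + (4 + c.val)) (by simp [g6, h9']; omega) (by simp [g6, h9'])
      (by omega) ⟨?_, g5, ?_, ?_⟩
    · rw [hsl]
      simp [g5, hch]
    · intro i i1 i2 i3 i4 i5
      simp only [Function.update_apply, if_neg i5]
      rw [g8 i i1 i2 i3 i4]
      simp [i1]
    · rw [hsl]
      simp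
      omega

theorem wp_fill (hB : Room E d Kmax) (hK : K ≤ Kmax) (h0 : s.reg 0 = σ)
    (hT : Tree d N ref s.mem ix F K (s.reg 8)) (hN : FactorClosed N) (hfin : N.Finite)
    (hu : NodeIn N u) (hp : wrap c u ∉ N) (hN' : FactorClosed (insert (wrap c u) N))
    (href : ref (wrap c u) = 0) (hrefd : ∀ p, ref p ≤ d) (hsize : N.ncard ≤ Kmax) {kn : ℕ}
    (hkK : kn < K) (hkF : kn ∉ F)
    (hkix : ∀ v, NodeIn N v → ix v ≠ kn) {ix' : ENode (Fin σ) → ℕ}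
    (hixp : ix' (.ord (wrap c u)) = kn) (hix : ∀ v, NodeIn N v → ix' v = ix v)
    (hnull : ∀ c' : Fin σ, s.mem (blk σ d kn + (4 + c'.val)) = 0)
    (h9 : s.reg 9 = c.val) (h11 : s.reg 11 = blk σ d kn) (h15 : s.reg 15 = blk σ d (ix u))
    (h16 : s.reg 16 = blk σ d (ix (slink (.ord (wrap c u))))) (h19 : s.reg 19 = lp u + 2) :
    Wp E fillCmd s fun t s' => Tree d (insert (wrap c u) N) ref s'.mem ix' F K (s.reg 8) ∧
      (∀ i, i ≠ 18 → s'.reg i = s.reg i) ∧ (∀ a < d, s'.mem a = s.mem a) ∧ t ≤ 100 := by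
  have hw := hB.word
  have hw0 := hB.w_ne
  have hcσ := c.2
  have hpv : Valid (.ord (wrap c u)) := ⟨wrap_ne_nil c u, (hN.valid hu).wrap c⟩
  have hsl : NodeIn N (slink (.ord (wrap c u))) := by
    rcases nodeIn_insert_iff.1 (hN'.nodeIn_slink (v := .ord (wrap c u)) (Set.mem_insert _ _))
      with h1 | h1
    · have := lp_slink_lt hpv (by simp)
      rw [h1] at this
      omega
    · exact h1
  have hMk := hB.blk_le (hkK.trans_le hK)
  have hMu := hB.blk_le ((hT.ix_lt u hu).trans_le hK)
  have hMs := hB.blk_le ((hT.ix_lt _ hsl).trans_le hK)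
  have hku := hkix u hu
  have hks := hkix _ hsl
  have hbk := le_blk σ d kn
  have hbu := le_blk σ d (ix u)
  have hbs := le_blk σ d (ix (slink (.ord (wrap c u))))
  refine wp_seq (wp_store (blk σ d kn) (lp u + 2) (by simp) (by simp [h11]) (by omega)
    (by simp) (by simp [h19]) ?_)
  refine wp_seq (wp_store (blk σ d kn + 1) (blk σ d (ix (slink (.ord (wrap c u)))))
    (by simp [h11, hw0]; omega) (by simp [h11]) (by omega) (by simp) (by simp [h16]) ?_)
  refine wp_seq (wp_store (blk σ d kn + 2) (blk σ d (ix u))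
    (by simp [h11]; omega) (by simp [h11]) (by omega) (by simp) (by simp [h15]) ?_)
  refine wp_seq (wp_store (blk σ d kn + 3) c.val
    (by simp [h11]; omega) (by simp [h11]) (by omega) (by simp) (by simp [h9]) ?_)
  refine wp_seq (wp_store (blk σ d kn + (4 + σ)) 0
    (by simp [h11, h0]; omega) (by simp [h11, h0]) (by omega) (by simp) (by simp) ?_)
  refine wp_seq (wp_store (blk σ d (ix u) + (4 + c.val)) (blk σ d kn)
    (by simp [h15, h9]; omega) (by simp [h15, h9]) (by omega) (by simp) (by simp [h11]) ?_)
  refine Wp.mono (wp_inc hB (b := blk σ d (ix (slink (.ord (wrap c u))))) (by simp [h0])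
    (by simp [h16]) (by simp) hMs) ?_
  rintro t s' ⟨x, hx, rfl, rfl⟩
  dsimp only at hx ⊢
  have hsk := hks.symm
  have huk := hku.symm
  refine ⟨hT.add_node hN hfin hu hp hN' href hkK hkF hkix hixp hix ?_ ?_ ?_ ?_ ?_ ?_ ?_ ?_ ?_ ?_,
    ?_, ?_, ?_⟩
  · simp (disch := omega) [blk_eq_add, hsk, huk]
  · simp (disch := omega) [blk_add_inj, hsk, huk]
  · simp (disch := omega) [blk_add_inj, hsk, huk]
  · simp (disch := omega) [blk_add_inj, hsk, huk]
  · intro c'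
    have := c'.2
    have h5 : ¬ c'.val = σ := by omega
    simp (disch := omega) [blk_add_inj, hsk, huk, h5, hnull c']
  · simp (disch := omega) [blk_add_inj, blk_inj, hsk, huk]
  · have h1 : ¬ c.val = σ := by omega
    simp (disch := omega) [blk_add_inj, h1]
  -- The counter of an ordinary node is at most `d + N.ncard`, which is below the word limit, so
  -- this increment is exact.
  · intro q hq
    have hqN : q ∈ N := by
      rw [hq] at hsl
      exact hsl
    have h1 : ¬ σ = c.val := by omega
    have hcount := hT.count q hqN
    have hl := links_le hfin q
    have hr := hrefd q
    have hM := hB.le_M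
    rw [hq] at hx hks
    simp (disch := omega) only [Function.update_apply, blk_add_inj, blk_add_eq, hks, false_and, if_false,
      Nat.add_left_cancel_iff, h1, and_false] at hx
    rw [hq, Function.update_self, hx (by omega)]
  · intro v hv o ho hv1 hv2
    have h1 := hkix v hv
    have h2 : ix v = ix u ↔ v = u := ⟨hT.ix_inj v u hv hu, fun h => by rw [h]⟩
    have h3 : ix v = ix (slink (.ord (wrap c u))) ↔ v = slink (.ord (wrap c u)) :=
      ⟨hT.ix_inj v _ hv hsl, fun h => by rw [h]⟩
    simp (disch := omega) only [Function.update_apply, blk_add_inj, blk_add_eq, h1, h2, h3, false_and, if_false,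
      hv1, hv2]
  · intro k hk o ho
    have h1 : k ≠ kn := by
      rintro rfl
      exact hkF hk
    have h2 : k ≠ ix u := (hT.free_ne k hk u hu).symm
    have h3 : k ≠ ix (slink (.ord (wrap c u))) := (hT.free_ne k hk _ hsl).symm
    simp (disch := omega) only [Function.update_apply, blk_add_inj, blk_add_eq, h1, h2, h3, false_and, if_false]
  · intro i hi
    simp [hi]
  · intro a ha
    simp only [Function.update_apply]
    rw [if_neg (by omega), if_neg (by omega), if_neg (by omega), if_neg (by omega),
      if_neg (by omega), if_neg (by omega), if_neg (by omega)]
  · simp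

theorem wp_create (hB : Room E d Kmax) (hK : K ≤ Kmax) (hlr : l ≤ r)
    (hr : r < E.text.length) (hlo : E.lo = l) (hhi : E.hi = r) (hc : E.text[r] = c)
    (hN : N = pals (factor E.text l r)) (hsize : N.ncard + 3 ≤ Kmax) (hC : Core d N ref ix F K s)
    (hu : OnSuffix (factor E.text l r) u) (hp : wrap c u ∉ N)
    (hN' : FactorClosed (insert (wrap c u) N)) (href : ref (wrap c u) = 0)
    (hrefd : ∀ p, ref p ≤ d) (h5 : s.reg 5 = l) (h6 : s.reg 6 = r)
    (h9 : s.reg 9 = c.val) (h10 : s.reg 10 = blk σ d (ix u)) (h12 : s.reg 12 = lp u) :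
    Wp E createCmd s fun t s' => ∃ ix' F' K', Core d (insert (wrap c u) N) ref ix' F' K' s' ∧
      s'.reg 11 = blk σ d (ix' (.ord (wrap c u))) ∧ K ≤ K' ∧ K' ≤ Kmax ∧
      (∀ v, NodeIn N v → ix' v = ix v) ∧ (∀ a < d, s'.mem a = s.mem a) ∧
      s'.reg 5 = l ∧ s'.reg 6 = r ∧
      t + 40 * lp (slink (.ord (wrap c u))) + 20 * (σ * K) ≤
        40 * lp (slink u) + 20 * (σ * K') + 400 := by
  classical
  have hw := hB.word
  have hw0 := hB.w_ne
  have hT := hC.tree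
  have hNc : FactorClosed N := hN ▸ factorClosed_pals _
  have hfin : N.Finite := hN ▸ finite_pals _
  have huN : NodeIn N u := hN ▸ nodeIn_of_onSuffix hu
  have hlu : lp u ≤ r + 1 := by
    rcases hu.1.eq_neg_or with rfl | ⟨p, hp, rfl⟩
    · simp
    · have := hu.2.length_le
      rw [length_factor hr.le, node_pal] at this
      rw [lp_node]
      omega
  refine wp_seq (wp_set (blk σ d (ix u)) (by simp) (by simp [h10]) ?_)
  refine wp_seq (wp_set (lp u + 2) (by simp [h12]; omega) (by simp [h12]) ?_)
  refine wp_seq (Wp.mono (wp_link hB hK hlr hr hlo hhi hc hN (ref := ref) (ix := ix) (F := F)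
    (K := K) ⟨by simp [hC.r0], by simp [hC.r1], by simp [hC.r2], by simp [hC.r3], by simp [hC.r7],
      by simpa using hT, hC.size⟩ hu hN' (by simp [h5]) (by simp [h6]) (by simp [h9])
      (by simp [h10]) (by simp [h12])) ?_)
  rintro t₁ s₁ ⟨a1, a2, a3, a4⟩
  have e₁ : ∀ i, i ≠ 10 → i ≠ 12 → i ≠ 13 → i ≠ 14 → i ≠ 15 → i ≠ 16 → i ≠ 19 →
      s₁.reg i = s.reg i := by
    intro i i1 i2 i3 i4 i5 i6 i7
    rw [a3 i i1 i2 i3 i4 i6]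
    simp [i5, i7]
  have hC₁ : Core d N ref ix F K s₁ := by
    refine ⟨?_, ?_, ?_, ?_, ?_, ?_, hC.size⟩
    · rw [e₁ 0 (by simp) (by simp) (by simp) (by simp) (by simp) (by simp) (by simp), hC.r0]
    · rw [e₁ 1 (by simp) (by simp) (by simp) (by simp) (by simp) (by simp) (by simp), hC.r1]
    · rw [e₁ 2 (by simp) (by simp) (by simp) (by simp) (by simp) (by simp) (by simp), hC.r2]
    · rw [e₁ 3 (by simp) (by simp) (by simp) (by simp) (by simp) (by simp) (by simp), hC.r3]
    · rw [e₁ 7 (by simp) (by simp) (by simp) (by simp) (by simp) (by simp) (by simp), hC.r7]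
    · rw [e₁ 8 (by simp) (by simp) (by simp) (by simp) (by simp) (by simp) (by simp), a2]
      exact hT
  refine wp_seq (Wp.mono (wp_alloc hB hK hsize hC₁) ?_)
  rintro t₂ s₂ ⟨kn, F', K', b1, b2, b3, b4, b5, b6, b7, b8, b9, b10, b11, b12, b13⟩
  have h15 : s₂.reg 15 = blk σ d (ix u) := by
    rw [b3 15 (by simp) (by simp) (by simp) (by simp),
      a3 15 (by simp) (by simp) (by simp) (by simp) (by simp)]
    simp
  have h19 : s₂.reg 19 = lp u + 2 := by
    rw [b3 19 (by simp) (by simp) (by simp) (by simp),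
      a3 19 (by simp) (by simp) (by simp) (by simp) (by simp)]
    simp
  have e₂ : ∀ i, i < 10 → i ≠ 7 → i ≠ 8 → s₂.reg i = s.reg i := by
    intro i i1 i2 i3
    rw [b3 i i2 i3 (by omega) (by omega), e₁ i (by omega) (by omega) (by omega) (by omega)
      (by omega) (by omega) (by omega)]
  refine Wp.mono (wp_fill (ix' := fun v => if v = .ord (wrap c u) then kn else ix v) (u := u)
    (c := c) hB b6 ?_ b4 hNc hfin huN hp hN' href hrefd (by omega) b8 b9 b10 (by simp) ?_ b11 ?_ b1
    h15 ?_ h19) ?_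
  · rw [e₂ 0 (by simp) (by simp) (by simp), hC.r0]
  · intro v hv
    refine if_neg ?_
    rintro rfl
    exact hp hv
  · rw [e₂ 9 (by simp) (by simp) (by simp), h9]
  · rw [b3 16 (by simp) (by simp) (by simp) (by simp), a1]
  rintro t₃ s₃ ⟨g1, g2, g3, g4⟩
  refine ⟨fun v => if v = .ord (wrap c u) then kn else ix v, F', K', ⟨?_, ?_, ?_, ?_, ?_, ?_, ?_⟩,
    ?_, b7, b6, ?_, ?_, ?_, ?_, ?_⟩
  · rw [g2 0 (by simp), e₂ 0 (by simp) (by simp) (by simp), hC.r0]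
  · rw [g2 1 (by simp), e₂ 1 (by simp) (by simp) (by simp), hC.r1]
  · rw [g2 2 (by simp), e₂ 2 (by simp) (by simp) (by simp), hC.r2, if_neg (by simp)]
  · rw [g2 3 (by simp), e₂ 3 (by simp) (by simp) (by simp), hC.r3, if_neg (by simp)]
  · rw [g2 7 (by simp), b2]
  · rw [g2 8 (by simp)]
    exact g1
  · rw [Set.ncard_insert_of_notMem hp hfin]
    omega
  · simp [g2 11 (by simp), b1]
  · intro v hv
    refine if_neg ?_
    rintro rfl
    exact hp hv
  · intro a ha
    rw [g3 a ha, b12 a ha, a2]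
  · rw [g2 5 (by simp), e₂ 5 (by simp) (by simp) (by simp), h5]
  · rw [g2 6 (by simp), e₂ 6 (by simp) (by simp) (by simp), h6]
  · simp
    omega

end Create

/-! ### Appending a character -/

section Append

open RExpr Cmd

attribute [local simp] val Fits fld chd Function.update_apply RExpr.cost RTest.Holds RTest.cost

variable {σ : ℕ} {E : REnv σ} {d Kmax : ℕ}

/-- The registers and the memory describe the eertree of the window `S[l..r-1]` and a surface. -/
structure Inv (d Kmax : ℕ) (S : List (Fin σ)) (l r : ℕ) (en : ℕ → ℕ) (ix : ENode (Fin σ) → ℕ)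
    (F : List ℕ) (K : ℕ) (s : RState) : Prop where
  core : Core d (pals (factor S l r)) (refs S l r en) ix F K s
  le : l ≤ r
  le_length : r ≤ S.length
  le_d : r - l ≤ d
  r4 : s.reg 4 = blk σ d (ix (node (lspal (factor S l r))))
  r5 : s.reg 5 = l
  r6 : s.reg 6 = r
  arr : ∀ b, l ≤ b → b < r →
    s.mem (b % d) = if en b = b then 0 else blk σ d (ix (.ord (factor S b (en b))))
  surf : Surface S l r en
  K_le : K ≤ Kmax

/-- The potential. -/
def pot {α : Type} [DecidableEq α] (W : List α) : ℕ :=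
  lp (node (lspal W)) + lp (slink (node (lspal W)))

/-- Positions of one window differ by less than `d`, so they occupy different slots of the circular
array. -/
theorem mod_ne_mod {a b d : ℕ} (h : a < b) (hd : b < a + d) : a % d ≠ b % d := by
  intro he
  have h1 := (Nat.modEq_iff_dvd' h.le).1 he
  have := Nat.le_of_dvd (by omega) h1
  omega

theorem Surface.mem_pals {α : Type} {S : List α} {l r b : ℕ} {en : ℕ → ℕ}
    (h : Surface S l r en) (hr : r ≤ S.length) (hl : l ≤ b) (hb : b < r) (hne : en b ≠ b) :
    factor S b (en b) ∈ pals (factor S l r) := by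
  rcases h.entry b hl hb with h1 | ⟨h1, h2, h3⟩
  · exact absurd h1 hne
  · exact (mem_pals_factor hr).2 ⟨h3, b, en b, hl, h1, h2, rfl⟩

variable {S : List (Fin σ)} {l r : ℕ} {en : ℕ → ℕ} {ix : ENode (Fin σ) → ℕ} {F : List ℕ} {K : ℕ}
  {s : RState}

/-- The first walk is paid for by the drop from the old longest palindromic suffix to `u`, and the
new one has `lp` equal to `lp u + 2`. The second term of the potential is handled by `lp_slink_mono`
together with the cost of `wp_create`, or with `lp_slink_wrap_le` if the node exists. -/
theorem wp_grow (hB : Room E d Kmax) (hS : E.text = S) (hlo : E.lo = l) (hhi : E.hi = r)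
    (h : Inv d Kmax S l r en ix F K s) (hr : r < S.length)
    (hsize : (pals (factor S l (r + 1))).ncard + 2 ≤ Kmax) :
    Wp E growCmd s fun t s' => ∃ ix' F' K',
      Core d (pals (factor S l (r + 1))) (refs S l r en) ix' F' K' s' ∧
      s'.reg 11 = blk σ d (ix' (node (lspal (factor S l (r + 1))))) ∧ K ≤ K' ∧ K' ≤ Kmax ∧
      (∀ v, NodeIn (pals (factor S l r)) v → ix' v = ix v) ∧ (∀ a < d, s'.mem a = s.mem a) ∧
      s'.reg 5 = l ∧ s'.reg 6 = r ∧
      t + 40 * pot (factor S l (r + 1)) + 20 * (σ * K) ≤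
        40 * pot (factor S l r) + 20 * (σ * K') + 1000 := by
  subst hS
  have hw := hB.word
  have hw0 := hB.w_ne
  have hC := h.core
  have hT := hC.tree
  have hlr := h.le
  set c := E.text[r] with hc
  set N := pals (factor E.text l r) with hN
  have hcσ := c.2
  have hcur := onSuffix_lspal (factor E.text l r)
  have hconc := factor_concat hlr hr
  refine wp_seq (wp_readChar r (by simp) (by simp [h.r6]) (by omega) (by omega) hr ?_)
  refine wp_seq (wp_set (blk σ d (ix (node (lspal (factor E.text l r))))) (by simp)
    (by simp [h.r4]) ?_)
  refine wp_seq (Wp.mono (wp_find (c := c) (v := node (lspal (factor E.text l r))) hB h.K_le hlr hr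
    hlo hhi rfl (fun v hv => nodeIn_of_onSuffix hv) hT hcur (by simp [h.r5]) (by simp [h.r6])
    (by simp [hc]) (by simp)) ?_)
  rintro t₁ s₁ ⟨u, a1, a2, a3, a4, a5, a6, a7, a8, a9⟩
  have e₁ : ∀ i, i ≠ 9 → i ≠ 10 → i ≠ 12 → i ≠ 13 → i ≠ 14 → s₁.reg i = s.reg i := by
    intro i i0 i1 i2 i3 i4
    rw [a8 i i1 i2 i3 i4]
    simp [i0, i1]
  have h9 : s₁.reg 9 = c.val := by
    rw [a8 9 (by simp) (by simp) (by simp) (by simp)]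
    simp [hc]
  have hlsp : lspal (factor E.text l (r + 1)) = wrap c u := by
    rw [hconc]
    exact lspal_concat a1.1 a2 fun v' hv' he => a4 v' hv' he (he.onSuffix hv').lp_le
  have hpals : pals (factor E.text l (r + 1)) = insert (wrap c u) N := by
    rw [hconc, pals_concat, ← hconc, hlsp]
  have hnode : node (wrap c u) = .ord (wrap c u) := node_of_ne_nil (wrap_ne_nil c u)
  have huN : NodeIn N u := nodeIn_of_onSuffix a1
  have hM := hB.blk_le ((hT.ix_lt u huN).trans_le h.K_le)
  have hblk := le_blk σ d
  have hd := hB.pos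
  have hN' : FactorClosed (insert (wrap c u) N) := hpals ▸ factorClosed_pals _
  have hsu : lp (slink u) ≤ lp (slink (node (lspal (factor E.text l r)))) :=
    lp_slink_mono hcur a1 a3
  have hC₁ : Core d N (refs E.text l r en) ix F K s₁ := by
    refine ⟨?_, ?_, ?_, ?_, ?_, ?_, hC.size⟩
    · rw [e₁ 0 (by simp) (by simp) (by simp) (by simp) (by simp), hC.r0]
    · rw [e₁ 1 (by simp) (by simp) (by simp) (by simp) (by simp), hC.r1]
    · rw [e₁ 2 (by simp) (by simp) (by simp) (by simp) (by simp), hC.r2]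
    · rw [e₁ 3 (by simp) (by simp) (by simp) (by simp) (by simp), hC.r3]
    · rw [e₁ 7 (by simp) (by simp) (by simp) (by simp) (by simp), hC.r7]
    · rw [e₁ 8 (by simp) (by simp) (by simp) (by simp) (by simp), a5]
      exact hT
  have h5₁ : s₁.reg 5 = l := by
    rw [e₁ 5 (by simp) (by simp) (by simp) (by simp) (by simp), h.r5]
  have h6₁ : s₁.reg 6 = r := by
    rw [e₁ 6 (by simp) (by simp) (by simp) (by simp) (by simp), h.r6]
  refine wp_seq (wp_load (blk σ d (ix u) + (4 + c.val)) (by simp [a6, h9]; omega) (by simp [a6, h9])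
    (by omega) ?_)
  have hpot : pot (factor E.text l (r + 1)) = lp u + 2 + lp (slink (.ord (wrap c u))) := by
    rw [pot, hlsp, hnode]
    simp
  rw [hpot, hlsp, hnode]
  unfold pot
  by_cases hp : wrap c u ∈ N
  · have hch := hT.child u c huN hp
    have hb := hblk (ix (.ord (wrap c u)))
    have hins : pals (factor E.text l (r + 1)) = N := by rw [hpals, Set.insert_eq_of_mem hp]
    rw [hins]
    refine wp_branch_eq (blk σ d (ix (.ord (wrap c u)))) 0 (by simp) (by simp [a5, hch]) (by simp)
      (by simp) (by omega) ?_
    intro _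
    refine wp_skip ⟨ix, F, K, ?_, ?_, le_rfl, h.K_le, fun _ _ => rfl, ?_, ?_, ?_, ?_⟩
    · refine ⟨?_, ?_, ?_, ?_, ?_, ?_, hC.size⟩
      · simp [hC₁.r0]
      · simp [hC₁.r1]
      · simp [hC₁.r2]
      · simp [hC₁.r3]
      · simp [hC₁.r7]
      · simpa using hC₁.tree
    · simp [a5, hch]
    · intro a _
      simp [a5]
    · simp [h5₁]
    · simp [h6₁]
    · have := lp_slink_wrap_le (c := c) a1
      simp [-lp_node]
      omega
  · have hch := hT.no_child u c huN hp
    have hcard : (pals (factor E.text l (r + 1))).ncard = N.ncard + 1 := by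
      rw [hpals, Set.ncard_insert_of_notMem hp (finite_pals _)]
    refine wp_branch_eq 0 0 (by simp) (by simp [a5, hch]) (by simp) (by simp) ?_ (by simp)
    intro _
    have hcreate := wp_create (ref := refs E.text l r en) (ix := ix) (F := F) (K := K) (u := u)
      (c := c) (s := ⟨Function.update s₁.reg 11 (s₁.mem (blk σ d (ix u) + (4 + c.val))), s₁.mem⟩)
      hB h.K_le hlr hr hlo hhi rfl hN (by omega)
      ⟨by simp [hC₁.r0], by simp [hC₁.r1], by simp [hC₁.r2], by simp [hC₁.r3], by simp [hC₁.r7],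
        by simpa using hC₁.tree, hC.size⟩ a1 hp hN' ?_ ?_ (by simp [h5₁]) (by simp [h6₁])
      (by simp [h9]) (by simp [a6]) (by simp [a7])
    · refine hcreate.mono ?_
      rintro t s' ⟨ix', F', K', g1, g2, g3, g4, g5, g6, g7, g8, g9⟩
      rw [hpals]
      refine ⟨ix', F', K', g1, g2, g3, g4, g5, ?_, g7, g8, ?_⟩
      · intro a ha
        rw [g6 a ha]
        simp [a5]
      · simp [-lp_node]
        omega
    -- A surface entry equal to the new palindrome would be an occurrence in the old window.
    · by_contra h0
      obtain ⟨b, b1, b2, b3, b4⟩ := refs_pos_iff.1 (Nat.pos_of_ne_zero h0)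
      apply hp
      rw [hN, ← b4]
      exact h.surf.mem_pals hr.le b1 b2 (by omega)
    · intro p
      exact (refs_le _ _ _ _ p).trans h.le_d

/-- `hold` balances the reference gained by `q` against the one lost by the old entry `o`, if any.
The condition `o ≠ q` makes the two counters distinct words, so the decrement and the increment do
not interfere. -/
theorem wp_slot (hB : Room E d Kmax) (hK : K ≤ Kmax) {N : Set (List (Fin σ))} (hfin : N.Finite)
    {ref ref' : List (Fin σ) → ℕ} (hC : Core d N ref ix F K s) {a j : ℕ} (ha : a ≠ 14)
    (ha' : a ≠ 18) (hj : j < d) (h17 : s.reg 17 = j) {q : List (Fin σ)} (hq : q ∈ N)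
    (haq : s.reg a = blk σ d (ix (.ord q))) (hrefd : ∀ p, ref' p ≤ d)
    (hold : (s.mem j = 0 ∧ ∀ p, ref' p = ref p + if q = p then 1 else 0) ∨
      ∃ o ∈ N, o ≠ q ∧ s.mem j = blk σ d (ix (.ord o)) ∧
        ∀ p, (ref' p + if o = p then 1 else 0) = ref p + if q = p then 1 else 0) :
    Wp E (slotCmd a) s fun t s' => Core d N ref' ix F K s' ∧
      s'.mem j = blk σ d (ix (.ord q)) ∧ (∀ b < d, b ≠ j → s'.mem b = s.mem b) ∧
      (∀ i, i ≠ 14 → i ≠ 18 → s'.reg i = s.reg i) ∧ t ≤ 60 := by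
  have hw := hB.word
  have hw0 := hB.w_ne
  have hT := hC.tree
  have hd := hB.pos
  have hM := hB.le_M
  have hMq := hB.blk_le ((hT.ix_lt (.ord q) hq).trans_le hK)
  have hbq := le_blk σ d (ix (.ord q))
  have hl := links_le hfin q
  have hsize := hC.size
  -- the part after the old reference has been deleted
  have tail : ∀ (t₀ : ℕ) (s₁ : RState) (ref₁ : List (Fin σ) → ℕ),
      Tree d N ref₁ s₁.mem ix F K (s₁.reg 8) → (∀ p, ref' p = ref₁ p + if q = p then 1 else 0) →
      (∀ b < d, s₁.mem b = s.mem b) → (∀ i, i ≠ 14 → i ≠ 18 → s₁.reg i = s.reg i) → t₀ ≤ 30 →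
      Wp E (seq (store (reg 17) (reg a)) (incCmd a)) s₁ fun t s' => Core d N ref' ix F K s' ∧
        s'.mem j = blk σ d (ix (.ord q)) ∧ (∀ b < d, b ≠ j → s'.mem b = s.mem b) ∧
        (∀ i, i ≠ 14 → i ≠ 18 → s'.reg i = s.reg i) ∧ t₀ + t ≤ 60 := by
    intro t₀ s₁ ref₁ hT₁ href hmem hreg ht₀
    have h0 : s₁.reg 0 = σ := by rw [hreg 0 (by simp) (by simp), hC.r0]
    have h17₁ : s₁.reg 17 = j := by rw [hreg 17 (by simp) (by simp), h17]
    have ha₁ : s₁.reg a = blk σ d (ix (.ord q)) := by rw [hreg a ha ha', haq]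
    refine wp_seq (wp_store j (blk σ d (ix (.ord q))) (by simp) (by simp [h17₁]) (by omega)
      (by simp) (by simp [ha₁]) ?_)
    refine Wp.mono (wp_inc hB (b := blk σ d (ix (.ord q))) (by simp [h0]) (by simp [ha₁]) ha' hMq) ?_
    rintro t s' ⟨x, hx, rfl, rfl⟩
    have hT₂ := hT₁.update_surface hj (blk σ d (ix (.ord q)))
    have hcount := hT₂.count q hq
    dsimp only at hx ⊢
    have hq' := href q
    rw [if_pos rfl] at hq'
    have hd' := hrefd q
    rw [hcount] at hx
    have hT₃ := hT₂.update_count (ref' := ref') hq (x := x) (by rw [hx (by omega)]; omega) (by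
      intro p _ hp
      rw [href, if_neg (Ne.symm hp), add_zero])
    refine ⟨⟨?_, ?_, ?_, ?_, ?_, ?_, hsize⟩, ?_, ?_, ?_, ?_⟩
    · simp [h0]
    · simp [hreg, hC.r1]
    · simp [hreg, hC.r2]
    · simp [hreg, hC.r3]
    · simp [hreg, hC.r7]
    · simpa using hT₃
    · have : j ≠ blk σ d (ix (.ord q)) + (4 + σ) := by omega
      simp [this]
    · intro b hb hbj
      have : b ≠ blk σ d (ix (.ord q)) + (4 + σ) := by omega
      simp [this, hbj, hmem b hb]
    · intro i i1 i2
      simp [i2, hreg i i1 i2]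
    · simp
      omega
  refine wp_seq (wp_load j (by simp) (by simp [h17]) (by omega) ?_)
  rcases hold with ⟨h0, href⟩ | ⟨o, ho, hoq, h0, href⟩
  · refine wp_seq (wp_branch_eq 0 0 (by simp) (by simp [h0]) (by simp) (by simp) ?_ (by simp))
    intro _
    refine wp_skip ?_
    refine (tail 7 _ ref ?_ href ?_ ?_ (by simp)).mono ?_
    · simpa using hT
    · intros; rfl
    · intro i i1 i2
      simp [i1]
    · rintro t s' ⟨g1, g2, g3, g4, g5⟩
      refine ⟨g1, g2, g3, g4, ?_⟩
      simp
      omega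
  · have hMo := hB.blk_le ((hT.ix_lt (.ord o) ho).trans_le hK)
    have hbo := le_blk σ d (ix (.ord o))
    refine wp_seq (wp_branch_eq (blk σ d (ix (.ord o))) 0 (by simp) (by simp [h0]) (by simp)
      (by simp) (by omega) ?_)
    intro _
    refine Wp.mono (wp_dec hB (b := blk σ d (ix (.ord o))) (by simp [hC.r0]) (by simp [h0]) (by simp)
      hMo) ?_
    rintro t s' ⟨rfl, rfl⟩
    have hcount := hT.count o ho
    have ho' := href o
    rw [if_pos rfl, if_neg (Ne.symm hoq)] at ho'
    -- The intermediate count: the old reference is gone, the new one is not yet made. The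
    -- subtraction is exact because `hold` makes `ref' q` positive.
    refine (tail 22 _ (fun p => ref' p - if q = p then 1 else 0) ?_ ?_ ?_ ?_ (by simp)).mono ?_
    · have := hT.update_count (ref' := fun p => ref' p - if q = p then 1 else 0) ho
        (x := s.mem (blk σ d (ix (.ord o)) + (4 + σ)) - 1) ?_ ?_
      · simpa using this
      · rw [hcount, if_neg (Ne.symm hoq)]
        omega
      · intro p _ hp
        have := href p
        rw [if_neg (Ne.symm hp)] at this
        omega
    · intro p
      have := href p
      by_cases hp : q = p
      · subst hp
        rw [if_pos rfl, if_neg hoq] at this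
        rw [if_pos rfl]
        omega
      · rw [if_neg hp]
        omega
    · intro b hb
      have : b ≠ blk σ d (ix (.ord o)) + (4 + σ) := by omega
      simp [this]
    · intro i i1 i2
      simp [i1, i2]
    · rintro t s' ⟨g1, g2, g3, g4, g5⟩
      refine ⟨g1, g2, g3, g4, ?_⟩
      simp
      omega

theorem wp_append (hB : Room E d Kmax) (hS : E.text = S) (hlo : E.lo = l) (hhi : E.hi = r)
    (h : Inv d Kmax S l r en ix F K s) (hr : r < S.length) (hd' : r + 1 - l ≤ d)
    (hsize : (pals (factor S l (r + 1))).ncard + 2 ≤ Kmax) :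
    Wp E appendCmd s fun t s' => ∃ en' ix' F' K', Inv d Kmax S l (r + 1) en' ix' F' K' s' ∧
      t + 40 * pot (factor S l (r + 1)) + 20 * (σ * K) ≤
        40 * pot (factor S l r) + 20 * (σ * K') + 1200 := by
  have hw := hB.word
  have hw0 := hB.w_ne
  have hd := hB.pos
  have hM := hB.le_M
  have hlr := h.le
  have hSl : S.length = E.text.length := by rw [hS]
  refine wp_seq (Wp.mono (wp_grow hB hS hlo hhi h hr hsize) ?_)
  rintro t₁ s₁ ⟨ix', F', K', hC, h11, hKK, hK', hix, hmem, h5, h6, htime⟩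
  have hT := hC.tree
  -- the longest palindromic suffix and its position
  have hne : lspal (factor S l (r + 1)) ≠ [] := lspal_ne_nil (factor_ne_nil (by omega) hr)
  have hpos := List.length_pos_iff.2 hne
  have hlen := (lspal_suffix (factor S l (r + 1))).length_le
  rw [length_factor hr] at hlen
  have hfac := eq_factor_of_suffix hr (lspal_suffix (factor S l (r + 1)))
  have hpal := lspal_palindrome (factor S l (r + 1))
  have hmaxl : ∀ b, l ≤ b → (factor S b (r + 1)).Palindrome →
      (factor S b (r + 1)).length ≤ (lspal (factor S l (r + 1))).length := fun b hb hp =>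
    (suffix_lspal hp (factor_suffix hb)).length_le
  have hnode := node_of_ne_nil hne
  have hlp : lp (node (lspal (factor S l (r + 1)))) = (lspal (factor S l (r + 1))).length + 1 :=
    lp_node _
  have hmemp : lspal (factor S l (r + 1)) ∈ pals (factor S l (r + 1)) :=
    ⟨hne, hpal, (lspal_suffix _).isInfix⟩
  generalize hq : lspal (factor S l (r + 1)) = q at *
  obtain ⟨st, hst⟩ : ∃ st, st = r + 1 - q.length := ⟨_, rfl⟩
  rw [← hst] at hfac
  have hlst : l ≤ st := by omega
  have hstr : st ≤ r := by omega
  have hnN : NodeIn (pals (factor S l (r + 1))) (node q) := nodeIn_node hmemp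
  have hMq := hB.blk_le ((hT.ix_lt _ hnN).trans_le hK')
  have hsurf := h.surf.append hr hlst hstr (hfac ▸ hpal) (by
    intro b hb hbs hp
    have := hmaxl b hb hp
    rw [length_factor hr] at this
    omega)
  have hrd : r % d < d := Nat.mod_lt _ hd
  have hstd : st % d < d := Nat.mod_lt _ hd
  have hsub : ∀ v, NodeIn (pals (factor S l r)) v → NodeIn (pals (factor S l (r + 1))) v := by
    intro v hv
    cases v with
    | ord p => exact ⟨hv.1, hv.2.1, hv.2.2.trans (factor_prefix (Nat.le_succ r)).isInfix⟩
    | _ => trivial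
  refine wp_seq (wp_set (blk σ d (ix' (node q))) (by simp) (by simp [h11]) ?_)
  refine wp_seq (wp_load (blk σ d (ix' (node q))) (by simp) (by simp) (by omega) ?_)
  refine wp_seq (wp_store (r % d) 0 (by simp) (by simp [h6, hC.r1]) (by omega) (by simp)
    (by simp) ?_)
  have hqlen := hT.len _ hnN
  rw [hlp] at hqlen
  refine wp_seq (wp_set (st % d) (by simp [h6]; omega) (by
    simp [h6, hC.r1, hqlen]
    congr 1
    omega) ?_)
  have hrefs : ∀ p, refs S l (r + 1) (Function.update en r r) p = refs S l r en p := by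
    intro p
    rw [refs_succ_right hlr (by simp)]
    refine refs_congr (fun b _ hb => ?_) p
    rw [Function.update_of_ne (by omega)]
  have hupd : ∀ p, _ := fun p => refs_update (S := S) (E := Function.update en r r) (e := r + 1)
    hlst (Nat.lt_succ_of_le hstr) p
  refine wp_seq (Wp.mono (wp_slot (q := q) (N := pals (factor S l (r + 1))) (ix := ix') (F := F')
    (K := K') (ref := refs S l r en)
    (ref' := refs S l (r + 1) (Function.update (Function.update en r r) st (r + 1))) hB hK'
    (finite_pals _) ⟨?_, ?_, ?_, ?_, ?_, ?_, hC.size⟩ (by simp) (by simp) hstd (by simp) hmemp ?_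
    ?_ ?_) ?_)
  · simp [hC.r0]
  · simp [hC.r1]
  · simp [hC.r2]
  · simp [hC.r3]
  · simp [hC.r7]
  · simpa using hT.update_surface hrd 0
  · simp [hnode]
  · exact fun p => (refs_le _ _ _ _ p).trans hd'
  · -- the entry that is replaced
    have hnew : ∀ p, (if st < r + 1 ∧ factor S st (r + 1) = p then 1 else 0) =
        if q = p then 1 else 0 := by
      intro p
      have : st < r + 1 := by omega
      rw [← hfac]
      simp [this]
    by_cases hsr : st = r
    · left
      refine ⟨by simp [hsr], fun p => ?_⟩
      have := hupd p
      rw [hnew, hrefs, if_neg (by simp [hsr])] at this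
      exact this
    · have hmod : st % d ≠ r % d := mod_ne_mod (by omega) (by omega)
      have harr := h.arr st hlst (by omega)
      rw [← hmem _ hstd] at harr
      by_cases hen : en st = st
      · left
        rw [if_pos hen] at harr
        refine ⟨by simp [hmod, harr], fun p => ?_⟩
        have := hupd p
        rw [hnew, hrefs, if_neg (by simp [hsr, hen])] at this
        exact this
      · right
        rw [if_neg hen] at harr
        have hold := h.surf.mem_pals hr.le hlst (by omega) hen
        have hen' : st < en st ∧ en st ≤ r := by
          rcases h.surf.entry st hlst (by omega) with h1 | h1
          · exact absurd h1 hen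
          · exact ⟨h1.1, h1.2.1⟩
        -- The old entry at `st` ends at `r` or earlier, whereas the new palindrome ends at `r + 1`;
        -- this is why the two differ.
        refine ⟨factor S st (en st), hsub (.ord _) hold, ?_, ?_, fun p => ?_⟩
        · intro he
          have := congrArg List.length he
          rw [length_factor (by omega)] at this
          omega
        · simp [hmod, harr, hix (.ord _) hold]
        · have := hupd p
          rw [hnew, hrefs] at this
          rw [← this]
          simp [hsr, hen'.1]
  rintro t₂ s₂ ⟨g1, g2, g3, g4, g5⟩
  have h6₂ : s₂.reg 6 = r := by
    rw [g4 6 (by simp) (by simp)]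
    simp [h6]
  refine wp_set (r + 1) (by simp [h6₂, hw0]; omega) (by simp [h6₂])
    ⟨_, ix', F', K', ⟨⟨?_, ?_, ?_, ?_, ?_, ?_, hC.size⟩, by omega, hr, hd', ?_, ?_, ?_, ?_, hsurf,
      hK'⟩, ?_⟩
  · simp [g1.r0]
  · simp [g1.r1]
  · simp [g1.r2]
  · simp [g1.r3]
  · simp [g1.r7]
  · simpa using g1.tree
  · rw [hq]
    simp [g4]
  · simp [g4, h5]
  · simp
  · intro b hb hbr
    dsimp only
    by_cases h1 : b = st
    · subst h1
      rw [g2, Function.update_self, if_neg (by omega), ← hfac]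
    · have hmod : b % d ≠ st % d := by
        rcases Nat.lt_or_gt_of_ne h1 with h2 | h2
        · exact mod_ne_mod h2 (by omega)
        · exact (mod_ne_mod h2 (by omega)).symm
      rw [g3 _ (Nat.mod_lt _ hd) hmod, Function.update_of_ne h1]
      by_cases h2 : b = r
      · subst h2
        simp
      · have hmod' : b % d ≠ r % d := mod_ne_mod (by omega) (by omega)
        have harr := h.arr b hb (by omega)
        rw [Function.update_of_ne h2]
        dsimp only
        rw [Function.update_of_ne hmod', hmem _ (Nat.mod_lt _ hd), harr]
        split_ifs with h3
        · rfl
        · rw [hix (.ord _) (h.surf.mem_pals hr.le hb (by omega) h3)]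
  · simp
    omega

end Append

/-! ### Deleting a character -/

section Delete

open RExpr Cmd

attribute [local simp] val Fits fld chd Function.update_apply RExpr.cost RTest.Holds RTest.cost

variable {σ : ℕ} {E : REnv σ} {d Kmax : ℕ} {S : List (Fin σ)} {l r : ℕ} {en : ℕ → ℕ}
  {ix : ENode (Fin σ) → ℕ} {F : List ℕ} {K : ℕ} {s : RState}

theorem wp_remove (hB : Room E d Kmax) (hK : K ≤ Kmax) {N : Set (List (Fin σ))}
    (hN : FactorClosed N) (hfin : N.Finite) {ref : List (Fin σ) → ℕ} {p : List (Fin σ)}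
    (hp : p ∉ N) (hN' : FactorClosed (insert p N)) (hC : Core d (insert p N) ref ix F K s)
    (h10 : s.reg 10 = blk σ d (ix (slink (.ord p))))
    (h11 : s.reg 11 = blk σ d (ix (.ord p))) :
    Wp E removeCmd s fun t s' => Core d N ref ix (ix (.ord p) :: F) K s' ∧
      (∀ a < d, s'.mem a = s.mem a) ∧
      (∀ i, i ≠ 8 → i ≠ 15 → i ≠ 16 → i ≠ 18 → s'.reg i = s.reg i) ∧ t ≤ 60 := by
  have hw := hB.word
  have hw0 := hB.w_ne
  have hT := hC.tree
  have hpN : p ∈ (insert p N : Set (List (Fin σ))) := Set.mem_insert _ _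
  have hpv : Valid (.ord p) := ⟨hN'.ne_nil p hpN, hN'.pal p hpN⟩
  obtain ⟨c, u, hu, rfl, hui⟩ := exists_wrap hpv.2 hpv.1
  have huN : NodeIn N u := by
    rcases nodeIn_insert_iff.1 (hN'.nodeIn_of_wrap hu hpN) with h | h
    · have := congrArg lp h
      simp only [lp_ord, length_wrap] at this
      omega
    · exact h
  have hsl : NodeIn N (slink (.ord (wrap c u))) := by
    rcases nodeIn_insert_iff.1 (hN'.nodeIn_slink (v := .ord (wrap c u)) hpN) with h | h
    · have := lp_slink_lt hpv (by simp)
      rw [h] at this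
      omega
    · exact h
  have hin : ∀ v, NodeIn N v → NodeIn (insert (wrap c u) N) v := fun v hv =>
    nodeIn_insert_iff.2 (.inr hv)
  have hkv : ∀ v, NodeIn N v → ix v ≠ ix (.ord (wrap c u)) := by
    intro v hv he
    have := hT.ix_inj v (.ord _) (hin v hv) hpN he
    rw [this] at hv
    exact hp hv
  have hcσ := c.2
  have hMp := hB.blk_le ((hT.ix_lt (.ord _) hpN).trans_le hK)
  have hMu := hB.blk_le ((hT.ix_lt u (hin u huN)).trans_le hK)
  have hMs := hB.blk_le ((hT.ix_lt _ (hin _ hsl)).trans_le hK)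
  have hbp := le_blk σ d (ix (.ord (wrap c u)))
  have hbu := le_blk σ d (ix u)
  have hbs := le_blk σ d (ix (slink (.ord (wrap c u))))
  have hpar := hT.parent u c (hin u huN) hpN
  have hlab := hT.label u c (hin u huN) hpN
  refine wp_seq (wp_load (blk σ d (ix (.ord (wrap c u))) + 2) (by simp [h11]; omega)
    (by simp [h11]) (by omega) ?_)
  refine wp_seq (wp_load (blk σ d (ix (.ord (wrap c u))) + 3) (by simp [h11]; omega)
    (by simp [h11]) (by omega) ?_)
  refine wp_seq (wp_store (blk σ d (ix u) + (4 + c.val)) 0 (by simp [hpar, hlab]; omega)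
    (by simp [hpar, hlab]) (by omega) (by simp) (by simp) ?_)
  refine wp_seq (Wp.mono (wp_dec hB (b := blk σ d (ix (slink (.ord (wrap c u)))))
    (by simp [hC.r0]) (by simp [h10]) (by simp) hMs) ?_)
  rintro t s' ⟨rfl, rfl⟩
  refine wp_seq (wp_store (blk σ d (ix (.ord (wrap c u))) + 1) (s.reg 8) (by simp [h11, hw0]; omega)
    (by simp [h11]) (by omega) (by simp) (by simp) ?_)
  refine wp_set (blk σ d (ix (.ord (wrap c u)))) (by simp) (by simp [h11]) ?_
  have h1 : c.val ≠ σ := by omega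
  have h1' : σ ≠ c.val := by omega
  have hks := hkv _ hsl
  have hku := hkv u huN
  refine ⟨⟨?_, ?_, ?_, ?_, ?_, ?_, ?_⟩, ?_, ?_, ?_⟩
  · simp [hC.r0]
  · simp [hC.r1]
  · simp [hC.r2]
  · simp [hC.r3]
  · simp [hC.r7]
  · dsimp only
    rw [Function.update_self]
    refine hT.remove_node hN' hN hfin hp huN ?_ ?_ ?_ ?_ ?_ ?_
    · simp (disch := omega) [blk_add_inj, hku, h1]
    · simp (disch := omega) [blk_add_inj, hks, h1']
    · simp
    · intro o ho ho1
      simp (disch := omega) [blk_add_inj, hks.symm, hku.symm]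
    · intro v hv o ho hv1 hv2
      have h2 : ix v = ix u ↔ v = u := ⟨hT.ix_inj v u (hin v hv) (hin u huN), fun h => by rw [h]⟩
      have h3 : ix v = ix (slink (.ord (wrap c u))) ↔ v = slink (.ord (wrap c u)) :=
        ⟨hT.ix_inj v _ (hin v hv) (hin _ hsl), fun h => by rw [h]⟩
      simp (disch := omega) only [Function.update_apply, blk_add_inj, hkv v hv, h2, h3, false_and,
        if_false, hv1, hv2]
    · intro k hk o ho
      have h2 : k ≠ ix u := (hT.free_ne k hk u (hin u huN)).symm
      have h3 : k ≠ ix (slink (.ord (wrap c u))) := (hT.free_ne k hk _ (hin _ hsl)).symm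
      have h4 : k ≠ ix (.ord (wrap c u)) := (hT.free_ne k hk (.ord _) hpN).symm
      simp (disch := omega) only [Function.update_apply, blk_add_inj, h2, h3, h4, false_and,
        if_false]
  · have := hC.size
    rw [Set.ncard_insert_of_notMem hp hfin] at this
    simp only [List.length_cons]
    omega
  · intro a ha
    dsimp only
    rw [Function.update_of_ne (by omega), Function.update_of_ne (by omega),
      Function.update_of_ne (by omega)]
  · intro i i1 i2 i3 i4
    simp [i1, i2, i3, i4]
  · simp

/-- The added indicator keeps the reference from the deleted position to the longest prefix until
the caller decrements its counter. Ends are compared through stored lengths, which is legitimate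
since both palindromes start at `q`; an empty entry counts as length word `0`. -/
theorem wp_shift (hB : Room E d Kmax) (h : Inv d Kmax S l r en ix F K s) (hr1 : l + 1 < r)
    {q : ℕ} (hlq : l < q) (hqe : q ≤ en l) (hen : en l ≤ r)
    (hq : lspal (factor S (l + 1) (en l)) = factor S q (en l)) {s : RState}
    (hC : Core d (pals (factor S l r)) (refs S l r en) ix F K s)
    (hmem : ∀ b, l ≤ b → b < r →
      s.mem (b % d) = if en b = b then 0 else blk σ d (ix (.ord (factor S b (en b)))))
    (h5 : s.reg 5 = l)
    (h10 : s.reg 10 = blk σ d (ix (node (factor S q (en l)))))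
    (h12 : s.reg 12 = en l - l + 1) (h13 : s.reg 13 = en l - q + 1)
    (hs : E.text.length = S.length) :
    Wp E shiftCmd s fun t s' => Core d (pals (factor S l r))
        (fun p => refs S (l + 1) r (shiftEnd en q (en l)) p +
          if factor S l (en l) = p then 1 else 0) ix F K s' ∧
      (∀ b, l + 1 ≤ b → b < r → s'.mem (b % d) = if shiftEnd en q (en l) b = b then 0
        else blk σ d (ix (.ord (factor S b (shiftEnd en q (en l) b))))) ∧
      (∀ i, i ≠ 14 → i ≠ 17 → i ≠ 18 → i ≠ 19 → s'.reg i = s.reg i) ∧ t ≤ 120 := by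
  have hw := hB.word
  have hw0 := hB.w_ne
  have hd := hB.pos
  have hM := hB.le_M
  have hle := h.le_length
  have hd' := h.le_d
  have hT := hC.tree
  have hleft : ∀ p, refs S l r en p = refs S (l + 1) r en p +
      if factor S l (en l) = p then 1 else 0 := by
    intro p
    have : l < en l := by omega
    rw [refs_succ_left (by omega)]
    simp [this]
  refine wp_branch_lt 1 (en l - q + 1) (by simp [hw0]) (by simp) (by simp) (by simp [h13]) ?_ ?_
  · intro hlt
    have hqr : q < r := by omega
    have hqd : q % d < d := Nat.mod_lt _ hd
    have hQne : factor S q (en l) ≠ [] := factor_ne_nil (by omega) (by omega)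
    have hQ : factor S q (en l) ∈ pals (factor S l r) :=
      (mem_pals_factor hle).2 ⟨hq ▸ lspal_palindrome _, q, en l, by omega, by omega, hen, rfl⟩
    have hnode := node_of_ne_nil hQne
    have harr := hmem q (by omega) hqr
    refine wp_seq (wp_set (q % d) (by simp [h5, h12]; omega) (by
      simp [h5, h12, h13, hC.r1]
      congr 1
      omega) ?_)
    refine wp_seq (wp_load (q % d) (by simp) (by simp) (by omega) ?_)
    -- the comparison of the two entries
    have key : ∀ (x t₀ : ℕ) (s₁ : RState), (x < en l - q + 1 ↔ en q < en l) → s₁.reg 19 = x →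
        s₁.mem = s.mem → s₁.reg 17 = q % d →
        (∀ i, i ≠ 14 → i ≠ 17 → i ≠ 19 → s₁.reg i = s.reg i) → t₀ ≤ 50 →
        Wp E (branch (.lt (reg 19) (reg 13)) (slotCmd 10) skip) s₁ fun t s' =>
          Core d (pals (factor S l r)) (fun p => refs S (l + 1) r (shiftEnd en q (en l)) p +
            if factor S l (en l) = p then 1 else 0) ix F K s' ∧
          (∀ b, l + 1 ≤ b → b < r → s'.mem (b % d) = if shiftEnd en q (en l) b = b then 0
            else blk σ d (ix (.ord (factor S b (shiftEnd en q (en l) b))))) ∧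
          (∀ i, i ≠ 14 → i ≠ 17 → i ≠ 18 → i ≠ 19 → s'.reg i = s.reg i) ∧ t₀ + t ≤ 120 := by
      intro x t₀ s₁ hx h19 hm₁ h17 hreg ht₀
      have hC₁ : Core d (pals (factor S l r)) (refs S l r en) ix F K s₁ := by
        refine ⟨?_, ?_, ?_, ?_, ?_, ?_, hC.size⟩
        · rw [hreg 0 (by simp) (by simp) (by simp), hC.r0]
        · rw [hreg 1 (by simp) (by simp) (by simp), hC.r1]
        · rw [hreg 2 (by simp) (by simp) (by simp), hC.r2]
        · rw [hreg 3 (by simp) (by simp) (by simp), hC.r3]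
        · rw [hreg 7 (by simp) (by simp) (by simp), hC.r7]
        · rw [hreg 8 (by simp) (by simp) (by simp), hm₁]
          exact hT
      refine wp_branch_lt x (en l - q + 1) (by simp) (by simp [h19]) (by simp)
        (by simp [hreg, h13]) ?_ ?_
      · intro h1
        have h2 := hx.1 h1
        have hsh : shiftEnd en q (en l) = Function.update en q (en l) := if_pos ⟨by omega, h2⟩
        rw [hsh]
        have hupd : ∀ p, _ := fun p => refs_update (S := S) (E := en) (e := en l)
          (show l + 1 ≤ q by omega) hqr p
        have hnew : ∀ p, (if q < en l ∧ factor S q (en l) = p then 1 else 0) =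
            if factor S q (en l) = p then 1 else 0 := by
          intro p
          have : q < en l := by omega
          simp [this]
        refine Wp.mono (wp_slot (q := factor S q (en l)) (ref := refs S l r en)
          (ref' := fun p => refs S (l + 1) r (Function.update en q (en l)) p +
            if factor S l (en l) = p then 1 else 0) hB h.K_le (finite_pals _) hC₁
          (by simp) (by simp) hqd h17 hQ ?_ ?_ ?_) ?_
        · rw [hreg 10 (by simp) (by simp) (by simp), h10, hnode]
        · intro p
          have := refs_le S (l + 1) r (Function.update en q (en l)) p
          split_ifs <;> omega
        · by_cases h3 : en q = q
          · left
            rw [if_pos h3] at harr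
            refine ⟨by rw [hm₁, harr], fun p => ?_⟩
            have := hupd p
            rw [hnew, if_neg (by simp [h3])] at this
            rw [hleft]
            omega
          · right
            rw [if_neg h3] at harr
            have hold := h.surf.mem_pals hle (by omega) hqr h3
            have h4 : q < en q := by
              rcases h.surf.entry q (by omega) hqr with h5 | h5
              · exact absurd h5 h3
              · exact h5.1
            refine ⟨factor S q (en q), hold, ?_, by rw [hm₁, harr], fun p => ?_⟩
            · intro he
              have := congrArg List.length he
              rw [length_factor (by omega), length_factor (by omega)] at this
              omega
            · have := hupd p
              rw [hnew] at this
              simp only [h4, true_and] at this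
              rw [hleft]
              omega
        · rintro t s' ⟨g1, g2, g3, g4, g5⟩
          refine ⟨g1, ?_, ?_, ?_⟩
          · intro b hb hbr
            by_cases hbq : b = q
            · subst hbq
              rw [g2, Function.update_self, if_neg (by omega)]
            · have hmod : b % d ≠ q % d := by
                rcases Nat.lt_or_gt_of_ne hbq with h2 | h2
                · exact mod_ne_mod h2 (by omega)
                · exact (mod_ne_mod h2 (by omega)).symm
              rw [g3 _ (Nat.mod_lt _ hd) hmod, Function.update_of_ne hbq, hm₁]
              exact hmem b (by omega) hbr
          · intro i i1 i2 i3 i4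
            rw [g4 i i1 i3, hreg i i1 i2 i4]
          · simp
            omega
      · intro h1
        have h2 : ¬ en q < en l := fun h3 => absurd (hx.2 h3) (by omega)
        have hsh : shiftEnd en q (en l) = en := if_neg fun h3 => h2 h3.2
        rw [hsh]
        refine wp_skip ⟨?_, ?_, ?_, ?_⟩
        · exact { hC₁ with tree := hC₁.tree.congr_ref fun p _ => (hleft p).symm }
        · intro b hb hbr
          rw [hm₁]
          exact hmem b (by omega) hbr
        · intro i i1 i2 _ i4
          exact hreg i i1 i2 i4
        · simp
          omega
    by_cases h3 : en q = q
    · rw [if_pos h3] at harr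
      refine wp_seq (wp_branch_eq 0 0 (by simp) (by simp [harr]) (by simp) (by simp) ?_ (by simp))
      intro _
      refine wp_set 0 (by simp) (by simp) ?_
      refine Wp.mono (key 0 18 _ (by omega) (by simp) rfl (by simp) ?_ (by simp)) ?_
      · intro i i1 i2 i4
        simp [i1, i2, i4]
      · rintro t s' ⟨g1, g2, g3, g4⟩
        refine ⟨g1, g2, g3, ?_⟩
        simp
        omega
    · rw [if_neg h3] at harr
      have hold := h.surf.mem_pals hle (by omega) hqr h3
      have h4 : q < en q ∧ en q ≤ r := by
        rcases h.surf.entry q (by omega) hqr with h5 | h5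
        · exact absurd h5 h3
        · exact ⟨h5.1, h5.2.1⟩
      have hMo := hB.blk_le ((hT.ix_lt (.ord _) hold).trans_le h.K_le)
      have hbo := le_blk σ d (ix (.ord (factor S q (en q))))
      have hlen := hT.len (.ord _) hold
      rw [lp_ord, length_factor (by omega)] at hlen
      refine wp_seq (wp_branch_eq (blk σ d (ix (.ord (factor S q (en q))))) 0 (by simp)
        (by simp [harr]) (by simp) (by simp) (by omega) ?_)
      intro _
      refine wp_load (blk σ d (ix (.ord (factor S q (en q))))) (by simp) (by simp [harr])
        (by omega) ?_
      refine Wp.mono (key (en q - q + 1) 18 _ (by omega) (by simp [hlen]) rfl (by simp) ?_ (by simp))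
        ?_
      · intro i i1 i2 i4
        simp [i1, i2, i4]
      · rintro t s' ⟨g1, g2, g3, g4⟩
        refine ⟨g1, g2, g3, ?_⟩
        simp
        omega
  · intro hge
    have hsh : shiftEnd en q (en l) = en := if_neg fun h3 => by omega
    rw [hsh]
    refine wp_skip ⟨?_, ?_, ?_, ?_⟩
    · exact { hC with tree := hT.congr_ref fun p _ => (hleft p).symm }
    · intro b hb hbr
      exact hmem b (by omega) hbr
    · intros; rfl
    · simp

theorem lp_slink_le {α : Type} [DecidableEq α] {v : ENode α} (hv : Valid v) :
    lp (slink v) ≤ lp v := by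
  by_cases h : v = .neg
  · subst h
    simp [slink]
  · exact (lp_slink_lt hv h).le

/-- The longest palindromic suffix after deleting the first character. -/
theorem node_lspal_tail {α : Type} [DecidableEq α] {W : List α} (h0 : W ≠ []) :
    node (lspal W.tail) =
      if W.Palindrome then slink (node W) else node (lspal W) := by
  cases W with
  | nil => exact absurd rfl h0
  | cons a W =>
    split_ifs with h
    · rw [slink_node _ h0]
    · rw [lspal_cons, if_neg h, List.tail_cons]

/-- The longest palindromic suffix changes only if it was the whole window; then both terms of the
potential move down by one link. -/
theorem pot_tail_le {α : Type} [DecidableEq α] {W : List α} (h0 : W ≠ []) :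
    pot W.tail ≤ pot W := by
  unfold pot
  rw [node_lspal_tail h0]
  split_ifs with h
  · rw [lspal_self h]
    have h1 := lp_slink_le (valid_node h)
    have h2 := lp_slink_le (valid_slink (node W))
    omega
  · exact le_rfl

theorem wp_delete (hB : Room E d Kmax) (hS : E.text = S)
    (h : Inv d Kmax S l r en ix F K s) (hr1 : l + 1 < r) :
    Wp E deleteCmd s fun t s' => ∃ en' F', Inv d Kmax S (l + 1) r en' ix F' K s' ∧ t ≤ 400 := by
  have hw := hB.word
  have hw0 := hB.w_ne
  have hd := hB.pos
  have hM := hB.le_M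
  have hle := h.le_length
  have hd' := h.le_d
  have hC := h.core
  have hT := hC.tree
  have hSl : S.length = E.text.length := by rw [hS]
  have hfc : FactorClosed (pals (factor S l r)) := factorClosed_pals _
  have hfin := finite_pals (factor S l r)
  obtain ⟨f1, f2, f3, f4⟩ := h.surf.first hle (by omega)
  -- the longest palindromic prefix and its suffix link
  have hPne : factor S l (en l) ≠ [] := factor_ne_nil f1 (by omega)
  have hP : factor S l (en l) ∈ pals (factor S l r) :=
    (mem_pals_factor hle).2 ⟨f3, l, en l, le_rfl, f1, f2, rfl⟩
  have hPnode := node_of_ne_nil hPne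
  have hPl := length_factor (S := S) (b := l) (e := en l) (by omega)
  obtain ⟨q, hlq, hqe, hq⟩ : ∃ q, l < q ∧ q ≤ en l ∧
      lspal (factor S (l + 1) (en l)) = factor S q (en l) := by
    have h1 := lspal_suffix (factor S (l + 1) (en l))
    have h2 := h1.length_le
    rw [length_factor (by omega)] at h2
    exact ⟨_, by omega, by omega, eq_factor_of_suffix (by omega) h1⟩
  have hQl := length_factor (S := S) (b := q) (e := en l) (by omega)
  have hsl : slink (.ord (factor S l (en l))) = node (factor S q (en l)) := by
    rw [slink, factor_tail, hq]
  have hQN : NodeIn (pals (factor S l r)) (node (factor S q (en l))) :=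
    hsl ▸ hfc.nodeIn_slink (v := .ord _) hP
  have hMP := hB.blk_le ((hT.ix_lt (.ord _) hP).trans_le h.K_le)
  have hMQ := hB.blk_le ((hT.ix_lt _ hQN).trans_le h.K_le)
  have harr := h.arr l le_rfl (by omega)
  rw [if_neg (by omega)] at harr
  have hslink := hT.slink (.ord _) hP
  rw [hsl] at hslink
  have hPlen := hT.len (.ord _) hP
  rw [lp_ord, hPl] at hPlen
  have hQlen := hT.len _ hQN
  rw [lp_node, hQl] at hQlen
  have hld : l % d < d := Nat.mod_lt _ hd
  refine wp_seq (wp_load (l % d) (by simp) (by simp [h.r5, hC.r1]) (by omega) ?_)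
  refine wp_seq (wp_load (blk σ d (ix (.ord (factor S l (en l)))) + 1) (by simp [harr, hw0]; omega)
    (by simp [harr]) (by omega) ?_)
  refine wp_seq (wp_load (blk σ d (ix (.ord (factor S l (en l))))) (by simp) (by simp [harr])
    (by omega) ?_)
  refine wp_seq (wp_load (blk σ d (ix (node (factor S q (en l))))) (by simp) (by simp [hslink])
    (by omega) ?_)
  dsimp only
  rw [harr, hslink, hPlen, hQlen]
  -- the new longest palindromic suffix
  have hWne : factor S l r ≠ [] := factor_ne_nil (by omega) hle
  have hwhole : (factor S l r).Palindrome ↔ en l = r := by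
    constructor
    · intro hp
      by_contra hne
      exact f4 r (by omega) le_rfl hp
    · intro he
      rwa [he] at f3
  have hcur := node_lspal_tail hWne
  rw [factor_tail] at hcur
  have next : ∀ (t₀ : ℕ) (s₁ : RState), s₁.mem = s.mem →
      s₁.reg 4 = blk σ d (ix (node (lspal (factor S (l + 1) r)))) →
      s₁.reg 10 = blk σ d (ix (node (factor S q (en l)))) →
      s₁.reg 11 = blk σ d (ix (.ord (factor S l (en l)))) →
      s₁.reg 12 = en l - l + 1 → s₁.reg 13 = en l - q + 1 →
      (∀ i, i ≠ 4 → i < 10 → s₁.reg i = s.reg i) → t₀ ≤ 60 →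
      Wp E (seq shiftCmd (seq (decCmd 11) (seq (load 18 (chd 11 0))
        (seq (branch (.eq (reg 18) (const 0)) removeCmd skip)
        (set 5 (add (reg 5) (const 1))))))) s₁ fun t s' =>
          ∃ en' F', Inv d Kmax S (l + 1) r en' ix F' K s' ∧ t₀ + t ≤ 400 := by
    intro t₀ s₁ hm₁ h4 h10 h11 h12 h13 hreg ht₀
    have hC₁ : Core d (pals (factor S l r)) (refs S l r en) ix F K s₁ := by
      refine ⟨?_, ?_, ?_, ?_, ?_, ?_, hC.size⟩
      · rw [hreg 0 (by simp) (by simp), hC.r0]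
      · rw [hreg 1 (by simp) (by simp), hC.r1]
      · rw [hreg 2 (by simp) (by simp), hC.r2]
      · rw [hreg 3 (by simp) (by simp), hC.r3]
      · rw [hreg 7 (by simp) (by simp), hC.r7]
      · rw [hreg 8 (by simp) (by simp), hm₁]
        exact hT
    have hsurf := h.surf.delete hle (by omega) hlq hqe hq
    refine wp_seq (Wp.mono (wp_shift hB h hr1 hlq hqe f2 hq hC₁ (by rw [hm₁]; exact h.arr)
      (by rw [hreg 5 (by simp) (by simp), h.r5]) h10 h12 h13 hSl.symm) ?_)
    rintro t₂ s₂ ⟨hC₂, harr₂, hreg₂, ht₂⟩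
    have hT₂ := hC₂.tree
    have hfirst := h.surf.first_mem_iff hle (by omega) hsurf
    set ref' := refs S (l + 1) r (shiftEnd en q (en l)) with href'
    set P := factor S l (en l) with hPdef
    have h11₂ : s₂.reg 11 = blk σ d (ix (.ord P)) := by
      rw [hreg₂ 11 (by simp) (by simp) (by simp) (by simp), h11]
    refine wp_seq (Wp.mono (wp_dec hB (b := blk σ d (ix (.ord P))) hC₂.r0 h11₂ (by simp) hMP) ?_)
    rintro t₃ s₃ ⟨rfl, rfl⟩
    have hcount := hT₂.count P hP
    rw [if_pos rfl] at hcount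
    -- Dropping the reference from position `l` leaves exactly the number tested in
    -- `Surface.first_mem_iff`: surface entries of the new window plus suffix links among the
    -- palindromes of the old one.
    have hval : s₂.mem (blk σ d (ix (.ord P)) + (4 + σ)) - 1 =
        ref' P + links (pals (factor S l r)) P := by omega
    rw [hval]
    have hT₃ := hT₂.update_count (ref' := ref') hP rfl (by
      intro p _ hp
      rw [if_neg (Ne.symm hp), add_zero])
    have hbP := le_blk σ d (ix (.ord P))
    refine wp_seq (wp_load (blk σ d (ix (.ord P)) + (4 + σ)) (by simp [h11₂, hC₂.r0]; omega)
      (by simp [h11₂, hC₂.r0]) (by omega) ?_)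
    dsimp only
    rw [Function.update_self]
    have hmemd : ∀ a < d, Function.update s₂.mem (blk σ d (ix (.ord P)) + (4 + σ))
        (ref' P + links (pals (factor S l r)) P) a = s₂.mem a := by
      intro a ha
      rw [Function.update_of_ne (by omega)]
    have hsub : pals (factor S (l + 1) r) ⊆ pals (factor S l r) := fun p hp =>
      ⟨hp.1, hp.2.1, hp.2.2.trans (factor_suffix (Nat.le_succ l)).isInfix⟩
    have finish : ∀ (t₅ : ℕ) (F' : List ℕ) (s₅ : RState),
        Core d (pals (factor S (l + 1) r)) ref' ix F' K s₅ → (∀ a < d, s₅.mem a = s₂.mem a) →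
        s₅.reg 4 = s₂.reg 4 → s₅.reg 5 = s₂.reg 5 → s₅.reg 6 = s₂.reg 6 → t₅ ≤ 350 →
        Wp E (set 5 (add (reg 5) (const 1))) s₅ fun t s' =>
          ∃ en' F', Inv d Kmax S (l + 1) r en' ix F' K s' ∧ t₅ + t ≤ 400 := by
      intro t₅ F' s₅ hC₅ hm₅ r4 r5 r6 ht₅
      have h5 : s₅.reg 5 = l := by
        rw [r5, hreg₂ 5 (by simp) (by simp) (by simp) (by simp), hreg 5 (by simp) (by simp), h.r5]
      refine wp_set (l + 1) (by simp [h5, hw0]; omega) (by simp [h5])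
        ⟨shiftEnd en q (en l), F', ⟨⟨?_, ?_, ?_, ?_, ?_, ?_, hC₅.size⟩, by omega, hle, by omega,
          ?_, ?_, ?_, ?_, hsurf, h.K_le⟩, ?_⟩
      · simp [hC₅.r0]
      · simp [hC₅.r1]
      · simp [hC₅.r2]
      · simp [hC₅.r3]
      · simp [hC₅.r7]
      · simpa using hC₅.tree
      · simp [r4, hreg₂ 4, h4]
      · simp
      · simp [r6, hreg₂ 6, hreg 6, h.r6]
      · intro b hb hbr
        dsimp only
        rw [hm₅ _ (Nat.mod_lt _ hd)]
        exact harr₂ b hb hbr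
      · simp
        omega
    by_cases h0 : ref' P + links (pals (factor S l r)) P = 0
    · have hPn : P ∉ pals (factor S (l + 1) r) := fun hp => by
        have := hfirst.1 hp
        omega
      -- The longest prefix is the only palindrome lost, so the old node set is the new one with `P`
      -- added, as the removal of a leaf requires.
      have hins : insert P (pals (factor S (l + 1) r)) = pals (factor S l r) := by
        refine Set.Subset.antisymm (Set.insert_subset hP hsub) fun p hp => ?_
        by_cases hpP : p = P
        · exact .inl hpP
        · exact .inr (h.surf.mem_pals_delete hle (by omega) hp hpP)
      refine wp_seq (wp_branch_eq 0 0 (by simp) (by simp [h0]) (by simp) (by simp) ?_ (by simp))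
      intro _
      refine Wp.mono (wp_remove (p := P) (N := pals (factor S (l + 1) r)) (ref := ref') (ix := ix)
        (F := F) (K := K) hB h.K_le (factorClosed_pals _) (finite_pals _) hPn
        (hins ▸ hfc) ?_ ?_ ?_) ?_
      · rw [hins]
        refine ⟨?_, ?_, ?_, ?_, ?_, ?_, hC.size⟩
        · simp [hC₂.r0]
        · simp [hC₂.r1]
        · simp [hC₂.r2]
        · simp [hC₂.r3]
        · simp [hC₂.r7]
        · simpa using hT₃
      · rw [hsl]
        simp [hreg₂ 10, h10]
      · simp [h11₂]
      rintro t₄ s₄ ⟨g1, g2, g3, g4⟩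
      refine (finish (t₀ + (t₂ + (15 + 6 + (3 + t₄)))) _ s₄ g1 ?_ ?_ ?_ ?_ (by omega)).mono ?_
      · intro a ha
        rw [g2 a ha]
        exact hmemd a ha
      · simp [g3]
      · simp [g3]
      · simp [g3]
      · rintro t s' ⟨en', F', g5, g6⟩
        refine ⟨en', F', g5, ?_⟩
        simp
        omega
    · have hPp : P ∈ pals (factor S (l + 1) r) := hfirst.2 (Nat.pos_of_ne_zero h0)
      have hpals : pals (factor S (l + 1) r) = pals (factor S l r) := by
        refine Set.Subset.antisymm hsub fun p hp => ?_
        by_cases hpP : p = P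
        · rwa [hpP]
        · exact h.surf.mem_pals_delete hle (by omega) hp hpP
      refine wp_seq (wp_branch_eq (ref' P + links (pals (factor S l r)) P) 0 (by simp) (by simp)
        (by simp) (by simp) (fun h => absurd h h0) ?_)
      intro _
      refine wp_skip ?_
      refine Wp.mono (finish (t₀ + (t₂ + (15 + 6 + 4))) F _ ?_ ?_ ?_ ?_ ?_ (by omega)) ?_
      · rw [hpals]
        refine ⟨?_, ?_, ?_, ?_, ?_, ?_, hC.size⟩
        · simp [hC₂.r0]
        · simp [hC₂.r1]
        · simp [hC₂.r2]
        · simp [hC₂.r3]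
        · simp [hC₂.r7]
        · simpa using hT₃
      · exact hmemd
      · simp
      · simp
      · simp
      · rintro t s' ⟨en', F', g5, g6⟩
        refine ⟨en', F', g5, ?_⟩
        simp
        omega
  refine wp_seq (wp_branch_eq (l + (en l - l + 1)) (r + 1) (by simp [h.r5]; omega) (by simp [h.r5])
    (by simp [h.r6, hw0]; omega) (by simp [h.r6]) ?_ ?_)
  · intro he
    refine wp_set (blk σ d (ix (node (factor S q (en l))))) (by simp) (by simp) ?_
    refine Wp.mono (next 40 _ rfl ?_ (by simp) (by simp) (by simp) (by simp) ?_ (by simp)) ?_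
    · have h1 : en l = r := by omega
      rw [hcur, if_pos (hwhole.2 h1), node_of_ne_nil hWne]
      rw [h1] at hsl
      rw [h1, hsl]
      simp
    · intro i i1 i2
      have j1 : i ≠ 10 := by omega
      have j2 : i ≠ 11 := by omega
      have j3 : i ≠ 12 := by omega
      have j4 : i ≠ 13 := by omega
      simp [i1, j1, j2, j3, j4]
    · rintro t s' ⟨en', F', g5, g6⟩
      refine ⟨en', F', g5, ?_⟩
      simp
      omega
  · intro he
    refine wp_skip ?_
    refine Wp.mono (next 40 _ rfl ?_ (by simp) (by simp) (by simp) (by simp) ?_ (by simp)) ?_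
    · have h1 : en l ≠ r := by omega
      rw [hcur, if_neg (fun h2 => h1 (hwhole.1 h2))]
      simp [h.r4]
    · intro i i1 i2
      have j1 : i ≠ 10 := by omega
      have j2 : i ≠ 11 := by omega
      have j3 : i ≠ 12 := by omega
      have j4 : i ≠ 13 := by omega
      simp [j1, j2, j3, j4]
    · rintro t s' ⟨en', F', g5, g6⟩
      refine ⟨en', F', g5, ?_⟩
      simp
      omega

end Delete

/-! ### The whole run -/

section Run

open RExpr Cmd

attribute [local simp] val Fits fld chd Function.update_apply RExpr.cost RTest.Holds RTest.cost

variable {σ : ℕ} {E : REnv σ} {d Kmax : ℕ} {S : List (Fin σ)} {l r : ℕ} {en : ℕ → ℕ}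
  {ix : ENode (Fin σ) → ℕ} {F : List ℕ} {K : ℕ} {s : RState}

/-- The blocks of the auxiliary nodes. -/
def auxIndex : ENode (Fin σ) → ℕ
  | .zero => 1
  | _ => 0

theorem pals_nil {α : Type} : pals ([] : List α) = ∅ := by
  ext p
  simp only [mem_pals, List.infix_nil, Set.mem_empty_iff_false, iff_false]
  tauto

theorem tree_empty {ref : List (Fin σ) → ℕ} {mem : ℕ → ℕ} (h0 : mem (blk σ d 0) = 0)
    (h1 : mem (blk σ d 1) = 1) (h2 : mem (blk σ d 0 + 1) = blk σ d 0)
    (h3 : mem (blk σ d 1 + 1) = blk σ d 0)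
    (h4 : ∀ c < σ, mem (blk σ d 0 + (4 + c)) = 0)
    (h5 : ∀ c < σ, mem (blk σ d 1 + (4 + c)) = 0) :
    Tree d (∅ : Set (List (Fin σ))) ref mem auxIndex [] 2 0 where
  ix_lt v hv := by cases v <;> simp [auxIndex]
  ix_inj u v hu hv h := by
    cases u with
    | ord p => exact absurd hu (Set.notMem_empty p)
    | _ =>
      cases v with
      | ord p => exact absurd hv (Set.notMem_empty p)
      | _ => simp_all [auxIndex]
  len v hv := by
    cases v with
    | ord p => exact absurd hv (Set.notMem_empty p)
    | neg => exact h0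
    | zero => exact h1
  slink v hv := by
    cases v with
    | ord p => exact absurd hv (Set.notMem_empty p)
    | neg => exact h2
    | zero => exact h3
  parent u c _ hw := absurd hw (Set.notMem_empty _)
  label u c _ hw := absurd hw (Set.notMem_empty _)
  child u c _ hw := absurd hw (Set.notMem_empty _)
  no_child v c hv _ := by
    cases v with
    | ord p => exact absurd hv (Set.notMem_empty p)
    | neg => exact h4 c c.2
    | zero => exact h5 c c.2
  count p hp := absurd hp (Set.notMem_empty p)
  free_lt := by simp
  free_nodup := by simp
  free_ne := by simp
  free_null := by simp
  chain := rfl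

/-- The first letter is an append to the empty window with `K = 2`. The term `20 * (σ * 2)` released
by that append pays for clearing the two auxiliary blocks. -/
theorem wp_start (hB : Room E d Kmax) (hS : E.text = S) (hlo : E.lo = 0) (hhi : E.hi = 0)
    (hS0 : 0 < S.length) (h0 : s.reg 0 = σ) (h1 : s.reg 1 = d)
    (hsize : (pals (factor S 0 1)).ncard + 2 ≤ Kmax) :
    Wp E startCmd s fun t s' => ∃ en' ix' F' K', Inv d Kmax S 0 1 en' ix' F' K' s' ∧
      t + 40 * pot (factor S 0 1) ≤ 20 * (σ * K') + 1400 := by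
  have hw := hB.word
  have hw0 := hB.w_ne
  have hd := hB.pos
  have hM := hB.le_M
  have hK : 2 ≤ Kmax := by omega
  have hM0 := hB.blk_le (k := 0) (by omega)
  have hM1 := hB.blk_le (k := 1) (by omega)
  have hb0 : blk σ d 0 = d := by simp [blk]
  have hb1 : blk σ d 1 = d + (σ + 5) := by simp [blk]
  have hb2 : blk σ d 2 = d + (σ + 5) + (σ + 5) := by simp [blk]; ring
  have hd0 : d ≠ 0 := by omega
  refine wp_seq (wp_set 0 (by simp) (by simp) ?_)
  refine wp_seq (wp_set 0 (by simp) (by simp) ?_)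
  refine wp_seq (wp_set 0 (by simp) (by simp) ?_)
  refine wp_seq (wp_set (blk σ d 0) (by simp) (by simp [h1, hb0]) ?_)
  refine wp_seq (wp_set (blk σ d 1) (by simp [h0, hb0]; omega) (by simp [h0, hb0, hb1]) ?_)
  refine wp_seq (wp_set (blk σ d 2) (by simp [h0, hb1]; omega) (by simp [h0, hb1, hb2]) ?_)
  refine wp_seq (wp_store (blk σ d 0) 0 (by simp) (by simp) (by omega) (by simp) (by simp) ?_)
  refine wp_seq (wp_store (blk σ d 0 + 1) (blk σ d 0) (by simp [hw0]; omega) (by simp) (by omega)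
    (by simp) (by simp) ?_)
  refine wp_seq (wp_store (blk σ d 1) 1 (by simp) (by simp) (by omega) (by simp [hw0])
    (by simp) ?_)
  refine wp_seq (wp_store (blk σ d 1 + 1) (blk σ d 0) (by simp [hw0]; omega) (by simp) (by omega)
    (by simp) (by simp) ?_)
  refine wp_seq (wp_set (blk σ d 0) (by simp) (by simp) ?_)
  refine wp_seq (Wp.mono (wp_clear (k := 0) hB (by omega) (by simp [h0]) (by simp)) ?_)
  rintro t₁ s₁ ⟨a1, a2, a3, a4⟩
  refine wp_seq (wp_set (blk σ d 1) (by simp) (by simp [a3]) ?_)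
  refine wp_seq (Wp.mono (wp_clear (k := 1) hB (by omega) (by simp [a3, h0]) (by simp)) ?_)
  rintro t₂ s₂ ⟨b1, b2, b3, b4⟩
  refine wp_seq (wp_set (blk σ d 1) (by simp) (by simp [b3, a3]) ?_)
  have hfac : factor S 0 0 = [] := factor_eq_nil le_rfl
  -- The empty window has no positions, so any function of ends is a surface for it; `id` is chosen.
  have hinv : Inv d Kmax S 0 0 id auxIndex [] 2
      ⟨Function.update s₂.reg 4 (blk σ d 1), s₂.mem⟩ := by
    refine ⟨?_, le_rfl, Nat.zero_le _, Nat.zero_le _, ?_, ?_, ?_, ?_, ?_, hK⟩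
    · rw [hfac, pals_nil]
      refine ⟨?_, ?_, ?_, ?_, ?_, ?_, ?_⟩
      · simp [b3, a3, h0]
      · simp [b3, a3, h1]
      · simp [b3, a3, auxIndex]
      · simp [b3, a3, auxIndex]
      · simp [b3, a3]
      · have h8 : Function.update s₂.reg 4 (blk σ d 1) 8 = 0 := by simp [b3, a3]
        dsimp only
        rw [h8]
        have hfield : ∀ k o, o < 4 → s₂.mem (blk σ d k + o) = s₁.mem (blk σ d k + o) := by
          intro k o ho
          refine b2 _ fun c hc => ?_
          rw [Ne, blk_add_inj (by omega) (by omega)]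
          omega
        have hside : ∀ k o, o < 4 → ∀ c < σ, blk σ d k + o ≠ blk σ d 0 + (4 + c) := by
          intro k o ho c hc
          rw [Ne, blk_add_inj (by omega) (by omega)]
          omega
        refine tree_empty ?_ ?_ ?_ ?_ ?_ b1
        · have e1 := hfield 0 0 (by omega)
          have e2 := a2 _ (hside 0 0 (by omega))
          rw [add_zero] at e1 e2
          rw [e1, e2]
          simp (disch := omega)
        · have e1 := hfield 1 0 (by omega)
          have e2 := a2 _ (hside 1 0 (by omega))
          rw [add_zero] at e1 e2
          rw [e1, e2]
          simp (disch := omega)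
        · rw [hfield 0 1 (by omega), a2 _ (hside 0 1 (by omega))]
          simp (disch := omega)
        · rw [hfield 1 1 (by omega), a2 _ (hside 1 1 (by omega))]
          simp
        · intro c hc
          rw [b2 _ fun c' hc' => by rw [Ne, blk_add_inj (by omega) (by omega)]; omega]
          exact a1 c hc
      · simp
    · rw [hfac]
      simp [auxIndex, node]
    · simp [b3, a3]
    · simp [b3, a3]
    · intro b hb hb'
      omega
    · exact ⟨fun b hb hb' => by omega, fun b e hb hbe he => by omega⟩
  refine Wp.mono (wp_append hB hS hlo hhi hinv hS0 (by omega) hsize) ?_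
  rintro t s' ⟨en', ix', F', K', g1, g2⟩
  refine ⟨en', ix', F', K', g1, ?_⟩
  have hpot : pot (factor S 0 0) = 1 := by
    rw [hfac]
    simp [pot, node, slink]
  rw [hpot, zero_add] at g2
  simp
  omega

theorem Inv.storesEertree {pool : Finset ℕ} (h : Inv d Kmax S l r en ix F K s)
    (hpool : ∀ k < Kmax, blk σ d k ∈ pool) :
    StoresEertree algorithm pool (factor S l r) s fun v => blk σ d (ix v) := by
  have hC := h.core
  have hT := hC.tree
  have hN := factorClosed_pals (factor S l r)
  constructor
  · intro v hv
    exact hpool _ ((hT.ix_lt v ((isNode_iff _ v).1 hv)).trans_le h.K_le)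
  · intro u v hu hv he
    exact hT.ix_inj u v ((isNode_iff _ u).1 hu) ((isNode_iff _ v).1 hv) (blk_inj.1 he)
  · exact hC.r2
  · exact hC.r3
  · intro v hv
    rw [hT.len v ((isNode_iff _ v).1 hv), lp_eq_len]
  · intro v hv
    have hv' := (isNode_iff _ v).1 hv
    exact ⟨slink v, (isNode_iff _ _).2 (hN.nodeIn_slink hv'), isSuffixLink_slink (hN.valid hv'),
      hT.slink v hv'⟩
  · intro u c v hu hv he
    have hu' := (isNode_iff _ u).1 hu
    have hv' := (isNode_iff _ v).1 hv
    rw [isEdge_iff (hN.valid hu') (hN.valid hv')] at he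
    subst he
    exact ⟨hT.parent u c hu' hv', hT.label u c hu' hv'⟩
  · intro u c v hu hv he
    have hu' := (isNode_iff _ u).1 hu
    have hv' := (isNode_iff _ v).1 hv
    rw [isEdge_iff (hN.valid hu') (hN.valid hv')] at he
    subst he
    rw [add_assoc]
    exact hT.child u c hu' hv'
  · intro u c hu hno
    have hu' := (isNode_iff _ u).1 hu
    rw [add_assoc]
    refine hT.no_child u c hu' fun hw => ?_
    exact hno (.ord (wrap c u)) ((isNode_iff _ _).2 hw) (isEdge_wrap u (hN.valid hu') c)

variable {lo hi : ℕ → ℕ} {T w M : ℕ}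

/-- The algorithm runs without errors, and its running time is bounded by the potential. -/
theorem exists_run (hW : IsSlidingWindow S lo hi T)
    (hd : ∀ t ≤ T, hi t - lo t + 1 ≤ d)
    (hB : ∀ a b, Room (⟨w, M, S, a, b⟩ : REnv σ) d Kmax)
    (hsize : ∀ t ≤ T, (pals (factor S (lo t) (hi t + 1))).ncard + 2 ≤ Kmax)
    {s₀ : RState} (h0 : s₀.reg 0 = σ) (h1 : s₀.reg 1 = d) (n : ℕ) (hn : n ≤ T) :
    ∃ (s : ℕ → RState) (τ : ℕ → ℕ), IsRun algorithm S lo hi n w M s₀ s τ ∧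
      (∀ t ≤ n, ∃ en ix F K, Inv d Kmax S (lo t) (hi t + 1) en ix F K (s t)) ∧
      ∃ en ix F K, Inv d Kmax S (lo n) (hi n + 1) en ix F K (s n) ∧
        ∑ t ∈ Finset.range (n + 1), τ t + 40 * pot (factor S (lo n) (hi n + 1)) ≤
          20 * (σ * K) + 1400 * (n + 1) := by
  induction n with
  | zero =>
    have hS0 : 0 < S.length := (Nat.zero_le _).trans_lt (hW.hi_lt 0 hn)
    obtain ⟨t, s, g1, en, ix, F, K, g2, g3⟩ := wp_start (s := s₀) (hB 0 0) rfl rfl rfl hS0 h0 h1 (by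
        have := hsize 0 hn
        rwa [hW.lo_zero, hW.hi_zero] at this)
    refine ⟨fun _ => s, fun _ => t, ⟨?_, by simp, by simp⟩, ?_, en, ix, F, K, ?_, ?_⟩
    · rw [hW.lo_zero, hW.hi_zero]
      exact g1
    · intro t' ht'
      obtain rfl : t' = 0 := by omega
      rw [hW.lo_zero, hW.hi_zero]
      exact ⟨en, ix, F, K, g2⟩
    · rw [hW.lo_zero, hW.hi_zero]
      exact g2
    · rw [hW.lo_zero, hW.hi_zero]
      simpa using g3
  | succ n ih =>
    obtain ⟨s, τ, hrun, hinv, en, ix, F, K, hlast, htime⟩ := ih (by omega)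
    have hlohi := hW.lo_le_hi (n + 1) hn
    have hhi := hW.hi_lt (n + 1) hn
    have hd' := hd (n + 1) hn
    obtain ⟨t', s', hex, en', ix', F', K', hinv', htime'⟩ : ∃ t' s',
        ((hi (n + 1) = hi n + 1 → Exec ⟨w, M, S, lo (n + 1), hi (n + 1)⟩ appendCmd (s n) t' s') ∧
          (lo (n + 1) = lo n + 1 →
            Exec ⟨w, M, S, lo (n + 1), hi (n + 1)⟩ deleteCmd (s n) t' s')) ∧
        ∃ en' ix' F' K', Inv d Kmax S (lo (n + 1)) (hi (n + 1) + 1) en' ix' F' K' s' ∧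
          t' + 40 * pot (factor S (lo (n + 1)) (hi (n + 1) + 1)) + 20 * (σ * K) ≤
            40 * pot (factor S (lo n) (hi n + 1)) + 20 * (σ * K') + 1200 := by
      rcases hW.step n (by omega) with ⟨e1, e2⟩ | ⟨e1, e2⟩
      · obtain ⟨t', s', g1, en', F', g2, g3⟩ := wp_delete (hB (lo (n + 1)) (hi (n + 1))) rfl hlast
          (by omega)
        refine ⟨t', s', ⟨fun h => by omega, fun _ => g1⟩, en', ix, F', K, ?_, ?_⟩
        · rw [e1, e2]
          exact g2
        · have := pot_tail_le (W := factor S (lo n) (hi n + 1))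
            (factor_ne_nil (by omega) (by omega))
          rw [factor_tail] at this
          rw [e1, e2]
          omega
      · have hsz := hsize (n + 1) hn
        have hr : hi n + 1 < S.length := e2 ▸ hhi
        rw [e1, e2] at hsz
        obtain ⟨t', s', g1, en', ix', F', K', g2, g3⟩ := wp_append (hB (lo (n + 1)) (hi (n + 1)))
          rfl e1 e2 hlast hr (by omega) hsz
        refine ⟨t', s', ⟨fun _ => g1, fun h => by omega⟩, en', ix', F', K', ?_, ?_⟩
        · rw [e1, e2]
          exact g2
        · rw [e1, e2]
          exact g3
    have hs : ∀ t, t ≤ n → Function.update s (n + 1) s' t = s t := fun t ht =>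
      Function.update_of_ne (by omega) _ _
    have hτ : ∀ t, t ≤ n → Function.update τ (n + 1) t' t = τ t := fun t ht =>
      Function.update_of_ne (by omega) _ _
    refine ⟨Function.update s (n + 1) s', Function.update τ (n + 1) t', ⟨?_, ?_, ?_⟩, ?_,
      en', ix', F', K', ?_, ?_⟩
    · rw [hs 0 (by omega), hτ 0 (by omega)]
      exact hrun.start
    · intro t ht hstep
      rcases Nat.lt_or_ge t n with h2 | h2
      · rw [hs t (by omega), hs (t + 1) (by omega), hτ (t + 1) (by omega)]
        exact hrun.append t h2 hstep
      · obtain rfl : t = n := by omega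
        rw [hs t le_rfl, Function.update_self, Function.update_self]
        exact hex.1 hstep
    · intro t ht hstep
      rcases Nat.lt_or_ge t n with h2 | h2
      · rw [hs t (by omega), hs (t + 1) (by omega), hτ (t + 1) (by omega)]
        exact hrun.delete t h2 hstep
      · obtain rfl : t = n := by omega
        rw [hs t le_rfl, Function.update_self, Function.update_self]
        exact hex.2 hstep
    · intro t ht
      rcases Nat.lt_or_ge n t with h2 | h2
      · obtain rfl : t = n + 1 := by omega
        rw [Function.update_self]
        exact ⟨en', ix', F', K', hinv'⟩
      · rw [hs t h2]
        exact hinv t h2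
    · rw [Function.update_self]
      exact hinv'
    · rw [Finset.sum_range_succ, Function.update_self]
      have : ∑ t ∈ Finset.range (n + 1), Function.update τ (n + 1) t' t =
          ∑ t ∈ Finset.range (n + 1), τ t :=
        Finset.sum_congr rfl fun t ht => hτ t (by have := Finset.mem_range.1 ht; omega)
      rw [this]
      omega

/-- Every operation advances exactly one end of the window. Hence `T + 1` is less than twice the
length of the text, which turns a bound per operation into a bound in `n`. -/
theorem lo_add_hi {α : Type} {S : List α} (hW : IsSlidingWindow S lo hi T) (t : ℕ) (ht : t ≤ T) :
    lo t + hi t = t := by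
  induction t with
  | zero => rw [hW.lo_zero, hW.hi_zero]
  | succ t ih =>
    have := ih (by omega)
    rcases hW.step t (by omega) with h | h <;> omega

end Run

end SlidingEertree

open SlidingEertree in
theorem mainTheorem2 :
    ∃ (A : WindowAlgorithm) (cTime cSpace cSpace' cWord : ℕ),
      ∀ (σ : ℕ) (S : List (Fin σ)) (lo hi : ℕ → ℕ) (T d : ℕ),
        IsSlidingWindow S lo hi T →
        (∀ t ≤ T, hi t - lo t + 1 ≤ d) →
        ∀ d' M : ℕ, d' = maxPal S lo hi T →
          M = (d' + 1) * σ + cSpace * d' + d →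
          M ≤ cSpace' * (d * σ) ∧
          ∀ (w : ℕ) (s₀ : RState),
            cWord * (S.length + d * σ) ≤ 2 ^ w →
            IsInitialState w σ d s₀ →
            ∃ (s : ℕ → RState) (τ : ℕ → ℕ) (pool : Finset ℕ),
              IsRun A S lo hi T w M s₀ s τ ∧
              ∑ t ∈ Finset.range (T + 1), τ t ≤ cTime * (S.length + d' * σ) ∧
              IsPool σ A.extra M pool ∧
              pool.card ≤ d' + 1 ∧
              ∀ t ≤ T, ∃ addr : ENode (Fin σ) → ℕ,
                StoresEertree A pool (substr S (lo t) (hi t)) (s t) addr := by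
  -- The time constant is `1400` per operation with fewer than `2n` operations; it also absorbs
  -- `20σK` with `K ≤ d' + 1 ≤ 2d'`. The `5(d' + 1)` extra words of the blocks are at most `10d'`.
  -- From `d' ≤ d + 1` follows `M ≤ 24dσ`, and `50` leaves room for `M + n + 16` in a word.
  refine ⟨algorithm, 2800, 10, 24, 50, fun σ S lo hi T d hW hd d' M hd' hM => ?_⟩
  have hS : 0 < S.length := by
    have := hW.hi_lt 0 (Nat.zero_le _)
    omega
  have hσ : 1 ≤ σ := by
    have := (S[0]).2
    omega
  have hd1 : 1 ≤ d := by
    have := hd 0 (Nat.zero_le _)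
    omega
  have hpal : ∀ t ≤ T, (pals (factor S (lo t) (hi t + 1))).ncard + 1 ≤ d' := by
    intro t ht
    have := Finset.le_sup (f := fun t => (DPal (substr S (lo t) (hi t))).ncard)
      (Finset.mem_range.2 (Nat.lt_succ_of_le ht))
    rw [← ncard_DPal, hd']
    exact this
  have hd'1 : 1 ≤ d' := by
    have := hpal 0 (Nat.zero_le _)
    omega
  have hd'd : d' ≤ d + 1 := by
    rw [hd']
    refine Finset.sup_le fun t ht => ?_
    have ht' := Finset.mem_range.1 ht
    have h1 := ncard_pals_le (factor S (lo t) (hi t + 1))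
    have h2 := hW.hi_lt t (by omega)
    have h3 := hd t (by omega)
    have h4 := hW.lo_le_hi t (by omega)
    rw [length_factor (by omega)] at h1
    rw [substr_eq_factor, ncard_DPal]
    omega
  have hdσ : d ≤ d * σ := Nat.le_mul_of_pos_right _ hσ
  have hσd : σ ≤ d * σ := Nat.le_mul_of_pos_left _ hd1
  have hMle : M ≤ 24 * (d * σ) := by
    have h1 : (d' + 1) * σ ≤ (d + 2) * σ := Nat.mul_le_mul_right _ (by omega)
    have h2 : (d + 2) * σ = d * σ + 2 * σ := by ring
    omega
  refine ⟨hMle, fun w s₀ hw hs₀ => ?_⟩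
  -- There are at most `d' - 1` nonempty palindromes in a window and two auxiliary nodes, hence `d'
  -- + 1` blocks.
  have hB : ∀ a b, Room (⟨w, M, S, a, b⟩ : REnv σ) d (d' + 1) := by
    intro a b
    refine ⟨hd1, ?_, ?_⟩
    · have h1 : blk σ d (d' + 1) = (d' + 1) * σ + 5 * d' + 5 + d := by
        unfold blk
        ring
      show blk σ d (d' + 1) ≤ M
      omega
    · show M + S.length + 16 < 2 ^ w
      omega
  obtain ⟨s, τ, hrun, hinv, en, ix, F, K, hlast, htime⟩ := exists_run hW hd hB
    (fun t ht => by have := hpal t ht; omega) hs₀.reg_zero hs₀.reg_one T le_rfl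
  refine ⟨s, τ, (Finset.range (d' + 1)).image (blk σ d), hrun, ?_, ⟨?_, ?_, ?_⟩, ?_, ?_⟩
  · have h1 := lo_add_hi hW T le_rfl
    have h2 := hW.lo_le_hi T le_rfl
    have h3 := hW.hi_lt T le_rfl
    have h4 : σ * K ≤ σ * (2 * d') := Nat.mul_le_mul_left _ (by have := hlast.K_le; omega)
    have h5 : σ * (2 * d') = 2 * (d' * σ) := by ring
    omega
  · intro a ha
    obtain ⟨k, -, rfl⟩ := Finset.mem_image.1 ha
    have := le_blk σ d k
    omega
  · intro a ha
    obtain ⟨k, hk, rfl⟩ := Finset.mem_image.1 ha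
    exact (hB 0 0).blk_le (Finset.mem_range.1 hk)
  · intro a ha b hb hab
    obtain ⟨k, -, rfl⟩ := Finset.mem_image.1 ha
    obtain ⟨k', -, rfl⟩ := Finset.mem_image.1 hb
    refine blk_lt_blk ?_
    by_contra h
    have := blk_mono (σ := σ) (d := d) (Nat.le_of_not_lt h)
    omega
  · exact Finset.card_image_le.trans (by simp)
  · intro t ht
    obtain ⟨en, ix, F, K, h⟩ := hinv t ht
    exact ⟨_, h.storesEertree fun k hk =>
      Finset.mem_image.2 ⟨k, Finset.mem_range.2 hk, rfl⟩⟩
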